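/- Let $L\ge 1$, let $X_k,Y_k,Z_k$ be the Pauli operators on site $k$ of a chain of qubits with sites $0,\dots,L+1$, and put $$t_j^A=X_{j-1}X_jZ_{j+1},\qquad t_j^B=Z_{j-2}Y_{j-1}Y_j,\qquad t_j^C=Z_{j-1}Z_{j+1}.$$ For real $a_1,\dots,a_L,b_1,\dots,b_L$ let $A_j=a_{j-1}a_jt_j^A$, $B_j=b_{j-1}b_jt_j^B$ ($2\le j\le L$) and $C_j=a_jb_jt_j^C$ ($1\le j\le L$). The transfer matrix $T_L(v)$ is defined, with $T_0=T_{-1}=T^A_0=T^A_1=T^B_0=T^B_1=1$, by $$T_m=T^A_m+T^B_m-T_{m-1}-vC_mT_{m-2},\quad T^A_{m+1}=T_m-vA_{m+1}T^B_{m-1},\quad T^B_{m+1}=T_m-vB_{m+1}T^A_{m-1}\qquad(m\ge1),$$ and the real polynomial $P_L(v^2)$ by the same recursion with $vA_j,vB_j,vC_j$ replaced by the scalars $v^2(a_{j-1}a_j)^2$, $v^2(b_{j-1}b_j)^2$, $v^2(a_jb_j)^2$. For a family of operators $g_j^x$ write $$G_L=g_1^C(g_2^Bg_2^Ag_2^C)\cdots(g_L^Bg_L^Ag_L^C),\qquad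 G_L^\top=(g_L^Cg_L^Ag_L^B)\cdots(g_2^Cg_2^Ag_2^B)g_1^C .$$ Complex angles $\phi_j^x$ ($x=A,B,C$, $0\le j\le L$) are said to satisfy the angle recursion at $v$ if $\phi_0^A=\phi_0^B=\phi_0^C=\phi_1^A=\phi_1^B=0$ and $$\sin\phi_{j+1}^A=-\frac{v\,a_ja_{j+1}}{\cos\phi_{j-1}^C\cos\phi_{j-1}^A\cos\phi_j^A\cos\phi_j^B\cos\phi_j^C},\qquad \sin\phi_{j+1}^B=-\frac{v\,b_jb_{j+1}}{\cos\phi_{j-1}^C\cos\phi_{j-1}^B\cos\phi_j^A\cos\phi_j^B\cos\phi_j^C}\qquad(1\le j<L),$$ $$\sin\phi_{j+1}^C=-\frac{v\,a_{j+1}b_{j+1}}{\cos^2\phi_j^C\cos\phi_j^A\cos\phi_j^B\cos\phi_{j+1}^A\cos\phi_{j+1}^B}\qquad(0\le j<L).$$ The gates are $g_j^x=\cos\frac{\phi_j^x}2+t_j^x\sin\frac{\phi_j^x}2$. A unitary operator $V$ is called free fermionic with quasi-energies $\eta_1,\dots,\eta_n\in\mathbb R$ if its set of eigenvalues is $\{\prod_ke^{\pm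 i\eta_k}\}$ (all independent choices of signs) and, when no two choices of signs give the same number, all eigenvalues have the same multiplicity. **(1)** For $v=iy$ with $y\in\mathbb R$ there is exactly one solution of the angle recursion of the form $\phi_j^x=i\theta_j^x$ with all $\theta_j^x$ real ($0\le j\le L$). **(2)** For this solution let $\varphi_j^x\in(-\pi/4,\pi/4)$ be given by $\tan\varphi_j^x=\tanh(\theta_j^x/2)$, and let $u_j^x=e^{i\varphi_j^xt_j^x}$. Then: * $T_L(iy)=G_LG_L^\top$ with the gates $g_j^x=\cosh\frac{\theta_j^x}2+i\,t_j^x\sinh\frac{\theta_j^x}2$, and $u_j^x=g_j^x/\sqrt{\cosh\theta_j^x}$. The $u_j^x$ are unitary and act only on the sites that appear in $t_j^x$. * The $\theta_j^x$ satisfy the angle recursion with $\sin,\cos,v$ replaced by $\sinh,\cosh,y$. The $\varphi_j^x$ vanish where the $\theta_j^x$ are prescribed to vanish, and $$\tan2\varphi_{j+1}^A=-y\,a_ja_{j+1}\cos2\varphi_{j-1}^C\cos2\varphi_{j-1}^A\cos2\varphi_j^A\cos2\varphi_j^B\cos2\varphi_j^C\qquad(1\le j<L),$$ $$\tan2\varphi_{j+1}^B=-y\,b_jb_{j+1}\cos2\varphi_{j-1}^C\cos2\varphi_{j-1}^B\cos2\varphi_j^A\cos2\varphi_j^B\cos2\varphi_j^C\qquad(1\le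 j<L),$$ $$\tan2\varphi_{j+1}^C=-y\,a_{j+1}b_{j+1}\cos^22\varphi_j^C\cos2\varphi_j^A\cos2\varphi_j^B\cos2\varphi_{j+1}^A\cos2\varphi_{j+1}^B\qquad(0\le j<L).$$ * $\tan2\varphi_{j-1}^C\tan2\varphi_j^C=\sin2\varphi_j^A\sin2\varphi_j^B$ for $2\le j\le L$. * Let $V=G_LG_L^\top$ be the circuit built from the gates $u_j^x$ in place of $g_j^x$. Then $T_L(iy)=\Big(\cosh\theta_1^C\prod_{j=2}^L\cosh\theta_j^A\cosh\theta_j^B\cosh\theta_j^C\Big)V$. * $P_L$ has degree $n\le\lfloor(L+1)/2\rfloor$, with equality if all $a_j,b_j$ are non-zero, and its $n$ roots (with multiplicity) are positive real numbers $\tilde v_1^2,\dots,\tilde v_n^2$, with $\tilde v_k>0$. With $\varepsilon_k=1/\tilde v_k$, the eigenvalues of $V$ are exactly the numbers $$\prod_{k=1}^n\frac{1\pm iy\varepsilon_k}{\sqrt{1+y^2\varepsilon_k^2}}$$ with independent signs, and $V$ is free fermionic with quasi-energies $\arctan(y\varepsilon_k)$. (For $y=1$ the eigenvalues are $\prod_k(1\pm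 i\varepsilon_k)/\sqrt{1+\varepsilon_k^2}$.) **(3)** Conversely, let $y\ne0$ and let real angles $\varphi_j^x$ ($0\le j\le L$) with $\varphi_0^A=\varphi_0^B=\varphi_0^C=\varphi_1^A=\varphi_1^B=0$ satisfy $\cos2\varphi_j^x\ne0$ for all $x$, $j$, $\tan2\varphi_j^C\neq0$ for $1\le j<L$, and the constraint $\tan2\varphi_{j-1}^C\tan2\varphi_j^C=\sin2\varphi_j^A\sin2\varphi_j^B$ for $2\le j\le L$. Then there are real $a_j,b_j$ for which the $\varphi_j^x$ satisfy the three recursions for $\tan2\varphi$ in (2). If moreover all $|\varphi_j^x|<\pi/4$, then the $\varphi_j^x$ are the angles that (2) assigns to these $a_j,b_j$ and $y$. -/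

import Mathlib

namespace FFCircuit

/-! ### Spin chain with `N` sites, labelled `0, …, N - 1` -/

/-- Operators on `(ℂ²)^{⊗N}`, as matrices in the computational basis, whose elements are the
configurations `Fin N → Fin 2`. -/
abbrev Op (N : ℕ) := Matrix (Fin N → Fin 2) (Fin N → Fin 2) ℂ

def pauliX : Matrix (Fin 2) (Fin 2) ℂ := !![0, 1; 1, 0]

def pauliY : Matrix (Fin 2) (Fin 2) ℂ := !![0, -Complex.I; Complex.I, 0]

def pauliZ : Matrix (Fin 2) (Fin 2) ℂ := !![1, 0; 0, -1]

/-- The tensor product `1 ⊗ ⋯ ⊗ P ⊗ ⋯ ⊗ 1` with `P` acting on site `k`. -/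
def siteOp (N : ℕ) (P : Matrix (Fin 2) (Fin 2) ℂ) (k : ℕ) : Op N :=
  Matrix.of fun s s' =>
    ∏ i : Fin N, (if (i : ℕ) = k then P else (1 : Matrix (Fin 2) (Fin 2) ℂ)) (s i) (s' i)

/-- The operators that act only on the sites in `S`: the algebra generated by the one-site
operators on the sites in `S`. -/
def ActsOn {N : ℕ} (S : Set ℕ) (M : Op N) : Prop :=
  M ∈ Algebra.adjoin ℂ {O : Op N | ∃ k ∈ S, ∃ P, O = siteOp N P k}

/-- The three kinds of terms in the Hamiltonian. -/
inductive Kind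
  | A
  | B
  | C

/-- `t_j^A = X_{j-1} X_j Z_{j+1}`, `t_j^B = Z_{j-2} Y_{j-1} Y_j`, `t_j^C = Z_{j-1} Z_{j+1}`. -/
noncomputable def t (N : ℕ) : Kind → ℕ → Op N
  | .A, j => siteOp N pauliX (j - 1) * siteOp N pauliX j * siteOp N pauliZ (j + 1)
  | .B, j => siteOp N pauliZ (j - 2) * siteOp N pauliY (j - 1) * siteOp N pauliY j
  | .C, j => siteOp N pauliZ (j - 1) * siteOp N pauliZ (j + 1)

/-- The sites on which `t_j^x` acts. -/
def sites : Kind → ℕ → Set ℕ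
  | .A, j => {j - 1, j, j + 1}
  | .B, j => {j - 2, j - 1, j}
  | .C, j => {j - 1, j + 1}

/-- The terms present in the model of size `L`: `C_1`, and `A_j, B_j, C_j` for `2 ≤ j ≤ L`. -/
def IsTerm (L : ℕ) (x : Kind) (j : ℕ) : Prop :=
  1 ≤ j ∧ j ≤ L ∧ (j = 1 → x = Kind.C)

/-- The coupling in front of `t_j^x`: `a_{j-1} a_j`, `b_{j-1} b_j`, `a_j b_j`. -/
def coupling (a b : ℕ → ℝ) : Kind → ℕ → ℝ
  | .A, j => a (j - 1) * a j
  | .B, j => b (j - 1) * b j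
  | .C, j => a j * b j

/-! ### Transfer matrix and polynomials -/

/- The coupled recursions
  `F_m = F^A_m + F^B_m - F_{m-1} - c_m^C F_{m-2}`,
  `F^A_{m+1} = F_m - c_{m+1}^A F^B_{m-1}`,
  `F^B_{m+1} = F_m - c_{m+1}^B F^A_{m-1}` for `m > 0`,
with `F_0 = F_{-1} = F^A_0 = F^A_1 = F^B_0 = F^B_1 = 1`. -/
mutual

def fam {R : Type} [Ring R] (c : Kind → ℕ → R) : ℕ → R
  | 0 => 1
  | 1 => famA c 1 + famB c 1 - fam c 0 - c .C 1 * 1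
  | m + 2 => famA c (m + 2) + famB c (m + 2) - fam c (m + 1) - c .C (m + 2) * fam c m
termination_by m => (m, 1)

def famA {R : Type} [Ring R] (c : Kind → ℕ → R) : ℕ → R
  | 0 => 1
  | 1 => 1
  | m + 2 => fam c (m + 1) - c .A (m + 2) * famB c m
termination_by m => (m, 0)

def famB {R : Type} [Ring R] (c : Kind → ℕ → R) : ℕ → R
  | 0 => 1
  | 1 => 1
  | m + 2 => fam c (m + 1) - c .B (m + 2) * famA c m
termination_by m => (m, 0)

end

/-- The transfer matrix `T_L(v)`, on the chain with sites `0, …, L + 1`. -/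
noncomputable def transferMatrix (L : ℕ) (a b : ℕ → ℝ) (v : ℂ) : Op (L + 2) :=
  fam (fun x j => (v * (coupling a b x j : ℂ)) • t (L + 2) x j) L

/-- The polynomial `P_L`, in the variable `v²`. -/
noncomputable def polyP (L : ℕ) (a b : ℕ → ℝ) : Polynomial ℝ :=
  fam (fun x j => Polynomial.X * Polynomial.C (coupling a b x j ^ 2)) L

/-! ### Staircase products -/

/-- `G_L = g_1^C (g_2^B g_2^A g_2^C) ⋯ (g_L^B g_L^A g_L^C)`. -/
def stairG {M : Type} [Monoid M] (g : Kind → ℕ → M) : ℕ → M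
  | 0 => 1
  | 1 => g .C 1
  | m + 2 => stairG g (m + 1) * (g .B (m + 2) * g .A (m + 2) * g .C (m + 2))

/-- `G_L^⊤ = (g_L^C g_L^A g_L^B) ⋯ (g_2^C g_2^A g_2^B) g_1^C`. -/
def stairGT {M : Type} [Monoid M] (g : Kind → ℕ → M) : ℕ → M
  | 0 => 1
  | 1 => g .C 1
  | m + 2 => (g .C (m + 2) * g .A (m + 2) * g .B (m + 2)) * stairGT g (m + 1)

/-- `g_j^x = cos(ϕ_j^x / 2) + t_j^x sin(ϕ_j^x / 2)`, for complex angles `ϕ_j^x`. -/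
noncomputable def gateG (N : ℕ) (ϕ : Kind → ℕ → ℂ) (x : Kind) (j : ℕ) : Op N :=
  Complex.cos (ϕ x j / 2) • (1 : Op N) + Complex.sin (ϕ x j / 2) • t N x j

/-- `u_j^x = exp(i φ_j^x t_j^x)`, for real angles `φ_j^x`. -/
noncomputable def gateU (N : ℕ) (φ : Kind → ℕ → ℝ) (x : Kind) (j : ℕ) : Op N :=
  NormedSpace.exp ((Complex.I * (φ x j : ℂ)) • t N x j)

/-- The circuit `V = G_L G_L^⊤` built from the gates `u_j^x`. -/
noncomputable def circuit (L : ℕ) (φ : Kind → ℕ → ℝ) : Op (L + 2) :=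
  stairG (gateU (L + 2) φ) L * stairGT (gateU (L + 2) φ) L

/-! ### Angle recursions -/

/-- Initial conditions shared by all the families of angles. -/
def InitialZero {R : Type} [Zero R] (ϕ : Kind → ℕ → R) : Prop :=
  (∀ x, ϕ x 0 = 0) ∧ ϕ .A 1 = 0 ∧ ϕ .B 1 = 0

/-- The complex angles of the local factors of `T_L(v)`. -/
structure AngleRecursion (L : ℕ) (a b : ℕ → ℝ) (v : ℂ) (ϕ : Kind → ℕ → ℂ) : Prop where
  init : InitialZero ϕ
  recA : ∀ j, 1 ≤ j → j < L → Complex.sin (ϕ .A (j + 1)) =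
    -(v * a j * a (j + 1) /
      (Complex.cos (ϕ .C (j - 1)) * Complex.cos (ϕ .A (j - 1)) * Complex.cos (ϕ .A j) *
        Complex.cos (ϕ .B j) * Complex.cos (ϕ .C j)))
  recB : ∀ j, 1 ≤ j → j < L → Complex.sin (ϕ .B (j + 1)) =
    -(v * b j * b (j + 1) /
      (Complex.cos (ϕ .C (j - 1)) * Complex.cos (ϕ .B (j - 1)) * Complex.cos (ϕ .A j) *
        Complex.cos (ϕ .B j) * Complex.cos (ϕ .C j)))
  recC : ∀ j, j < L → Complex.sin (ϕ .C (j + 1)) =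
    -(v * a (j + 1) * b (j + 1) /
      (Complex.cos (ϕ .C j) ^ 2 * Complex.cos (ϕ .A j) * Complex.cos (ϕ .B j) *
        Complex.cos (ϕ .A (j + 1)) * Complex.cos (ϕ .B (j + 1))))

/-- The recursion for the real hyperbolic angles `θ_j^x`, where `ϕ_j^x = i θ_j^x` and `v = i y`. -/
structure HyperbolicRecursion (L : ℕ) (a b : ℕ → ℝ) (y : ℝ) (θ : Kind → ℕ → ℝ) : Prop where
  init : InitialZero θ
  recA : ∀ j, 1 ≤ j → j < L → Real.sinh (θ .A (j + 1)) =
    -(y * a j * a (j + 1) /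
      (Real.cosh (θ .C (j - 1)) * Real.cosh (θ .A (j - 1)) * Real.cosh (θ .A j) *
        Real.cosh (θ .B j) * Real.cosh (θ .C j)))
  recB : ∀ j, 1 ≤ j → j < L → Real.sinh (θ .B (j + 1)) =
    -(y * b j * b (j + 1) /
      (Real.cosh (θ .C (j - 1)) * Real.cosh (θ .B (j - 1)) * Real.cosh (θ .A j) *
        Real.cosh (θ .B j) * Real.cosh (θ .C j)))
  recC : ∀ j, j < L → Real.sinh (θ .C (j + 1)) =
    -(y * a (j + 1) * b (j + 1) /
      (Real.cosh (θ .C j) ^ 2 * Real.cosh (θ .A j) * Real.cosh (θ .B j) *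
        Real.cosh (θ .A (j + 1)) * Real.cosh (θ .B (j + 1))))

/-- The recursion for the circuit angles `φ_j^x`. -/
structure CircuitRecursion (L : ℕ) (a b : ℕ → ℝ) (y : ℝ) (φ : Kind → ℕ → ℝ) : Prop where
  init : InitialZero φ
  recA : ∀ j, 1 ≤ j → j < L → Real.tan (2 * φ .A (j + 1)) =
    -(y * a j * a (j + 1) * Real.cos (2 * φ .C (j - 1)) * Real.cos (2 * φ .A (j - 1)) *
      Real.cos (2 * φ .A j) * Real.cos (2 * φ .B j) * Real.cos (2 * φ .C j))
  recB : ∀ j, 1 ≤ j → j < L → Real.tan (2 * φ .B (j + 1)) =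
    -(y * b j * b (j + 1) * Real.cos (2 * φ .C (j - 1)) * Real.cos (2 * φ .B (j - 1)) *
      Real.cos (2 * φ .A j) * Real.cos (2 * φ .B j) * Real.cos (2 * φ .C j))
  recC : ∀ j, j < L → Real.tan (2 * φ .C (j + 1)) =
    -(y * a (j + 1) * b (j + 1) * Real.cos (2 * φ .C j) ^ 2 * Real.cos (2 * φ .A j) *
      Real.cos (2 * φ .B j) * Real.cos (2 * φ .A (j + 1)) * Real.cos (2 * φ .B (j + 1)))

/-- The angle `φ` in `(-π/4, π/4)` with `tan φ_j^x = tanh(θ_j^x / 2)`. -/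
noncomputable def circuitAngle (θ : Kind → ℕ → ℝ) (x : Kind) (j : ℕ) : ℝ :=
  Real.arctan (Real.tanh (θ x j / 2))

/-- `tan 2φ_{j-1}^C tan 2φ_j^C = sin 2φ_j^A sin 2φ_j^B` for `2 ≤ j ≤ L`. -/
def AngleConstraint (L : ℕ) (φ : Kind → ℕ → ℝ) : Prop :=
  ∀ j, 2 ≤ j → j ≤ L → Real.tan (2 * φ .C (j - 1)) * Real.tan (2 * φ .C j) =
    Real.sin (2 * φ .A j) * Real.sin (2 * φ .B j)

/-! ### Free fermionic unitary operators -/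

/-- The product `∏_k e^{± i η_k}` for the choice `s` of signs. -/
noncomputable def signProd {n : ℕ} (η : Fin n → ℝ) (s : Fin n → ℤˣ) : ℂ :=
  ∏ k, Complex.exp (Complex.I * (((s k : ℤ) : ℝ) * η k : ℝ))

/-- The unitary operator `V` is free fermionic with quasi-energies `η_1, …, η_n`: its eigenvalues
are the numbers `∏_k e^{± i η_k}` with independent signs, and for generic `η` (no two choices of
signs give the same number) all eigenvalues have the same degeneracy. -/
def IsFreeFermionic {ι : Type} [Fintype ι] [DecidableEq ι] (V : Matrix ι ι ℂ) {n : ℕ}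
    (η : Fin n → ℝ) : Prop :=
  V ∈ Matrix.unitaryGroup ι ℂ ∧
  spectrum ℂ V = Set.range (signProd η) ∧
  (Function.Injective (signProd η) →
    ∃ d : ℕ, ∀ z ∈ spectrum ℂ V,
      Module.finrank ℂ (Module.End.eigenspace (Matrix.toLin' V) z) = d)

end FFCircuit

-- The spectrum is governed by two algebraic facts about the transfer matrix: T(v) and T(w) commute,
-- and T(v)T(-v) is the scalar P(v²). Unitarity comes from a third fact, a factorization of T(v)
-- into gates. All three use only the relations collected in `TermRel`: any two terms commute or
-- anticommute, and A_{j+1}B_{j+1} = -C_j C_{j+1}.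
--
-- Commutation is one item in a closed system of bilinear relations between the families at v and at
-- w, proved by induction in `exchangeRel`. Two symmetries keep the induction small: exchanging A
-- and B, and the observation that T^B is T with its last a-coupling set to zero. At w = -v the
-- mixed terms cancel, and `sT_mul_sT_neg` leaves the recursion of P.
--
-- For the factorization, the square of a gate is 1 + u sin ϕ, and multiplying an anticommuting term
-- by the gate from both sides only produces the factor cos ϕ. The angle recursion is precisely what
-- makes the staircase product obey the recursion of T (`sT_eq_blockProd`). At v = iy the sines
-- become i sinh and the cosines cosh, so each step of the recursion has exactly one real solution,
-- given by arsinh. Every gate is then a positive multiple of a unitary, and T(iy) = ρV with ρ > 0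
-- and V unitary.
--
-- For the eigenvalues, take a joint eigenvector of all T(w). Its eigenvalue is a polynomial q(w)
-- with q(0) = 1 and q(w)q(-w) = ∏(1 - ε_k²w²), hence q = ∏(1 ± ε_k w)
-- (`exists_sign_of_isRoot_charpoly`). That each choice of signs occurs, and equally often, is shown
-- by deformation. The couplings are joined by a line to a decoupled point where T is diagonal
-- (`exists_charpoly_decoupled`). Over an algebraic closure of ℂ(X) the characteristic polynomial is
-- described by one fixed multiset of sign choices, which specializes to every point of the line
-- (`exists_multiset_charpoly_curve`) and is determined at the decoupled end.
--
-- The roots of P are positive because V is unitary: at y = 1 all products ∏(1 ± iε_k) have the same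
-- modulus, so |1 + iε_k| = |1 - iε_k| and ε_k is real (`exists_real_rootProd`). For the converse,
-- couplings are solved for level by level from the A and B recursions, and the constraint then
-- supplies the C recursion (`circuitRecursion_couplingsOf`).

namespace FFCircuit

/-! ### The recursion with uniform indices -/

section Recursion

variable {𝒜 : Type} [Ring 𝒜]

/-- The families `fam`, `famA`, `famB` depend only on the terms that are present. -/
theorem fam_congr {c c' : Kind → ℕ → 𝒜} (L : ℕ) (h : ∀ x j, IsTerm L x j → c x j = c' x j) :
    ∀ m, m ≤ L → fam c m = fam c' m ∧ famA c m = famA c' m ∧ famB c m = famB c' m := by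
  intro m
  induction m using Nat.strong_induction_on with
  | _ m ih =>
    intro hm
    match m, ih, hm with
    | 0, _, _ => simp [fam, famA, famB]
    | 1, _, hm => simp [fam, famA, famB, h .C 1 ⟨le_rfl, hm, fun _ => rfl⟩]
    | m + 2, ih, hm =>
      obtain ⟨h1, -, -⟩ := ih (m + 1) (by omega) (by omega)
      obtain ⟨h2, h3, h4⟩ := ih m (by omega) (by omega)
      have hA := h .A (m + 2) ⟨by omega, hm, by omega⟩
      have hB := h .B (m + 2) ⟨by omega, hm, by omega⟩
      have hC := h .C (m + 2) ⟨by omega, hm, by omega⟩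
      simp only [fam, famA, famB, h1, h2, h3, h4, hA, hB, hC, and_self]

theorem map_fam {ℬ : Type} [Ring ℬ] (f : 𝒜 →+* ℬ) (c : Kind → ℕ → 𝒜) (m : ℕ) :
    f (fam c m) = fam (fun x j => f (c x j)) m ∧ f (famA c m) = famA (fun x j => f (c x j)) m ∧
      f (famB c m) = famB (fun x j => f (c x j)) m := by
  induction m using Nat.strong_induction_on with
  | _ m ih =>
    match m, ih with
    | 0, _ => simp [fam, famA, famB]
    | 1, _ => simp [fam, famA, famB]
    | m + 2, ih =>
      obtain ⟨h1, -, -⟩ := ih (m + 1) (by omega)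
      obtain ⟨h2, h3, h4⟩ := ih m (by omega)
      simp only [fam, famA, famB, map_sub, map_add, map_mul, h1, h2, h3, h4, and_self]

/-- `T_{n-2}`, with `T_{-2} = T_{-1} = 1`. -/
def shiftT (c : Kind → ℕ → 𝒜) : ℕ → 𝒜
  | 0 => 1
  | 1 => 1
  | n + 2 => fam c n

/-- `T^A_{n-2}`, with `T^A_{-2} = T^A_{-1} = 1`. -/
def shiftTA (c : Kind → ℕ → 𝒜) : ℕ → 𝒜
  | 0 => 1
  | 1 => 1
  | n + 2 => famA c n

/-- `T^B_{n-2}`, with `T^B_{-2} = T^B_{-1} = 1`. -/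
def shiftTB (c : Kind → ℕ → 𝒜) : ℕ → 𝒜
  | 0 => 1
  | 1 => 1
  | n + 2 => famB c n

/-- The terms outside the chain vanish. -/
structure LowZero (c : Kind → ℕ → 𝒜) : Prop where
  zero : ∀ x, c x 0 = 0
  A1 : c .A 1 = 0
  B1 : c .B 1 = 0

theorem LowZero.shiftTA_succ {c : Kind → ℕ → 𝒜} (h : LowZero c) (n : ℕ) :
    shiftTA c (n + 2) = shiftT c (n + 1) - c .A n * shiftTB c n := by
  match n with
  | 0 => simp [shiftTA, shiftT, famA, h.zero]
  | 1 => simp [shiftTA, shiftT, famA, h.A1, fam]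
  | n + 2 => simp [shiftTA, shiftT, shiftTB, famA]

theorem LowZero.shiftTB_succ {c : Kind → ℕ → 𝒜} (h : LowZero c) (n : ℕ) :
    shiftTB c (n + 2) = shiftT c (n + 1) - c .B n * shiftTA c n := by
  match n with
  | 0 => simp [shiftTB, shiftT, famB, h.zero]
  | 1 => simp [shiftTB, shiftT, famB, h.B1, fam]
  | n + 2 => simp [shiftTA, shiftT, shiftTB, famB]

/-- T^A and T^B of the current level are eliminated here. The index shift and the vanishing of the
terms outside the chain make the recursion hold from n = 0 on, so later inductions meet no
exceptional step at the end of the chain. -/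
theorem LowZero.shiftT_succ {c : Kind → ℕ → 𝒜} (h : LowZero c) (n : ℕ) :
    shiftT c (n + 2) = shiftT c (n + 1) - c .A n * shiftTB c n - c .B n * shiftTA c n
      - c .C n * shiftT c n := by
  match n with
  | 0 => simp [shiftT, fam, h.zero]
  | 1 => simp [shiftT, fam, h.A1, h.B1, famA, famB]
  | n + 2 =>
    simp only [shiftTA, shiftT, shiftTB, fam, famA, famB]
    abel

end Recursion

/-! ### The algebra of the terms -/

/-- The sign in `t_j^x t_{j+d}^y = ± t_{j+d}^y t_j^x`. -/
def exchangeSign : Kind → Kind → ℕ → ℤ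
  | .A, .A, 1 => -1
  | .A, .A, 2 => -1
  | .B, .B, 1 => -1
  | .B, .B, 2 => -1
  | .A, .B, 1 => -1
  | .B, .A, 1 => -1
  | .A, .C, 0 => -1
  | .A, .C, 1 => -1
  | .B, .C, 0 => -1
  | .B, .C, 1 => -1
  | .C, .A, 0 => -1
  | .C, .A, 1 => -1
  | .C, .A, 2 => -1
  | .C, .B, 0 => -1
  | .C, .B, 1 => -1
  | .C, .B, 2 => -1
  | _, _, _ => 1

/-- The relations between the terms; terms outside the chain are set to zero. -/
structure TermRel {𝒜 : Type} [Ring 𝒜] (u : Kind → ℕ → 𝒜) : Prop extends LowZero u where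
  comm : ∀ x y j d, u x j * u y (j + d) = exchangeSign x y d • (u y (j + d) * u x j)
  mulAB : ∀ j, u .A (j + 1) * u .B (j + 1) = -(u .C j * u .C (j + 1))

/-- `a_{j-1} a_j`, `b_{j-1} b_j`, `a_j b_j` -/
def couplingR {R : Type} [CommRing R] (a b : ℕ → R) : Kind → ℕ → R
  | .A, j => a (j - 1) * a j
  | .B, j => b (j - 1) * b j
  | .C, j => a j * b j

def Kind.swap : Kind → Kind
  | .A => .B
  | .B => .A
  | .C => .C

/-- The exchange signs are symmetric in A and B, and A_j commutes with B_j, so the product relation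
can be read in either order. Every statement about A thus has a mirror image for B. -/
theorem TermRel.swap {𝒜 : Type} [Ring 𝒜] {u : Kind → ℕ → 𝒜} (h : TermRel u) :
    TermRel (fun x j => u x.swap j) where
  zero x := h.zero _
  A1 := h.B1
  B1 := h.A1
  comm x y j d := by
    rw [h.comm]
    congr 1
    rcases x <;> rcases y <;> match d with
      | 0 => rfl
      | 1 => rfl
      | 2 => rfl
      | _ + 3 => rfl
  mulAB j := by
    have := h.comm .B .A (j + 1) 0
    simp only [exchangeSign, one_smul, add_zero] at this
    simp only [Kind.swap]
    rw [this, h.mulAB]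

section Families

variable {R : Type} [CommRing R] {𝒜 : Type} [Ring 𝒜] [Algebra R 𝒜]

def term (u : Kind → ℕ → 𝒜) (a b : ℕ → R) (v : R) (x : Kind) (j : ℕ) : 𝒜 :=
  (v * couplingR a b x j) • u x j

def sT (u : Kind → ℕ → 𝒜) (a b : ℕ → R) (v : R) (n : ℕ) : 𝒜 := shiftT (term u a b v) n
def sA (u : Kind → ℕ → 𝒜) (a b : ℕ → R) (v : R) (n : ℕ) : 𝒜 := shiftTA (term u a b v) n
def sB (u : Kind → ℕ → 𝒜) (a b : ℕ → R) (v : R) (n : ℕ) : 𝒜 := shiftTB (term u a b v) n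

variable {u : Kind → ℕ → 𝒜}

theorem LowZero.term (h : LowZero u) (a b : ℕ → R) (v : R) : LowZero (term u a b v) where
  zero x := by simp [FFCircuit.term, h.zero]
  A1 := by simp [FFCircuit.term, h.A1]
  B1 := by simp [FFCircuit.term, h.B1]

theorem LowZero.sT_succ (h : LowZero u) (a b : ℕ → R) (v : R) (n : ℕ) :
    sT u a b v (n + 2) = sT u a b v (n + 1) - (v * couplingR a b .A n) • (u .A n * sB u a b v n)
      - (v * couplingR a b .B n) • (u .B n * sA u a b v n)
      - (v * couplingR a b .C n) • (u .C n * sT u a b v n) := by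
  simp only [sT, sA, sB, (h.term a b v).shiftT_succ, FFCircuit.term, smul_mul_assoc]

theorem LowZero.sA_succ (h : LowZero u) (a b : ℕ → R) (v : R) (n : ℕ) :
    sA u a b v (n + 2) =
      sT u a b v (n + 1) - (v * couplingR a b .A n) • (u .A n * sB u a b v n) := by
  simp only [sT, sA, sB, (h.term a b v).shiftTA_succ, FFCircuit.term, smul_mul_assoc]

theorem LowZero.sB_succ (h : LowZero u) (a b : ℕ → R) (v : R) (n : ℕ) :
    sB u a b v (n + 2) =
      sT u a b v (n + 1) - (v * couplingR a b .B n) • (u .B n * sA u a b v n) := by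
  simp only [sT, sA, sB, (h.term a b v).shiftTB_succ, FFCircuit.term, smul_mul_assoc]

@[simp] theorem sT_zero (a b : ℕ → R) (v : R) : sT u a b v 0 = 1 := rfl
@[simp] theorem sT_one (a b : ℕ → R) (v : R) : sT u a b v 1 = 1 := rfl
@[simp] theorem sA_zero (a b : ℕ → R) (v : R) : sA u a b v 0 = 1 := rfl
@[simp] theorem sA_one (a b : ℕ → R) (v : R) : sA u a b v 1 = 1 := rfl
@[simp] theorem sB_zero (a b : ℕ → R) (v : R) : sB u a b v 0 = 1 := rfl
@[simp] theorem sB_one (a b : ℕ → R) (v : R) : sB u a b v 1 = 1 := rfl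

theorem LowZero.swap_families (h : LowZero u) (a b : ℕ → R) (v : R) (n : ℕ) :
    sT (fun x j => u x.swap j) b a v n = sT u a b v n ∧
    sA (fun x j => u x.swap j) b a v n = sB u a b v n ∧
    sB (fun x j => u x.swap j) b a v n = sA u a b v n := by
  have h' : LowZero (fun x j => u x.swap j) := ⟨fun x => h.zero _, h.B1, h.A1⟩
  induction n using Nat.strong_induction_on with
  | _ n ih =>
    match n, ih with
    | 0, _ => simp
    | 1, _ => simp
    | n + 2, ih =>
      obtain ⟨h1, -, -⟩ := ih (n + 1) (by omega)
      obtain ⟨h2, h3, h4⟩ := ih n (by omega)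
      rw [h'.sT_succ, h'.sA_succ, h'.sB_succ, h.sT_succ, h.sA_succ, h.sB_succ, h1, h2, h3, h4]
      simp only [couplingR, Kind.swap, and_self, and_true, mul_comm (b n) (a n)]
      abel

/-- The families up to level `n - 2` only involve couplings with index at most `n - 2`. -/
theorem LowZero.families_congr (h : LowZero u) {a a' b b' : ℕ → R} (v : R) (n : ℕ)
    (ha : ∀ j, j + 2 ≤ n → a j = a' j) (hb : ∀ j, j + 2 ≤ n → b j = b' j) :
    sT u a b v n = sT u a' b' v n ∧ sA u a b v n = sA u a' b' v n ∧
      sB u a b v n = sB u a' b' v n := by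
  induction n using Nat.strong_induction_on with
  | _ n ih =>
    match n, ih with
    | 0, _ => simp
    | 1, _ => simp
    | n + 2, ih =>
      obtain ⟨h1, -, -⟩ := ih (n + 1) (by omega) (fun j hj => ha j (by omega))
        (fun j hj => hb j (by omega))
      obtain ⟨h2, h3, h4⟩ := ih n (by omega) (fun j hj => ha j (by omega))
        (fun j hj => hb j (by omega))
      rw [h.sT_succ, h.sA_succ, h.sB_succ, h.sT_succ, h.sA_succ, h.sB_succ, h1, h2, h3, h4]
      simp only [couplingR, ha n le_rfl, hb n le_rfl, ha (n - 1) (by omega), hb (n - 1) (by omega),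
        and_self]

/-- At its last level T differs from T^B only by the terms A and C, and these are exactly the ones
containing the last a-coupling. Relations proved for T with arbitrary couplings therefore specialize
to T^B. -/
theorem LowZero.sT_update (h : LowZero u) (a b : ℕ → R) (v : R) (n : ℕ) :
    sT u (Function.update a (n - 2) 0) b v n = sB u a b v n := by
  match n with
  | 0 => simp
  | 1 => simp
  | n + 2 =>
    have key : ∀ j, j + 2 ≤ n + 1 → Function.update a n 0 j = a j := fun j hj =>
      Function.update_of_ne (by omega) _ _
    obtain ⟨h1, -, -⟩ := h.families_congr (a' := a) (b' := b) v (n + 1) key (fun _ _ => rfl)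
    obtain ⟨-, h2, -⟩ := h.families_congr (a' := a) (b' := b) v n
      (fun j hj => key j (by omega)) (fun _ _ => rfl)
    simp only [Nat.add_sub_cancel]
    rw [h.sT_succ, h.sB_succ, h1, h2]
    simp [couplingR]

theorem LowZero.commute_families (h : LowZero u) (a b : ℕ → R) (v : R) (x : 𝒜) (n : ℕ)
    (hx : ∀ y j, j + 2 ≤ n → Commute x (u y j)) :
    Commute x (sT u a b v n) ∧ Commute x (sA u a b v n) ∧ Commute x (sB u a b v n) := by
  induction n using Nat.strong_induction_on with
  | _ n ih =>
    match n, ih with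
    | 0, _ => simp
    | 1, _ => simp
    | n + 2, ih =>
      obtain ⟨h1, -, -⟩ := ih (n + 1) (by omega) (fun y j hj => hx y j (by omega))
      obtain ⟨h2, h3, h4⟩ := ih n (by omega) (fun y j hj => hx y j (by omega))
      rw [h.sT_succ, h.sA_succ, h.sB_succ]
      have hA := ((hx .A n le_rfl).mul_right h4).smul_right (v * couplingR a b .A n)
      have hB := ((hx .B n le_rfl).mul_right h3).smul_right (v * couplingR a b .B n)
      have hC := ((hx .C n le_rfl).mul_right h2).smul_right (v * couplingR a b .C n)
      exact ⟨((h1.sub_right hA).sub_right hB).sub_right hC, h1.sub_right hA, h1.sub_right hB⟩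

end Families

-- Moving a term through the families.

section Conjugation

variable {R : Type} [CommRing R] {𝒜 : Type} [Ring 𝒜] [Algebra R 𝒜] {u : Kind → ℕ → 𝒜}

theorem TermRel.commute_of_sign (h : TermRel u) {x y : Kind} {j d : ℕ}
    (hs : exchangeSign x y d = 1) : Commute (u x j) (u y (j + d)) := by
  have := h.comm x y j d
  rwa [hs, one_smul] at this

theorem TermRel.anticommute_of_sign (h : TermRel u) {x y : Kind} {j d : ℕ}
    (hs : exchangeSign x y d = -1) : u x j * u y (j + d) = -(u y (j + d) * u x j) := by
  have := h.comm x y j d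
  rwa [hs, neg_smul, one_smul] at this

theorem exchangeSign_three (x y : Kind) (d : ℕ) : exchangeSign x y (d + 3) = 1 := by
  rcases x <;> rcases y <;> rfl

theorem TermRel.commute_far (h : TermRel u) (x y : Kind) {j k : ℕ} (hjk : j + 3 ≤ k) :
    Commute (u x k) (u y j) := by
  obtain ⟨d, rfl⟩ := Nat.exists_eq_add_of_le hjk
  rw [add_assoc, add_comm 3 d]
  exact (h.commute_of_sign (exchangeSign_three y x d)).symm

theorem TermRel.commute_families_far (h : TermRel u) (a b : ℕ → R) (v : R) (x : Kind) {k n : ℕ}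
    (hk : n + 1 ≤ k) :
    Commute (u x k) (sT u a b v n) ∧ Commute (u x k) (sA u a b v n) ∧
      Commute (u x k) (sB u a b v n) :=
  h.commute_families a b v _ n fun y _ hj => h.commute_far x y (by omega)

/-- The only term of index k - 2 in T^B_{k-2} is B_{k-2}, which commutes with A_k; all others have
distance at least 3 from A_k. -/
theorem TermRel.A_sB (h : TermRel u) (a b : ℕ → R) (v : R) (k : ℕ) :
    sB u a b v k * u .A k = u .A k * sB u a b v k := by
  match k with
  | 0 => simp
  | 1 => simp
  | j + 2 =>
    obtain ⟨h1, -, -⟩ := h.commute_families_far a b v .A (le_refl (j + 1 + 1))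
    obtain ⟨-, h2, -⟩ := h.commute_families_far a b v .A (show j + 1 ≤ j + 2 by omega)
    have h3 : Commute (u .A (j + 2)) (u .B j) := (h.commute_of_sign (by rfl)).symm
    rw [h.sB_succ]
    exact ((h1.sub_right ((h3.mul_right h2).smul_right _)).eq).symm

/-- In T^A_{k-1} = T_{k-2} - A_{k-1}T^B_{k-3} (couplings suppressed) only the factor A_{k-1}
anticommutes with A_{k+1}. Passing A_{k+1} through flips that summand, which is a reflection about
T_{k-2}. -/
theorem TermRel.A_sA (h : TermRel u) (a b : ℕ → R) (v : R) (k : ℕ) :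
    sA u a b v (k + 1) * u .A (k + 1) =
      u .A (k + 1) * (sT u a b v k + sT u a b v k - sA u a b v (k + 1)) := by
  match k with
  | 0 => simp
  | j + 1 =>
    obtain ⟨h1, -, -⟩ := h.commute_families_far a b v .A (le_refl (j + 1 + 1))
    obtain ⟨-, -, h2⟩ := h.commute_families_far a b v .A (show j + 1 ≤ j + 2 by omega)
    have h3 : u .A j * u .A (j + 2) = -(u .A (j + 2) * u .A j) := h.anticommute_of_sign (by rfl)
    have h4 : u .A j * sB u a b v j * u .A (j + 2)
        = -(u .A (j + 2) * (u .A j * sB u a b v j)) := by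
      rw [mul_assoc, ← h2.eq, ← mul_assoc, h3, neg_mul, mul_assoc]
    rw [h.sA_succ, sub_mul, smul_mul_assoc, h4, ← h1.eq]
    simp only [mul_sub, mul_add, mul_smul_comm, smul_neg]
    abel

/-- The summands of T_{k-2} with A_{k-2} and C_{k-2} change sign when A_k passes, and the rest is
T^B_{k-2}: again a reflection. -/
theorem TermRel.A_sT (h : TermRel u) (a b : ℕ → R) (v : R) (k : ℕ) :
    sT u a b v k * u .A k = u .A k * (sB u a b v k + sB u a b v k - sT u a b v k) := by
  match k with
  | 0 => simp
  | 1 => simp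
  | j + 2 =>
    obtain ⟨h1, h2', h2⟩ := h.commute_families_far a b v .A (show j + 1 ≤ j + 2 by omega)
    have hB := h.A_sB a b v (j + 2)
    have h3 : u .A j * u .A (j + 2) = -(u .A (j + 2) * u .A j) := h.anticommute_of_sign (by rfl)
    have h3' : u .C j * u .A (j + 2) = -(u .A (j + 2) * u .C j) := h.anticommute_of_sign (by rfl)
    have h4 : u .A j * sB u a b v j * u .A (j + 2)
        = -(u .A (j + 2) * (u .A j * sB u a b v j)) := by
      rw [mul_assoc, ← h2.eq, ← mul_assoc, h3, neg_mul, mul_assoc]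
    have h5 : u .C j * sT u a b v j * u .A (j + 2)
        = -(u .A (j + 2) * (u .C j * sT u a b v j)) := by
      rw [mul_assoc, ← h1.eq, ← mul_assoc, h3', neg_mul, mul_assoc]
    have e : sT u a b v (j + 2) = sB u a b v (j + 2)
        - (v * couplingR a b .A j) • (u .A j * sB u a b v j)
        - (v * couplingR a b .C j) • (u .C j * sT u a b v j) := by
      rw [h.sT_succ, h.sB_succ]; abel
    rw [e, sub_mul, sub_mul, smul_mul_assoc, smul_mul_assoc, h4, h5, hB]
    simp only [mul_sub, mul_add, mul_smul_comm, smul_neg]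
    abel

/-- All three terms of index k - 1 anticommute with A_k, so the reflection about T^B_{k-2} persists
one level up. -/
theorem TermRel.A_sT_succ (h : TermRel u) (a b : ℕ → R) (v : R) (k : ℕ) :
    sT u a b v (k + 1) * u .A k = u .A k * (sB u a b v k + sB u a b v k - sT u a b v (k + 1)) := by
  match k with
  | 0 => simp
  | j + 1 =>
    obtain ⟨h1, h2', h2⟩ := h.commute_families_far a b v .A (le_refl (j + 1))
    have hT := h.A_sT a b v (j + 1)
    have h3 : u .A j * u .A (j + 1) = -(u .A (j + 1) * u .A j) := h.anticommute_of_sign (by rfl)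
    have h3' : u .C j * u .A (j + 1) = -(u .A (j + 1) * u .C j) := h.anticommute_of_sign (by rfl)
    have h3'' : u .B j * u .A (j + 1) = -(u .A (j + 1) * u .B j) := h.anticommute_of_sign (by rfl)
    have h4 : u .A j * sB u a b v j * u .A (j + 1)
        = -(u .A (j + 1) * (u .A j * sB u a b v j)) := by
      rw [mul_assoc, ← h2.eq, ← mul_assoc, h3, neg_mul, mul_assoc]
    have h5 : u .C j * sT u a b v j * u .A (j + 1)
        = -(u .A (j + 1) * (u .C j * sT u a b v j)) := by
      rw [mul_assoc, ← h1.eq, ← mul_assoc, h3', neg_mul, mul_assoc]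
    have h6 : u .B j * sA u a b v j * u .A (j + 1)
        = -(u .A (j + 1) * (u .B j * sA u a b v j)) := by
      rw [mul_assoc, ← h2'.eq, ← mul_assoc, h3'', neg_mul, mul_assoc]
    rw [h.sT_succ, sub_mul, sub_mul, sub_mul, smul_mul_assoc, smul_mul_assoc, smul_mul_assoc, h4,
      h5, h6, hT]
    simp only [mul_sub, mul_add, mul_smul_comm, smul_neg]
    abel

theorem TermRel.C_families (h : TermRel u) (a b : ℕ → R) (v : R) (k : ℕ) :
    Commute (u .C k) (sT u a b v k) ∧ Commute (u .C k) (sA u a b v k) ∧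
      Commute (u .C k) (sB u a b v k) := by
  refine h.commute_families a b v _ k fun y j hj => ?_
  obtain ⟨d, rfl⟩ := Nat.exists_eq_add_of_le hj
  rw [add_assoc]
  refine (h.commute_of_sign ?_).symm
  match d with
  | 0 => rcases y <;> rfl
  | d + 1 => rw [show 2 + (d + 1) = d + 3 by ring, exchangeSign_three]

/-- Unlike A, the term C_{j+1} does not act by a reflection: A_j and B_j change sign, while C_j
commutes with it and keeps its sign. -/
theorem TermRel.C_sT_succ (h : TermRel u) (a b : ℕ → R) (v : R) (j : ℕ) :
    sT u a b v (j + 2) * u .C (j + 1) = u .C (j + 1) * (sT u a b v (j + 1)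
      + (v * couplingR a b .A j) • (u .A j * sB u a b v j)
      + (v * couplingR a b .B j) • (u .B j * sA u a b v j)
      - (v * couplingR a b .C j) • (u .C j * sT u a b v j)) := by
  obtain ⟨h1, h2', h2⟩ := h.commute_families_far a b v .C (le_refl (j + 1))
  obtain ⟨hT, -, -⟩ := h.C_families a b v (j + 1)
  have h3 : u .A j * u .C (j + 1) = -(u .C (j + 1) * u .A j) := h.anticommute_of_sign (by rfl)
  have h3' : u .C j * u .C (j + 1) = u .C (j + 1) * u .C j := h.commute_of_sign (by rfl)
  have h3'' : u .B j * u .C (j + 1) = -(u .C (j + 1) * u .B j) := h.anticommute_of_sign (by rfl)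
  have h4 : u .A j * sB u a b v j * u .C (j + 1)
      = -(u .C (j + 1) * (u .A j * sB u a b v j)) := by
    rw [mul_assoc, ← h2.eq, ← mul_assoc, h3, neg_mul, mul_assoc]
  have h5 : u .C j * sT u a b v j * u .C (j + 1)
      = u .C (j + 1) * (u .C j * sT u a b v j) := by
    rw [mul_assoc, ← h1.eq, ← mul_assoc, h3', mul_assoc]
  have h6 : u .B j * sA u a b v j * u .C (j + 1)
      = -(u .C (j + 1) * (u .B j * sA u a b v j)) := by
    rw [mul_assoc, ← h2'.eq, ← mul_assoc, h3'', neg_mul, mul_assoc]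
  rw [h.sT_succ, sub_mul, sub_mul, sub_mul, smul_mul_assoc, smul_mul_assoc, smul_mul_assoc, h4,
    h5, h6, ← hT.eq]
  simp only [mul_sub, mul_add, mul_smul_comm, smul_neg]
  abel

theorem TermRel.B_sB (h : TermRel u) (a b : ℕ → R) (v : R) (k : ℕ) :
    sB u a b v (k + 1) * u .B (k + 1) =
      u .B (k + 1) * (sT u a b v k + sT u a b v k - sB u a b v (k + 1)) := by
  have := h.swap.A_sA b a v k
  rwa [(h.swap_families a b v _).1, (h.swap_families a b v _).2.1] at this

theorem TermRel.B_sA (h : TermRel u) (a b : ℕ → R) (v : R) (k : ℕ) :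
    sA u a b v k * u .B k = u .B k * sA u a b v k := by
  have := h.swap.A_sB b a v k
  rwa [(h.swap_families a b v _).2.2] at this

end Conjugation

/-! ### Exchange relations -/

section Exchange

variable {R : Type} [CommRing R] {𝒜 : Type} [Ring 𝒜] [Algebra R 𝒜]

/-- Increments of the recursion at level n, stripped of their scalar prefactors so that they can be
weighted by v and w independently. -/
def eA (u : Kind → ℕ → 𝒜) (a b : ℕ → R) (v : R) (n : ℕ) : 𝒜 := u .A n * sB u a b v n
def eB (u : Kind → ℕ → 𝒜) (a b : ℕ → R) (v : R) (n : ℕ) : 𝒜 := u .B n * sA u a b v n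
def eC (u : Kind → ℕ → 𝒜) (a b : ℕ → R) (v : R) (n : ℕ) : 𝒜 := u .C n * sT u a b v n

/-- Bilinear relations between the families at `v` and at `w`. -/
structure ExchangeRel (u : Kind → ℕ → 𝒜) (a b : ℕ → R) (v w : R) (n : ℕ) : Prop where
  TT : sT u a b v (n + 1) * sT u a b w (n + 1) = sT u a b w (n + 1) * sT u a b v (n + 1)
  TA_sub : w • (sT u a b v (n + 1) * eA u a b w n - eA u a b w n * sT u a b v (n + 1)) =
    v • (sT u a b w (n + 1) * eA u a b v n - eA u a b v n * sT u a b w (n + 1))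
  TA_add : sT u a b v (n + 1) * eA u a b w n + eA u a b w n * sT u a b v (n + 1) =
    sT u a b w (n + 1) * eA u a b v n + eA u a b v n * sT u a b w (n + 1)
  TC_sub : w • (sT u a b v (n + 1) * eC u a b w n - eC u a b w n * sT u a b v (n + 1)) -
      v • (sT u a b w (n + 1) * eC u a b v n - eC u a b v n * sT u a b w (n + 1)) =
    (v * w * (a (n - 1) * b (n - 1))) • (eA u a b v n * eB u a b w n - eB u a b w n * eA u a b v n
      + eB u a b v n * eA u a b w n - eA u a b w n * eB u a b v n)
  TC_add : eC u a b v n * sT u a b w (n + 1) + sT u a b w (n + 1) * eC u a b v n -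
      (eC u a b w n * sT u a b v (n + 1) + sT u a b v (n + 1) * eC u a b w n) =
    (a (n - 1) * b (n - 1)) • (w • (eA u a b v n * eB u a b w n + eB u a b w n * eA u a b v n)
      - v • (eA u a b w n * eB u a b v n + eB u a b v n * eA u a b w n))
  AC_sub : eA u a b v n * eC u a b w n - eC u a b w n * eA u a b v n
    + eC u a b v n * eA u a b w n - eA u a b w n * eC u a b v n = 0
  AC_add : w • (eC u a b v n * eA u a b w n + eA u a b w n * eC u a b v n) =
    v • (eC u a b w n * eA u a b v n + eA u a b v n * eC u a b w n)

/-- The relations obtained by exchanging `A` and `B`. -/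
structure ExchangeRel' (u : Kind → ℕ → 𝒜) (a b : ℕ → R) (v w : R) (n : ℕ) : Prop where
  TB_sub : w • (sT u a b v (n + 1) * eB u a b w n - eB u a b w n * sT u a b v (n + 1)) =
    v • (sT u a b w (n + 1) * eB u a b v n - eB u a b v n * sT u a b w (n + 1))
  TB_add : sT u a b v (n + 1) * eB u a b w n + eB u a b w n * sT u a b v (n + 1) =
    sT u a b w (n + 1) * eB u a b v n + eB u a b v n * sT u a b w (n + 1)
  TC_add' : eC u a b v n * sT u a b w (n + 1) + sT u a b w (n + 1) * eC u a b v n -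
      (eC u a b w n * sT u a b v (n + 1) + sT u a b v (n + 1) * eC u a b w n) =
    (a (n - 1) * b (n - 1)) • (w • (eB u a b v n * eA u a b w n + eA u a b w n * eB u a b v n)
      - v • (eB u a b w n * eA u a b v n + eA u a b v n * eB u a b w n))
  BC_sub : eB u a b v n * eC u a b w n - eC u a b w n * eB u a b v n
    + eC u a b v n * eB u a b w n - eB u a b w n * eC u a b v n = 0
  BC_add : w • (eC u a b v n * eB u a b w n + eB u a b w n * eC u a b v n) =
    v • (eC u a b w n * eB u a b v n + eB u a b v n * eC u a b w n)

variable {u : Kind → ℕ → 𝒜}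

theorem ExchangeRel.mirror (h : TermRel u) {a b : ℕ → R} {v w : R} {n : ℕ}
    (H : ExchangeRel (fun x j => u x.swap j) b a v w n) : ExchangeRel' u a b v w n := by
  have e1 : ∀ v m, sT (fun x j => u x.swap j) b a v m = sT u a b v m :=
    fun v m => (h.swap_families a b v m).1
  have e2 : ∀ v m, eA (fun x j => u x.swap j) b a v m = eB u a b v m := fun v m => by
    rw [eA, eB, (h.swap_families a b v m).2.2]; rfl
  have e3 : ∀ v m, eB (fun x j => u x.swap j) b a v m = eA u a b v m := fun v m => by
    rw [eA, eB, (h.swap_families a b v m).2.1]; rfl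
  have e4 : ∀ v m, eC (fun x j => u x.swap j) b a v m = eC u a b v m := fun v m => by
    rw [eC, eC, e1]; rfl
  obtain ⟨-, h1, h2, -, h3, h4, h5⟩ := H
  simp only [e1, e2, e3, e4, mul_comm (b (n - 1))] at h1 h2 h3 h4 h5
  exact ⟨h1, h2, h3, h4, h5⟩

end Exchange

-- Ring identities within one level.

section Core

set_option linter.unusedSimpArgs false

variable {R : Type} [CommRing R] {𝒜 : Type} [Ring 𝒜] [Algebra R 𝒜]
  {s α β γ s' α' β' γ' : 𝒜} {v w p q c d : R}

/-- Products αβ' and βα' carry the weight pq and can be traded for commutators of γ with s only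
because pq = cd; this is the role of `TC_sub`. Here s is T before a step, α, β, γ are its increments
of type A, B, C, primes mark the parameter w, and p, q, c are the couplings of the three increments.
-/
theorem core_commutator (hpq : p * q = c * d)
    (TB : (s - (v * q) • β) * (s' - (w * q) • β') = (s' - (w * q) • β') * (s - (v * q) • β))
    (TA_sub : w • (s * α' - α' * s) = v • (s' * α - α * s'))
    (TC_sub : w • (s * γ' - γ' * s) - v • (s' * γ - γ * s') =
      (v * w * d) • (α * β' - β' * α + β * α' - α' * β))
    (BC_sub : β * γ' - γ' * β + γ * β' - β' * γ = 0) :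
    (s' - (w * q) • β') * (s - (v * p) • α - (v * q) • β - (v * c) • γ)
        - (s - (v * p) • α - (v * q) • β - (v * c) • γ) * (s' - (w * q) • β')
      = (s - (v * q) • β) * (s' - (w * p) • α' - (w * q) • β' - (w * c) • γ')
        - (s' - (w * p) • α' - (w * q) • β' - (w * c) • γ') * (s - (v * q) • β) := by
  have hpq' := congrArg (fun x => (v * w * x) • (α * β' - β' * α + β * α' - α' * β)) hpq
  simp only [mul_add, add_mul, mul_sub, sub_mul, smul_add, smul_sub, smul_mul_assoc,
    mul_smul_comm, smul_smul] at *
  linear_combination (norm := module) (-2 : R) • TB + p • TA_sub + c • TC_sub - hpq'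
    - (v * w * q * c) • BC_sub

/-- The counterpart of `core_commutator` for anticommutators, with the same cancellation through
`TC_add`. Both versions are needed because pulling A through T turns one kind into the other. -/
theorem core_anticommutator (hpq : p * q = c * d)
    (TB : (s - (v * q) • β) * (s' - (w * q) • β') = (s' - (w * q) • β') * (s - (v * q) • β))
    (TA_add : s * α' + α' * s = s' * α + α * s')
    (TC_add : γ * s' + s' * γ - (γ' * s + s * γ') =
      d • (w • (α * β' + β' * α) - v • (α' * β + β * α')))
    (BC_add : w • (γ * β' + β' * γ) = v • (γ' * β + β * γ')) :
    w • ((s - (v * p) • α - (v * q) • β - (v * c) • γ) * (s' - (w * q) • β')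
        + (s' - (w * q) • β') * (s - (v * p) • α - (v * q) • β - (v * c) • γ)
        - (2 : R) • ((s - (v * q) • β) * (s' - (w * q) • β')))
      = v • ((s' - (w * p) • α' - (w * q) • β' - (w * c) • γ') * (s - (v * q) • β)
        + (s - (v * q) • β) * (s' - (w * p) • α' - (w * q) • β' - (w * c) • γ')
        - (2 : R) • ((s' - (w * q) • β') * (s - (v * q) • β))) := by
  have hpq' := congrArg
    (fun x => (v * w * x) • (w • (α * β' + β' * α) - v • (α' * β + β * α'))) hpq
  simp only [mul_add, add_mul, mul_sub, sub_mul, smul_add, smul_sub, smul_mul_assoc,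
    mul_smul_comm, smul_smul] at *
  linear_combination (norm := module) (-(v + w)) • TB + (v * w * p) • TA_add
    - (v * w * c) • TC_add + hpq' + (v * w * q * c) • BC_add

/-- This and `core_square_add` serve to advance the C relations. The factors with flipped A and B
terms are those produced by pulling C through T, and the right-hand side is what products of A-type
and B-type increments leave behind. -/
theorem core_square_sub (hpq : p * q = c * d)
    (TC_sub : w • (s * γ' - γ' * s) - v • (s' * γ - γ * s') =
      (v * w * d) • (α * β' - β' * α + β * α' - α' * β)) :
    s * (s' - (w * p) • α' - (w * q) • β' - (w * c) • γ')
        - (s' + (w * p) • α' + (w * q) • β' - (w * c) • γ') * s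
        - s' * (s - (v * p) • α - (v * q) • β - (v * c) • γ)
        + (s + (v * p) • α + (v * q) • β - (v * c) • γ) * s'
      = (s + s - (s - (v * q) • β)) * (s' - (w * p) • α')
        - (s' + s' - (s' - (w * p) • α')) * (s - (v * q) • β)
        + (s + s - (s - (v * p) • α)) * (s' - (w * q) • β')
        - (s' + s' - (s' - (w * q) • β')) * (s - (v * p) • α) := by
  have hpq' := congrArg (fun x => (v * w * x) • (α * β' - β' * α + β * α' - α' * β)) hpq
  simp only [mul_add, add_mul, mul_sub, sub_mul, smul_add, smul_sub, smul_mul_assoc,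
    mul_smul_comm, smul_smul] at *
  linear_combination (norm := module) -c • TC_sub + hpq'

theorem core_square_add (hpq : p * q = c * d)
    (TA_sub : w • (s * α' - α' * s) = v • (s' * α - α * s'))
    (TC_add' : γ * s' + s' * γ - (γ' * s + s * γ') =
      d • (w • (β * α' + α' * β) - v • (β' * α + α * β'))) :
    w • ((s + (v * p) • α + (v * q) • β - (v * c) • γ) * s'
        + s' * (s - (v * p) • α - (v * q) • β - (v * c) • γ)
        - (s + s - (s - (v * q) • β)) * (s' - (w * p) • α')
        - (s' + s' - (s' - (w * p) • α')) * (s - (v * q) • β))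
      = v • ((s' + (w * p) • α' + (w * q) • β' - (w * c) • γ') * s
        + s * (s' - (w * p) • α' - (w * q) • β' - (w * c) • γ')
        - (s' + s' - (s' - (w * q) • β')) * (s - (v * p) • α)
        - (s + s - (s - (v * p) • α)) * (s' - (w * q) • β')) := by
  have hpq' := congrArg
    (fun x => (v * w * x) • (w • (β * α' + α' * β) - v • (β' * α + α * β'))) hpq
  simp only [mul_add, add_mul, mul_sub, sub_mul, smul_add, smul_sub, smul_mul_assoc,
    mul_smul_comm, smul_smul] at *
  linear_combination (norm := module) ((v + w) * p) • TA_sub - (v * w * c) • TC_add' + hpq'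

/-- After expansion in the increments each kind of mixed product is handled by one of the relations;
the αβ' terms compensate the sγ' terms through pq = cd. -/
theorem core_commute (hpq : p * q = c * d) (TT : s * s' = s' * s)
    (AA : α * α' = α' * α) (BB : β * β' = β' * β) (CC : γ * γ' = γ' * γ)
    (TA_sub : w • (s * α' - α' * s) = v • (s' * α - α * s'))
    (TB_sub : w • (s * β' - β' * s) = v • (s' * β - β * s'))
    (TC_sub : w • (s * γ' - γ' * s) - v • (s' * γ - γ * s') =
      (v * w * d) • (α * β' - β' * α + β * α' - α' * β))
    (AC_sub : α * γ' - γ' * α + γ * α' - α' * γ = 0)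
    (BC_sub : β * γ' - γ' * β + γ * β' - β' * γ = 0) :
    (s - (v * p) • α - (v * q) • β - (v * c) • γ) *
        (s' - (w * p) • α' - (w * q) • β' - (w * c) • γ')
      = (s' - (w * p) • α' - (w * q) • β' - (w * c) • γ') *
        (s - (v * p) • α - (v * q) • β - (v * c) • γ) := by
  have hpq' := congrArg (fun x => (v * w * x) • (α * β' - β' * α + β * α' - α' * β)) hpq
  simp only [mul_add, add_mul, mul_sub, sub_mul, smul_add, smul_sub, smul_mul_assoc,
    mul_smul_comm, smul_smul] at *
  linear_combination (norm := module) TT + (v * w * p * p) • AA + (v * w * q * q) • BB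
    + (v * w * c * c) • CC - p • TA_sub - q • TB_sub - c • TC_sub + hpq'
    + (v * w * p * c) • AC_sub + (v * w * q * c) • BC_sub

end Core

-- Ring identities that raise the level.

section CoreStep

variable {R : Type} [CommRing R] {𝒜 : Type} [Ring 𝒜] [Algebra R 𝒜]

set_option linter.unusedSimpArgs false

/-- Pulling A to the left reflects S about B, so the commutator with S becomes an anticommutator.
For this reason relations of both symmetries have to go through the induction together. -/
theorem core_step_TA_sub {s B α β γ s' B' α' β' γ' A S S' : 𝒜} {v w p q c : R}
    (hS : S = s - (v * p) • α - (v * q) • β - (v * c) • γ)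
    (hS' : S' = s' - (w * p) • α' - (w * q) • β' - (w * c) • γ')
    (hA : S * A = A * (B + B - S)) (hA' : S' * A = A * (B' + B' - S'))
    (J : w • (s * B' + B' * s - (2 : R) • (B * B')) = v • (s' * B + B * s' - (2 : R) • (B' * B)))
    (Ja : B * α' + α' * B = B' * α + α * B') (Jb : B * β' + β' * B = B' * β + β * B')
    (Jc : γ * B' + B' * γ - (γ' * B + B * γ') = 0) :
    w • (S * (A * B') - A * B' * S) = v • (S' * (A * B) - A * B * S') := by
  have key : w • ((B + B - S) * B' - B' * S) = v • ((B' + B' - S') * B - B * S') := by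
    subst hS hS'
    simp only [mul_add, add_mul, mul_sub, sub_mul, smul_add, smul_sub, smul_mul_assoc,
      mul_smul_comm, smul_smul] at *
    linear_combination (norm := module) -J - (v * w * p) • Ja - (v * w * q) • Jb
      + (v * w * c) • Jc
  have := congrArg (A * ·) key
  rw [← mul_assoc S, ← mul_assoc S', hA, hA', mul_assoc, mul_assoc, mul_assoc, mul_assoc,
    ← mul_sub, ← mul_sub, ← mul_smul_comm, ← mul_smul_comm, this]

theorem core_step_TA_add {s B α β γ s' B' α' β' γ' A S S' : 𝒜} {v w p q c : R}
    (hS : S = s - (v * p) • α - (v * q) • β - (v * c) • γ)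
    (hS' : S' = s' - (w * p) • α' - (w * q) • β' - (w * c) • γ')
    (hA : S * A = A * (B + B - S)) (hA' : S' * A = A * (B' + B' - S'))
    (hB : B * B' = B' * B) (N : B' * s - s * B' = B * s' - s' * B)
    (Na : w • (B * α' - α' * B) = v • (B' * α - α * B'))
    (Nb : w • (B * β' - β' * B) = v • (B' * β - β * B'))
    (Nc : w • (B * γ' - γ' * B) - v • (B' * γ - γ * B') = 0) :
    S * (A * B') + A * B' * S = S' * (A * B) + A * B * S' := by
  have key : (B + B - S) * B' + B' * S = (B' + B' - S') * B + B * S' := by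
    subst hS hS'
    simp only [mul_add, add_mul, mul_sub, sub_mul, smul_add, smul_sub, smul_mul_assoc,
      mul_smul_comm, smul_smul] at *
    linear_combination (norm := module) N + (2 : R) • hB + p • Na + q • Nb + c • Nc
  have := congrArg (A * ·) key
  rw [← mul_assoc S, ← mul_assoc S', hA, hA', mul_assoc, mul_assoc, mul_assoc, mul_assoc,
    ← mul_add, ← mul_add, this]

/-- C commutes with T^B and anticommutes with A, so every product reduces to AC times a bilinear
expression in T and T^B, where `N` and `J` apply. -/
theorem core_step_AC {s B s' B' A C : 𝒜} {v w : R}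
    (hA : s * A = A * (B + B - s)) (hA' : s' * A = A * (B' + B' - s'))
    (hC : B * C = C * B) (hC' : B' * C = C * B') (hAC : C * A = -(A * C))
    (hB : B * B' = B' * B) (N : B' * s - s * B' = B * s' - s' * B)
    (J : w • (s * B' + B' * s - (2 : R) • (B * B')) = v • (s' * B + B * s' - (2 : R) • (B' * B))) :
    A * B * (C * s') - C * s' * (A * B) + C * s * (A * B') - A * B' * (C * s) = 0 ∧
    w • (C * s * (A * B') + A * B' * (C * s)) = v • (C * s' * (A * B) + A * B * (C * s')) := by
  have e1 : ∀ x, A * B * (C * x) = A * C * (B * x) := fun x => by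
    rw [mul_assoc, ← mul_assoc B, hC]; simp only [mul_assoc]
  have e1' : ∀ x, A * B' * (C * x) = A * C * (B' * x) := fun x => by
    rw [mul_assoc, ← mul_assoc B', hC']; simp only [mul_assoc]
  have e2 : ∀ x, C * s * (A * x) = -(A * C * ((B + B - s) * x)) := fun x => by
    rw [mul_assoc, ← mul_assoc s, hA, mul_assoc, ← mul_assoc, hAC, neg_mul]
  have e2' : ∀ x, C * s' * (A * x) = -(A * C * ((B' + B' - s') * x)) := fun x => by
    rw [mul_assoc, ← mul_assoc s', hA', mul_assoc, ← mul_assoc, hAC, neg_mul]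
  rw [e1, e1', e2, e2']
  have N' := congrArg (A * C * ·) N
  have J' := congrArg (A * C * ·) J
  have hB' := congrArg (A * C * ·) hB
  simp only [mul_add, add_mul, mul_sub, sub_mul, smul_add, smul_sub, smul_neg,
      mul_smul_comm, smul_smul] at *
  constructor
  · linear_combination (norm := module) -N' - (2 : R) • hB'
  · linear_combination (norm := module) J'

/-- The product relation turns the mixed A and B products into -CD times a bilinear expression, D
being the C term one level below. Once C is pulled to the left, the terms without D cancel by `TT`,
`Fa`, `Fb`, and those with D by `E`. -/
theorem core_step_TC_sub {s₁ s α β s₁' s' α' β' S S' sA sB sA' sB' σ σ' A B C D : 𝒜}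
    {v w p q c : R}
    (hS : S * C = C * (s + (v * p) • α + (v * q) • β - (v * c) • (D * s₁)))
    (hS' : S' * C = C * (s' + (w * p) • α' + (w * q) • β' - (w * c) • (D * s₁')))
    (eS : S = s - (v * p) • α - (v * q) • β - (v * c) • (D * s₁))
    (eS' : S' = s' - (w * p) • α' - (w * q) • β' - (w * c) • (D * s₁'))
    (hσ : s * D = D * σ) (hσ' : s' * D = D * σ')
    (TT : s * s' = s' * s)
    (hA : sA * A = A * (s₁ + s₁ - sA)) (hA' : sA' * A = A * (s₁' + s₁' - sA'))
    (hB : sB * B = B * (s₁ + s₁ - sB)) (hB' : sB' * B = B * (s₁' + s₁' - sB'))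
    (AB : A * B = -(C * D)) (BA : B * A = -(C * D))
    (Fa : s * α' + α' * s = s' * α + α * s') (Fb : s * β' + β' * s = s' * β + β * s')
    (E : s₁ * s' - σ' * s₁ - s₁' * s + σ * s₁' = (s₁ + s₁ - sB) * sA' - (s₁' + s₁' - sA') * sB
      + (s₁ + s₁ - sA) * sB' - (s₁' + s₁' - sB') * sA) :
    w • (S * (C * s') - C * s' * S) - v • (S' * (C * s) - C * s * S') =
    (v * w * c) • (A * sB * (B * sA') - B * sA' * (A * sB) + B * sA * (A * sB')
        - A * sB' * (B * sA)) := by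
  have f1 : ∀ x, A * sB * (B * x) = -(C * (D * ((s₁ + s₁ - sB) * x))) := fun x => by
    rw [mul_assoc, ← mul_assoc sB, hB, mul_assoc, ← mul_assoc, AB, neg_mul, mul_assoc]
  have f1' : ∀ x, A * sB' * (B * x) = -(C * (D * ((s₁' + s₁' - sB') * x))) := fun x => by
    rw [mul_assoc, ← mul_assoc sB', hB', mul_assoc, ← mul_assoc, AB, neg_mul, mul_assoc]
  have f2 : ∀ x, B * sA * (A * x) = -(C * (D * ((s₁ + s₁ - sA) * x))) := fun x => by
    rw [mul_assoc, ← mul_assoc sA, hA, mul_assoc, ← mul_assoc, BA, neg_mul, mul_assoc]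
  have f2' : ∀ x, B * sA' * (A * x) = -(C * (D * ((s₁' + s₁' - sA') * x))) := fun x => by
    rw [mul_assoc, ← mul_assoc sA', hA', mul_assoc, ← mul_assoc, BA, neg_mul, mul_assoc]
  rw [f1, f1', f2, f2', ← mul_assoc S, ← mul_assoc S', hS, hS', eS, eS']
  have g : s * (D * s₁') = D * (σ * s₁') := by rw [← mul_assoc, hσ, mul_assoc]
  have g' : s' * (D * s₁) = D * (σ' * s₁) := by rw [← mul_assoc, hσ', mul_assoc]
  have key : w • ((s + (v * p) • α + (v * q) • β - (v * c) • (D * s₁)) * s'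
      - s' * (s - (v * p) • α - (v * q) • β - (v * c) • (D * s₁)))
      - v • ((s' + (w * p) • α' + (w * q) • β' - (w * c) • (D * s₁')) * s
      - s * (s' - (w * p) • α' - (w * q) • β' - (w * c) • (D * s₁')))
      = -((v * w * c) • (D * ((s₁ + s₁ - sB) * sA' - (s₁' + s₁' - sA') * sB
      + (s₁ + s₁ - sA) * sB' - (s₁' + s₁' - sB') * sA))) := by
    rw [← E]
    simp only [mul_add, add_mul, mul_sub, sub_mul, smul_add, smul_sub, smul_mul_assoc,
      mul_smul_comm, smul_smul, mul_assoc, g, g'] at *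
    linear_combination (norm := module) (w + v) • TT - (v * w * p) • Fa - (v * w * q) • Fb
  have := congrArg (C * ·) key
  simp only [mul_add, add_mul, mul_sub, sub_mul, smul_add, smul_sub, smul_mul_assoc,
    mul_smul_comm, smul_smul, mul_neg, smul_neg, mul_assoc] at this ⊢
  linear_combination (norm := module) this

theorem core_step_TC_add {s₁ s α β s₁' s' α' β' S S' sA sB sA' sB' σ σ' A B C D : 𝒜}
    {v w p q c : R}
    (hS : S * C = C * (s + (v * p) • α + (v * q) • β - (v * c) • (D * s₁)))
    (hS' : S' * C = C * (s' + (w * p) • α' + (w * q) • β' - (w * c) • (D * s₁')))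
    (eS : S = s - (v * p) • α - (v * q) • β - (v * c) • (D * s₁))
    (eS' : S' = s' - (w * p) • α' - (w * q) • β' - (w * c) • (D * s₁'))
    (hσ : s * D = D * σ) (hσ' : s' * D = D * σ')
    (TT : s * s' = s' * s)
    (hA : sA * A = A * (s₁ + s₁ - sA)) (hA' : sA' * A = A * (s₁' + s₁' - sA'))
    (hB : sB * B = B * (s₁ + s₁ - sB)) (hB' : sB' * B = B * (s₁' + s₁' - sB'))
    (AB : A * B = -(C * D)) (BA : B * A = -(C * D))
    (Ea : w • (s * α' - α' * s) = v • (s' * α - α * s'))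
    (Eb : w • (s * β' - β' * s) = v • (s' * β - β * s'))
    (F : w • (σ * s₁' + s₁' * s - (s₁ + s₁ - sB) * sA' - (s₁' + s₁' - sA') * sB)
      = v • (σ' * s₁ + s₁ * s' - (s₁' + s₁' - sB') * sA - (s₁ + s₁ - sA) * sB')) :
    C * s * S' + S' * (C * s) - (C * s' * S + S * (C * s')) =
    c • (w • (A * sB * (B * sA') + B * sA' * (A * sB))
      - v • (A * sB' * (B * sA) + B * sA * (A * sB'))) := by
  have f1 : ∀ x, A * sB * (B * x) = -(C * (D * ((s₁ + s₁ - sB) * x))) := fun x => by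
    rw [mul_assoc, ← mul_assoc sB, hB, mul_assoc, ← mul_assoc, AB, neg_mul, mul_assoc]
  have f1' : ∀ x, A * sB' * (B * x) = -(C * (D * ((s₁' + s₁' - sB') * x))) := fun x => by
    rw [mul_assoc, ← mul_assoc sB', hB', mul_assoc, ← mul_assoc, AB, neg_mul, mul_assoc]
  have f2 : ∀ x, B * sA * (A * x) = -(C * (D * ((s₁ + s₁ - sA) * x))) := fun x => by
    rw [mul_assoc, ← mul_assoc sA, hA, mul_assoc, ← mul_assoc, BA, neg_mul, mul_assoc]
  have f2' : ∀ x, B * sA' * (A * x) = -(C * (D * ((s₁' + s₁' - sA') * x))) := fun x => by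
    rw [mul_assoc, ← mul_assoc sA', hA', mul_assoc, ← mul_assoc, BA, neg_mul, mul_assoc]
  rw [f1, f1', f2, f2', ← mul_assoc S, ← mul_assoc S', hS, hS', eS, eS']
  have g : s * (D * s₁') = D * (σ * s₁') := by rw [← mul_assoc, hσ, mul_assoc]
  have g' : s' * (D * s₁) = D * (σ' * s₁) := by rw [← mul_assoc, hσ', mul_assoc]
  have F' := congrArg (D * ·) F
  have key : s * (s' - (w * p) • α' - (w * q) • β' - (w * c) • (D * s₁'))
      + (s' + (w * p) • α' + (w * q) • β' - (w * c) • (D * s₁')) * s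
      - (s' * (s - (v * p) • α - (v * q) • β - (v * c) • (D * s₁))
      + (s + (v * p) • α + (v * q) • β - (v * c) • (D * s₁)) * s')
      = c • (v • (D * ((s₁' + s₁' - sB') * sA + (s₁ + s₁ - sA) * sB'))
        - w • (D * ((s₁ + s₁ - sB) * sA' + (s₁' + s₁' - sA') * sB))) := by
    simp only [mul_add, add_mul, mul_sub, sub_mul, smul_add, smul_sub, smul_mul_assoc,
      mul_smul_comm, smul_smul, mul_assoc, g, g'] at *
    linear_combination (norm := module) (0 : R) • TT - p • Ea - q • Eb - c • F'
  have := congrArg (C * ·) key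
  simp only [mul_add, add_mul, mul_sub, sub_mul, smul_add, smul_sub, smul_mul_assoc,
    mul_smul_comm, smul_smul, mul_neg, smul_neg, mul_assoc] at this ⊢
  linear_combination (norm := module) this

end CoreStep

-- Commutation of the transfer matrices.

section Induction

variable {R : Type} [CommRing R] {𝒜 : Type} [Ring 𝒜] [Algebra R 𝒜] {u : Kind → ℕ → 𝒜}

/-- Scalar companion of the product relation `mulAB`: the products A_kB_k and C_{k-1}C_k enter with
matching weights. -/
theorem couplingR_mul (a b : ℕ → R) (k : ℕ) :
    couplingR a b .A k * couplingR a b .B k = couplingR a b .C k * (a (k - 1) * b (k - 1)) := by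
  simp only [couplingR]; ring

theorem LowZero.sT_expand (h : LowZero u) (a b : ℕ → R) (v : R) (n : ℕ) :
    sT u a b v (n + 2) = sT u a b v (n + 1) - (v * couplingR a b .A n) • eA u a b v n
      - (v * couplingR a b .B n) • eB u a b v n - (v * couplingR a b .C n) • eC u a b v n :=
  h.sT_succ a b v n

theorem LowZero.sA_expand (h : LowZero u) (a b : ℕ → R) (v : R) (n : ℕ) :
    sA u a b v (n + 2) = sT u a b v (n + 1) - (v * couplingR a b .A n) • eA u a b v n :=
  h.sA_succ a b v n

theorem LowZero.sB_expand (h : LowZero u) (a b : ℕ → R) (v : R) (n : ℕ) :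
    sB u a b v (n + 2) = sT u a b v (n + 1) - (v * couplingR a b .B n) • eB u a b v n :=
  h.sB_succ a b v n

theorem LowZero.update_families (h : LowZero u) (a b : ℕ → R) (v : R) (k : ℕ) :
    sT u (Function.update a k 0) b v (k + 2) = sB u a b v (k + 2) ∧
    eA u (Function.update a k 0) b v (k + 1) = eA u a b v (k + 1) ∧
    eB u (Function.update a k 0) b v (k + 1) = eB u a b v (k + 1) ∧
    eC u (Function.update a k 0) b v (k + 1) = eC u a b v (k + 1) := by
  obtain ⟨h1, h2, h3⟩ := h.families_congr (a := Function.update a k 0) (a' := a) (b := b) (b' := b)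
    v (k + 1) (fun j hj => Function.update_of_ne (by omega) _ _) (fun _ _ => rfl)
  exact ⟨h.sT_update a b v (k + 2), by rw [eA, eA, h3], by rw [eB, eB, h2], by rw [eC, eC, h1]⟩

theorem sT_two (h : LowZero u) (a b : ℕ → R) (v : R) : sT u a b v 2 = 1 := by
  rw [h.sT_succ]; simp [h.zero]

/-- Level k supplies `N`, `J`, `E`, `F`; level k + 1 supplies the relations for the increments; and
level k + 1 with a_k = 0 supplies the same relations with T^B in place of T. -/
theorem ExchangeRel.step (h : TermRel u) {a b : ℕ → R} {v w : R} {k : ℕ}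
    (H0 : ExchangeRel u a b v w k) (M0 : ExchangeRel' u a b v w k)
    (H1 : ExchangeRel u a b v w (k + 1)) (M1 : ExchangeRel' u a b v w (k + 1))
    (Z : ExchangeRel u (Function.update a k 0) b v w (k + 1))
    (Z' : ExchangeRel' u (Function.update a k 0) b v w (k + 1))
    (cA : sA u a b v (k + 1) * sA u a b w (k + 1) = sA u a b w (k + 1) * sA u a b v (k + 1))
    (cB : sB u a b v (k + 1) * sB u a b w (k + 1) = sB u a b w (k + 1) * sB u a b v (k + 1)) :
    ExchangeRel u a b v w (k + 2) := by
  have hz := h.toLowZero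
  have hpq := couplingR_mul a b k
  obtain ⟨zv1, zv2, zv3, zv4⟩ := hz.update_families a b v k
  obtain ⟨zw1, zw2, zw3, zw4⟩ := hz.update_families a b w k
  obtain ⟨zTT, zTA_sub, zTA_add, zTC_sub, zTC_add, -, -⟩ := Z
  obtain ⟨zTB_sub, zTB_add, -, -, -⟩ := Z'
  -- The right-hand sides of the two C relations carry the factor a_k b_k, which is now zero.
  simp only [Nat.add_sub_cancel, Function.update_self, zero_mul, mul_zero, zero_smul]
    at zTC_sub zTC_add
  simp only [Nat.add_assoc, Nat.reduceAdd, zv1, zv2, zv3, zv4, zw1, zw2, zw3, zw4]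
    at zTT zTA_sub zTA_add zTC_sub zTC_add zTB_sub zTB_add
  have N := core_commutator hpq (by rw [← hz.sB_expand, ← hz.sB_expand, zTT]) H0.TA_sub H0.TC_sub
    M0.BC_sub
  have J := core_anticommutator hpq (by rw [← hz.sB_expand, ← hz.sB_expand, zTT]) H0.TA_add
    H0.TC_add M0.BC_add
  rw [← hz.sT_expand, ← hz.sT_expand, ← hz.sB_expand, ← hz.sB_expand] at N J
  have hAC : u .C (k + 2) * u .A (k + 2) = -(u .A (k + 2) * u .C (k + 2)) :=
    h.anticommute_of_sign (j := k + 2) (d := 0) (by rfl)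
  have hAB : u .A (k + 2) * u .B (k + 2) = -(u .C (k + 2) * u .C (k + 1)) := by
    rw [h.mulAB (k + 1), (h.commute_of_sign (x := .C) (y := .C) (j := k + 1) (d := 1) (by rfl)).eq]
  have hBA : u .B (k + 2) * u .A (k + 2) = -(u .C (k + 2) * u .C (k + 1)) := by
    rw [← hAB]; exact (h.commute_of_sign (j := k + 2) (d := 0) (by rfl)).eq
  obtain ⟨AC1, AC2⟩ := core_step_AC (h.A_sT a b v (k + 2)) (h.A_sT a b w (k + 2))
    (h.C_families a b v (k + 2)).2.2.eq.symm (h.C_families a b w (k + 2)).2.2.eq.symm hAC zTT N J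
  have E := core_square_sub hpq H0.TC_sub
  have F := core_square_add hpq H0.TA_sub M0.TC_add'
  rw [← hz.sT_expand, ← hz.sT_expand, ← hz.sB_expand, ← hz.sB_expand, ← hz.sA_expand,
    ← hz.sA_expand] at E F
  have sq : ∀ x y z : 𝒜, Commute z x → Commute z y → x * y = y * x →
      z * x * (z * y) = z * y * (z * x) := fun x y z hx hy hxy => by
    rw [mul_assoc, ← mul_assoc x, ← hx.eq, mul_assoc z x, hxy, mul_assoc, ← mul_assoc y, ← hy.eq,
      mul_assoc]
  refine ⟨?_, ?_, ?_, ?_, ?_, AC1, AC2⟩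
  · rw [show k + 2 + 1 = k + 1 + 2 from rfl, hz.sT_expand a b v (k + 1),
      hz.sT_expand a b w (k + 1)]
    exact core_commute (couplingR_mul a b (k + 1)) H1.TT
      (sq _ _ _ (h.A_sB a b v (k + 1)).symm (h.A_sB a b w (k + 1)).symm cB)
      (sq _ _ _ (h.B_sA a b v (k + 1)).symm (h.B_sA a b w (k + 1)).symm cA)
      (sq _ _ _ (h.C_families a b v (k + 1)).1 (h.C_families a b w (k + 1)).1 H0.TT)
      H1.TA_sub M1.TB_sub H1.TC_sub H1.AC_sub M1.BC_sub
  · exact core_step_TA_sub (hz.sT_expand a b v (k + 1)) (hz.sT_expand a b w (k + 1))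
      (h.A_sT_succ a b v (k + 2)) (h.A_sT_succ a b w (k + 2)) J zTA_add zTB_add zTC_add
  · exact core_step_TA_add (hz.sT_expand a b v (k + 1)) (hz.sT_expand a b w (k + 1))
      (h.A_sT_succ a b v (k + 2)) (h.A_sT_succ a b w (k + 2)) zTT N zTA_sub zTB_sub zTC_sub
  · exact core_step_TC_sub (h.C_sT_succ a b v (k + 1)) (h.C_sT_succ a b w (k + 1))
      (hz.sT_expand a b v (k + 1)) (hz.sT_expand a b w (k + 1))
      (h.C_sT_succ a b v k) (h.C_sT_succ a b w k) H1.TT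
      (h.A_sA a b v (k + 1)) (h.A_sA a b w (k + 1)) (h.B_sB a b v (k + 1)) (h.B_sB a b w (k + 1))
      hAB hBA H1.TA_add M1.TB_add E
  · exact core_step_TC_add (h.C_sT_succ a b v (k + 1)) (h.C_sT_succ a b w (k + 1))
      (hz.sT_expand a b v (k + 1)) (hz.sT_expand a b w (k + 1))
      (h.C_sT_succ a b v k) (h.C_sT_succ a b w k) H1.TT
      (h.A_sA a b v (k + 1)) (h.A_sA a b w (k + 1)) (h.B_sB a b v (k + 1)) (h.B_sB a b w (k + 1))
      hAB hBA H1.TA_sub M1.TB_sub F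

/-- The quantification over all terms and couplings is essential: the step uses the mirrored terms
and couplings with an entry replaced by zero. -/
theorem exchangeRel (v w : R) (n : ℕ) : ∀ u : Kind → ℕ → 𝒜, TermRel u → ∀ a b : ℕ → R,
    ExchangeRel u a b v w n := by
  induction n using Nat.strong_induction_on with
  | _ n ih =>
    intro u h a b
    match n, ih with
    | 0, _ => constructor <;> simp [eA, eB, eC, h.zero]
    | 1, _ =>
      constructor <;> simp [eA, eB, eC, h.A1, h.B1, sT_two h.toLowZero]
    | k + 2, ih =>
      have h0 := ih k (by omega)
      have h1 := ih (k + 1) (by omega)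
      -- With a_{k-1} = 0 the family `sT` at k + 1 becomes `sB`, so commutation of T^B is an
      -- instance of commutation of T; mirroring gives T^A.
      have cB := (h0 _ h (Function.update a (k - 1) 0) b).TT
      have cA := (h0 _ h.swap (Function.update b (k - 1) 0) a).TT
      have e1 : ∀ v, sT u (Function.update a (k - 1) 0) b v (k + 1) = sB u a b v (k + 1) :=
        fun v => h.sT_update a b v (k + 1)
      have e2 : ∀ v, sT (fun x j => u x.swap j) (Function.update b (k - 1) 0) a v (k + 1) =
          sA u a b v (k + 1) := fun v => by
        rw [← (h.swap_families a b v (k + 1)).2.2]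
        exact h.swap.sT_update b a v (k + 1)
      rw [e1, e1] at cB
      rw [e2, e2] at cA
      exact ExchangeRel.step h (h0 _ h a b) ((h0 _ h.swap b a).mirror h) (h1 _ h a b)
        ((h1 _ h.swap b a).mirror h) (h1 _ h _ b) ((h1 _ h.swap b _).mirror h) cA cB

theorem sT_commute (h : TermRel u) (a b : ℕ → R) (v w : R) (n : ℕ) :
    Commute (sT u a b v n) (sT u a b w n) := by
  match n with
  | 0 => simp
  | n + 1 => exact (exchangeRel v w n u h a b).TT

end Induction

-- The product T(v)T(-v).

section Inversion

variable {R : Type} [CommRing R] {𝒜 : Type} [Ring 𝒜] [Algebra R 𝒜] {u : Kind → ℕ → 𝒜}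

set_option linter.unusedSimpArgs false in
-- At w = -v the commutator and anticommutator relations combine to remove every mixed product: αβ'
-- + βα' cancels against sγ' - γs' through pq = cd. Combining the two kinds yields twice the claim,
-- hence the invertibility of 2.
theorem core_inversion {s α β γ s' α' β' γ' : 𝒜} {v p q c d : R} (h2 : IsUnit (2 : R))
    (hpq : p * q = c * d)
    (TA_sub : -v • (s * α' - α' * s) = v • (s' * α - α * s'))
    (TA_add : s * α' + α' * s = s' * α + α * s')
    (TB_sub : -v • (s * β' - β' * s) = v • (s' * β - β * s'))
    (TB_add : s * β' + β' * s = s' * β + β * s')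
    (TC_sub : -v • (s * γ' - γ' * s) - v • (s' * γ - γ * s') =
      (v * -v * d) • (α * β' - β' * α + β * α' - α' * β))
    (TC_add : γ * s' + s' * γ - (γ' * s + s * γ') =
      d • (-v • (α * β' + β' * α) - v • (α' * β + β * α')))
    (AC_sub : α * γ' - γ' * α + γ * α' - α' * γ = 0)
    (AC_add : -v • (γ * α' + α' * γ) = v • (γ' * α + α * γ'))
    (BC_sub : β * γ' - γ' * β + γ * β' - β' * γ = 0)
    (BC_add : -v • (γ * β' + β' * γ) = v • (γ' * β + β * γ')) :
    (s - (v * p) • α - (v * q) • β - (v * c) • γ) *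
        (s' - (-v * p) • α' - (-v * q) • β' - (-v * c) • γ')
      = s * s' - (v * v * p * p) • (α * α') - (v * v * q * q) • (β * β')
        - (v * v * c * c) • (γ * γ') := by
  have hpq' := congrArg (fun x => (v * v * x) • (α * β' + β * α')) hpq
  have key : ∀ x y : 𝒜, (2 : R) • x = (2 : R) • y → x = y := fun x y hxy => by
    obtain ⟨z, hz⟩ := h2.exists_left_inv
    rw [← one_smul R x, ← one_smul R y, ← hz, mul_smul, mul_smul, hxy]
  apply key
  simp only [mul_add, add_mul, mul_sub, sub_mul, smul_add, smul_sub, smul_mul_assoc,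
    mul_smul_comm, smul_smul] at *
  linear_combination (norm := module) -p • TA_sub + (v * p) • TA_add - q • TB_sub
    + (v * q) • TB_add - c • TC_sub - (v * c) • TC_add - (2 : R) • hpq'
    - (v * v * p * c) • AC_sub + (v * p * c) • AC_add - (v * v * q * c) • BC_sub
    + (v * q * c) • BC_add

set_option linter.unusedSimpArgs false in
theorem core_inversion_single {s α s' α' : 𝒜} {v p : R} (h2 : IsUnit (2 : R))
    (TA_sub : -v • (s * α' - α' * s) = v • (s' * α - α * s'))
    (TA_add : s * α' + α' * s = s' * α + α * s') :
    (s - (v * p) • α) * (s' - (-v * p) • α') = s * s' - (v * v * p * p) • (α * α') := by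
  have := core_inversion (s := s) (α := α) (β := 0) (γ := 0) (s' := s') (α' := α') (β' := 0)
    (γ' := 0) (v := v) (p := p) (q := 0) (c := 0) (d := 0) h2 (by simp) TA_sub TA_add
  simpa using this

/-- The surviving products have the form A_nT^B(v)A_nT^B(-v), and A_n commutes with T^B, so A_n²
splits off and the induction hypothesis applies to the rest. The function `e` records the squares of
the terms. -/
theorem sT_mul_sT_neg (h : TermRel u) (h2 : IsUnit (2 : R)) {e : Kind → ℕ → R} (he : LowZero e)
    (hu : ∀ x j, u x j * u x j = algebraMap R 𝒜 (e x j)) (a b : ℕ → R) (v : R) (n : ℕ) :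
    let c : Kind → ℕ → R := fun x j => v ^ 2 * couplingR a b x j ^ 2 * e x j
    sT u a b v n * sT u a b (-v) n = algebraMap R 𝒜 (shiftT c n) ∧
    sA u a b v n * sA u a b (-v) n = algebraMap R 𝒜 (shiftTA c n) ∧
    sB u a b v n * sB u a b (-v) n = algebraMap R 𝒜 (shiftTB c n) := by
  intro c
  have hc : LowZero c := ⟨fun x => by simp [c, he.zero], by simp [c, he.A1], by simp [c, he.B1]⟩
  have hz := h.toLowZero
  induction n using Nat.strong_induction_on with
  | _ n ih =>
    match n, ih with
    | 0, _ => simp [shiftT, shiftTA, shiftTB]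
    | 1, _ => simp [shiftT, shiftTA, shiftTB]
    | n + 2, ih =>
      obtain ⟨h1, -, -⟩ := ih (n + 1) (by omega)
      obtain ⟨h3, h4, h5⟩ := ih n (by omega)
      have H := exchangeRel v (-v) n u h a b
      have M := (exchangeRel v (-v) n _ h.swap b a).mirror h
      have sq : ∀ (x y : 𝒜) (κ : Kind) (r : R), Commute (u κ n) x →
          x * y = algebraMap R 𝒜 r →
          u κ n * x * (u κ n * y) = algebraMap R 𝒜 (e κ n * r) := fun x y κ r hx hxy => by
        rw [mul_assoc, ← mul_assoc x, ← hx.eq, mul_assoc _ x, hxy, ← mul_assoc, hu, map_mul]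
      have qA := sq _ _ .A _ (h.A_sB a b v n).symm h5
      have qB := sq _ _ .B _ (h.B_sA a b v n).symm h4
      have qC := sq _ _ .C _ (h.C_families a b v n).1 h3
      refine ⟨?_, ?_, ?_⟩
      · rw [hz.sT_expand, hz.sT_expand, core_inversion h2 (couplingR_mul a b n) H.TA_sub H.TA_add
          M.TB_sub M.TB_add H.TC_sub H.TC_add H.AC_sub H.AC_add M.BC_sub M.BC_add, h1, eA, eA, eB,
          eB, eC, eC, qA, qB, qC, hc.shiftT_succ]
        simp only [Algebra.smul_def, ← map_mul, ← map_sub, c]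
        congr 1; ring
      · rw [hz.sA_expand, hz.sA_expand, core_inversion_single h2 H.TA_sub H.TA_add, h1, eA, eA, qA,
          hc.shiftTA_succ]
        simp only [Algebra.smul_def, ← map_mul, ← map_sub, c]
        congr 1; ring
      · rw [hz.sB_expand, hz.sB_expand, core_inversion_single h2 M.TB_sub M.TB_add, h1, eB, eB, qB,
          hc.shiftTB_succ]
        simp only [Algebra.smul_def, ← map_mul, ← map_sub, c]
        congr 1; ring

end Inversion

/-! ### Pauli strings -/

section SiteOperators

variable {N : ℕ}

/-- The tensor product of one-site operators. -/
def tensorOp (f : Fin N → Matrix (Fin 2) (Fin 2) ℂ) : Op N :=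
  Matrix.of fun s s' => ∏ i, f i (s i) (s' i)

theorem tensorOp_mul (f g : Fin N → Matrix (Fin 2) (Fin 2) ℂ) :
    tensorOp f * tensorOp g = tensorOp fun i => f i * g i := by
  ext s s'
  simp only [tensorOp, Matrix.mul_apply, Matrix.of_apply, Finset.prod_univ_sum,
    Fintype.piFinset_univ, Finset.prod_mul_distrib]

theorem tensorOp_one : tensorOp (fun _ : Fin N => (1 : Matrix (Fin 2) (Fin 2) ℂ)) = 1 := by
  ext s s'
  simp only [tensorOp, Matrix.of_apply, Matrix.one_apply]
  by_cases h : s = s'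
  · simp [h]
  · rw [if_neg h]
    obtain ⟨i, hi⟩ := Function.ne_iff.mp h
    exact Finset.prod_eq_zero (Finset.mem_univ i) (by simp [hi])

theorem siteOp_eq (P : Matrix (Fin 2) (Fin 2) ℂ) (k : ℕ) :
    siteOp N P k = tensorOp fun i => if (i : ℕ) = k then P else 1 := rfl

theorem siteOp_mul_self (P Q : Matrix (Fin 2) (Fin 2) ℂ) (k : ℕ) :
    siteOp N P k * siteOp N Q k = siteOp N (P * Q) k := by
  rw [siteOp_eq, siteOp_eq, siteOp_eq, tensorOp_mul]
  congr 1; ext1 i; split_ifs <;> simp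

theorem siteOp_one (k : ℕ) : siteOp N 1 k = 1 := by
  rw [siteOp_eq, ← tensorOp_one]; congr 1; ext1 i; split_ifs <;> rfl

theorem siteOp_commute (P Q : Matrix (Fin 2) (Fin 2) ℂ) {k l : ℕ} (h : k ≠ l) :
    siteOp N P k * siteOp N Q l = siteOp N Q l * siteOp N P k := by
  rw [siteOp_eq, siteOp_eq, tensorOp_mul, tensorOp_mul]
  congr 1; ext1 i
  by_cases hk : (i : ℕ) = k <;> by_cases hl : (i : ℕ) = l <;> simp [hk, hl, h, h.symm]

theorem siteOp_smul (c : ℂ) (P : Matrix (Fin 2) (Fin 2) ℂ) {k : ℕ} (h : k < N) :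
    siteOp N (c • P) k = c • siteOp N P k := by
  ext s s'
  simp only [siteOp, Matrix.of_apply, Matrix.smul_apply, smul_eq_mul]
  rw [← Finset.mul_prod_erase _ _ (Finset.mem_univ (⟨k, h⟩ : Fin N)),
    ← Finset.mul_prod_erase _ _ (Finset.mem_univ (⟨k, h⟩ : Fin N)), ← mul_assoc]
  simp only [if_true, Matrix.smul_apply, smul_eq_mul]
  congr 1
  refine Finset.prod_congr rfl fun i hi => ?_
  have : (i : ℕ) ≠ k := fun h' => (Finset.mem_erase.mp hi).1 (Fin.ext h')
  simp [this]

theorem siteOp_conjTranspose {P : Matrix (Fin 2) (Fin 2) ℂ} (hP : P.IsHermitian) (k : ℕ) :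
    (siteOp N P k).conjTranspose = siteOp N P k := by
  ext s s'
  simp only [siteOp, Matrix.conjTranspose_apply, Matrix.of_apply, star_prod]
  refine Finset.prod_congr rfl fun i _ => ?_
  split_ifs
  · exact congrFun (congrFun hP (s i)) (s' i)
  · exact congrFun (congrFun (Matrix.isHermitian_one (n := Fin 2) (α := ℂ)) (s i)) (s' i)

/-- The three Pauli matrices. -/
noncomputable def pauli : Fin 3 → Matrix (Fin 2) (Fin 2) ℂ
  | 0 => pauliX
  | 1 => pauliY
  | 2 => pauliZ

theorem pauli_mul_self (p : Fin 3) : pauli p * pauli p = 1 := by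
  fin_cases p <;> ext i j <;> fin_cases i <;> fin_cases j <;>
    simp [pauli, pauliX, pauliY, pauliZ, Matrix.mul_apply]

theorem pauli_isHermitian (p : Fin 3) : (pauli p).IsHermitian := by
  fin_cases p <;> ext i j <;> fin_cases i <;> fin_cases j <;>
    simp [pauli, pauliX, pauliY, pauliZ]

theorem pauli_exchange (p q : Fin 3) :
    pauli p * pauli q = (if p = q then (1 : ℂ) else -1) • (pauli q * pauli p) := by
  fin_cases p <;> fin_cases q <;> ext i j <;> fin_cases i <;> fin_cases j <;>
    simp [pauli, pauliX, pauliY, pauliZ, Matrix.mul_apply]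

theorem pauliX_mul_pauliY : pauliX * pauliY = Complex.I • pauliZ := by
  ext i j; fin_cases i <;> fin_cases j <;> simp [pauliX, pauliY, pauliZ, Matrix.mul_apply]

/-- The sign in the exchange of two one-site Pauli operators. -/
def siteSign (p q : Fin 3 × ℕ) : ℤ := if p.2 = q.2 ∧ p.1 ≠ q.1 then -1 else 1

theorem siteOp_exchange (p q : Fin 3 × ℕ) (hp : p.2 < N) :
    siteOp N (pauli p.1) p.2 * siteOp N (pauli q.1) q.2 =
      siteSign p q • (siteOp N (pauli q.1) q.2 * siteOp N (pauli p.1) p.2) := by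
  obtain ⟨p, k⟩ := p
  obtain ⟨q, l⟩ := q
  simp only [siteSign]
  by_cases hkl : k = l
  · subst hkl
    rw [siteOp_mul_self, siteOp_mul_self, pauli_exchange, siteOp_smul _ _ hp]
    by_cases hpq : p = q <;> simp [hpq]
  · rw [siteOp_commute _ _ hkl]; simp [hkl]

/-- The product of the one-site Pauli operators in a list. -/
noncomputable def pauliString (N : ℕ) (l : List (Fin 3 × ℕ)) : Op N :=
  (l.map fun p => siteOp N (pauli p.1) p.2).prod

def stringSign (l l' : List (Fin 3 × ℕ)) : ℤ :=
  (l.map fun p => (l'.map fun q => siteSign p q).prod).prod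

theorem siteOp_pauliString_exchange (p : Fin 3 × ℕ) (hp : p.2 < N) (l : List (Fin 3 × ℕ)) :
    siteOp N (pauli p.1) p.2 * pauliString N l =
      (l.map fun q => siteSign p q).prod • (pauliString N l * siteOp N (pauli p.1) p.2) := by
  induction l with
  | nil => simp [pauliString]
  | cons q l ih =>
    simp only [pauliString, List.map_cons, List.prod_cons] at ih ⊢
    rw [← mul_assoc, siteOp_exchange p q hp, smul_mul_assoc, mul_assoc, ih, mul_smul_comm,
      smul_smul, mul_assoc]

theorem pauliString_exchange (l l' : List (Fin 3 × ℕ)) (hl : ∀ p ∈ l, p.2 < N) :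
    pauliString N l * pauliString N l' =
      stringSign l l' • (pauliString N l' * pauliString N l) := by
  induction l with
  | nil => simp [pauliString, stringSign]
  | cons p l ih =>
    have h1 := siteOp_pauliString_exchange p (hl p (by simp)) l'
    have h2 := ih fun q hq => hl q (by simp [hq])
    simp only [pauliString, stringSign, List.map_cons, List.prod_cons] at h1 h2 ⊢
    rw [mul_assoc, h2, mul_smul_comm, ← mul_assoc, h1, smul_mul_assoc, smul_smul, mul_assoc,
      mul_comm]

def termString : Kind → ℕ → List (Fin 3 × ℕ)
  | .A, j => [(0, j - 1), (0, j), (2, j + 1)]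
  | .B, j => [(2, j - 2), (1, j - 1), (1, j)]
  | .C, j => [(2, j - 1), (2, j + 1)]

theorem t_eq_pauliString (x : Kind) (j : ℕ) : t N x j = pauliString N (termString x j) := by
  rcases x <;> simp [t, termString, pauliString, pauli, mul_assoc]

theorem pauliString_mul_self (l : List (Fin 3 × ℕ)) (hl : (l.map Prod.snd).Nodup) :
    pauliString N l * pauliString N l = 1 := by
  induction l with
  | nil => simp [pauliString]
  | cons p l ih =>
    simp only [List.map_cons, List.nodup_cons] at hl
    have hc : pauliString N l * siteOp N (pauli p.1) p.2 =
        siteOp N (pauli p.1) p.2 * pauliString N l := by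
      refine (Commute.list_prod_right _ _ ?_).eq.symm
      simp only [List.mem_map, forall_exists_index, and_imp, forall_apply_eq_imp_iff₂]
      exact fun q hq => siteOp_commute _ _ fun h => hl.1 (List.mem_map.mpr ⟨q, hq, h.symm⟩)
    have ih' := ih hl.2
    rw [pauliString, List.map_cons, List.prod_cons, ← pauliString, mul_assoc,
      ← mul_assoc (pauliString N l), hc, mul_assoc, ih', mul_one, siteOp_mul_self, pauli_mul_self,
      siteOp_one]

theorem pauliString_conjTranspose (l : List (Fin 3 × ℕ)) (hl : (l.map Prod.snd).Nodup) :
    (pauliString N l).conjTranspose = pauliString N l := by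
  induction l with
  | nil => simp [pauliString]
  | cons p l ih =>
    simp only [List.map_cons, List.nodup_cons] at hl
    have hc : pauliString N l * siteOp N (pauli p.1) p.2 =
        siteOp N (pauli p.1) p.2 * pauliString N l := by
      refine (Commute.list_prod_right _ _ ?_).eq.symm
      simp only [List.mem_map, forall_exists_index, and_imp, forall_apply_eq_imp_iff₂]
      exact fun q hq => siteOp_commute _ _ fun h => hl.1 (List.mem_map.mpr ⟨q, hq, h.symm⟩)
    rw [pauliString, List.map_cons, List.prod_cons, ← pauliString, Matrix.conjTranspose_mul,
      ih hl.2, siteOp_conjTranspose (pauli_isHermitian _), hc]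

theorem termString_nodup {L : ℕ} {x : Kind} {j : ℕ} (h : IsTerm L x j) :
    ((termString x j).map Prod.snd).Nodup := by
  obtain ⟨h1, h2, h3⟩ := h
  rcases x <;> simp [termString] <;> try omega
  all_goals
    have : j ≠ 1 := fun hj => by simpa using h3 hj
    omega

theorem t_mul_self {L : ℕ} {x : Kind} {j : ℕ} (h : IsTerm L x j) : t N x j * t N x j = 1 := by
  rw [t_eq_pauliString, pauliString_mul_self _ (termString_nodup h)]

theorem t_conjTranspose {L : ℕ} {x : Kind} {j : ℕ} (h : IsTerm L x j) :
    (t N x j).conjTranspose = t N x j := by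
  rw [t_eq_pauliString, pauliString_conjTranspose _ (termString_nodup h)]

end SiteOperators

/-! ### The terms of the chain -/

open Classical in
/-- `t_j^x` if it is a term of the chain of size `L`, and zero otherwise. -/
noncomputable def chainTerm (L : ℕ) (x : Kind) (j : ℕ) : Op (L + 2) :=
  if IsTerm L x j then t (L + 2) x j else 0

theorem chainTerm_of {L : ℕ} {x : Kind} {j : ℕ} (h : IsTerm L x j) :
    chainTerm L x j = t (L + 2) x j := if_pos h

theorem chainTerm_of_not {L : ℕ} {x : Kind} {j : ℕ} (h : ¬ IsTerm L x j) :
    chainTerm L x j = 0 := if_neg h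

/-- The level j = 1 is separated because j - 1 and j - 2 are truncated subtractions. From distance 3
on, two terms meet in at most one site, where both act by Z. -/
theorem stringSign_termString {x y : Kind} {j d : ℕ} (hx : 1 ≤ j ∧ (j = 1 → x = .C))
    (hy : j + d = 1 → y = .C) :
    stringSign (termString x j) (termString y (j + d)) = exchangeSign x y d := by
  obtain ⟨h1, h3⟩ := hx
  match j, h1, h3, hy with
  | 1, _, h3, hy =>
    rw [h3 rfl]
    match d, hy with
    | 0, hy => rw [hy rfl]; rfl
    | 1, _ => rcases y <;> rfl
    | 2, _ => rcases y <;> rfl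
    | d + 3, _ =>
      rw [exchangeSign_three]
      rcases y <;> simp [stringSign, termString, siteSign] <;> omega
  | i + 2, _, _, _ =>
    match d with
    | 0 => rcases x <;> rcases y <;> simp [stringSign, termString, siteSign, exchangeSign]
    | 1 =>
      rcases x <;> rcases y <;> simp [stringSign, termString, siteSign, exchangeSign] <;> omega
    | 2 =>
      rcases x <;> rcases y <;> simp [stringSign, termString, siteSign, exchangeSign] <;> omega
    | d + 3 =>
      rw [exchangeSign_three]
      rcases x <;> rcases y <;> simp [stringSign, termString, siteSign] <;> omega

theorem chainTerm_rel (L : ℕ) : TermRel (chainTerm L) where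
  zero x := chainTerm_of_not fun h => by simpa using h.1
  A1 := chainTerm_of_not fun h => by simpa using h.2.2 rfl
  B1 := chainTerm_of_not fun h => by simpa using h.2.2 rfl
  comm x y j d := by
    by_cases hx : IsTerm L x j
    · by_cases hy : IsTerm L y (j + d)
      · rw [chainTerm_of hx, chainTerm_of hy, t_eq_pauliString, t_eq_pauliString,
          pauliString_exchange, stringSign_termString ⟨hx.1, hx.2.2⟩ hy.2.2]
        have := hx.2.1
        rcases x <;> simp [termString] <;> omega
      · simp [chainTerm_of_not hy]
    · simp [chainTerm_of_not hx]
  mulAB j := by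
    by_cases h : IsTerm L .A (j + 1)
    · have hj : 1 ≤ j := by
        by_contra hj
        exact absurd (h.2.2 (by omega)) (by simp)
      have hL := h.2.1
      obtain ⟨i, rfl⟩ := Nat.exists_eq_add_of_le' hj
      rw [chainTerm_of h, chainTerm_of (x := .B) ⟨by omega, hL, by omega⟩,
        chainTerm_of (x := .C) ⟨by omega, by omega, fun _ => rfl⟩,
        chainTerm_of (x := .C) ⟨by omega, by omega, fun _ => rfl⟩]
      simp only [t, Nat.add_sub_cancel]
      rw [show i + 1 + 1 - 2 = i by omega]
      have c1 := siteOp_commute (N := L + 2) pauliZ pauliZ (show i + 1 + 1 + 1 ≠ i by omega)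
      have c2 := siteOp_commute (N := L + 2) pauliX pauliZ (show i + 1 + 1 ≠ i by omega)
      have c3 := siteOp_commute (N := L + 2) pauliX pauliZ (show i + 1 ≠ i by omega)
      have c4 := siteOp_commute (N := L + 2) pauliZ pauliY (show i + 1 + 1 + 1 ≠ i + 1 by omega)
      have c5 := siteOp_commute (N := L + 2) pauliX pauliY (show i + 1 + 1 ≠ i + 1 by omega)
      have c6 := siteOp_commute (N := L + 2) pauliZ pauliY (show i + 1 + 1 + 1 ≠ i + 1 + 1 by omega)
      have c7 := siteOp_commute (N := L + 2) pauliZ pauliZ (show i + 1 ≠ i + 1 + 1 by omega)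
      -- The terms A and B share two sites, and XY = iZ on each of them; the sign in the product
      -- relation is i².
      have e1 := siteOp_mul_self (N := L + 2) pauliX pauliY (i + 1)
      have e2 := siteOp_mul_self (N := L + 2) pauliX pauliY (i + 1 + 1)
      rw [pauliX_mul_pauliY, siteOp_smul _ _ (by omega)] at e1 e2
      generalize siteOp (L + 2) pauliX (i + 1) = x1 at *
      generalize siteOp (L + 2) pauliX (i + 1 + 1) = x2 at *
      generalize siteOp (L + 2) pauliY (i + 1) = y1 at *
      generalize siteOp (L + 2) pauliY (i + 1 + 1) = y2 at *
      generalize siteOp (L + 2) pauliZ i = z0 at *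
      generalize siteOp (L + 2) pauliZ (i + 1) = z1 at *
      generalize siteOp (L + 2) pauliZ (i + 1 + 1) = z2 at *
      generalize siteOp (L + 2) pauliZ (i + 1 + 1 + 1) = z3 at *
      calc x1 * x2 * z3 * (z0 * y1 * y2) = x1 * x2 * (z3 * z0) * y1 * y2 := by
            simp only [mul_assoc]
        _ = x1 * (x2 * z0) * (z3 * y1) * y2 := by rw [c1]; simp only [mul_assoc]
        _ = (x1 * z0) * (x2 * y1) * (z3 * y2) := by rw [c2, c4]; simp only [mul_assoc]
        _ = z0 * (x1 * y1) * (x2 * y2) * z3 := by rw [c3, c5, c6]; simp only [mul_assoc]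
        _ = -(z0 * (z1 * z2) * z3) := by
          rw [e1, e2]
          simp only [mul_smul_comm, smul_mul_assoc, smul_smul, Complex.I_mul_I, neg_smul, one_smul,
            neg_mul, mul_assoc]
        _ = -(z0 * z2 * (z1 * z3)) := by rw [c7]; simp only [mul_assoc]
    · have hB : ¬ IsTerm L .B (j + 1) := fun h' => h ⟨h'.1, h'.2.1, fun hj => by
        simpa using h'.2.2 hj⟩
      rw [chainTerm_of_not h, zero_mul, eq_comm, neg_eq_zero]
      by_cases hj : j = 0
      · rw [chainTerm_of_not (j := j) (fun h' => by have := h'.1; omega), zero_mul]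
      · rw [chainTerm_of_not (j := j + 1), mul_zero]
        exact fun h' => h ⟨h'.1, h'.2.1, fun hj' => by omega⟩

theorem chainTerm_mul_self {L : ℕ} {x : Kind} {j : ℕ} (h : IsTerm L x j) :
    chainTerm L x j * chainTerm L x j = 1 := by
  rw [chainTerm_of h, t_mul_self h]

/-! ### Factorization into gates -/

section Factorization

section Blocks

variable {𝒜 : Type} [Ring 𝒜]

/-- The product of the first `n` blocks `g_j^B g_j^A g_j^C`. -/
def blockProd (g : Kind → ℕ → 𝒜) : ℕ → 𝒜
  | 0 => 1
  | n + 1 => blockProd g n * (g .B n * g .A n * g .C n)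

/-- The reversed product of the first `n` blocks. -/
def blockProdT (g : Kind → ℕ → 𝒜) : ℕ → 𝒜
  | 0 => 1
  | n + 1 => (g .C n * g .A n * g .B n) * blockProdT g n

theorem blockProd_commute {g : Kind → ℕ → 𝒜} {x : 𝒜} {n : ℕ}
    (h : ∀ y j, j < n → Commute (g y j) x) :
    Commute (blockProd g n) x ∧ Commute (blockProdT g n) x := by
  induction n with
  | zero => exact ⟨Commute.one_left x, Commute.one_left x⟩
  | succ n ih =>
    obtain ⟨h1, h2⟩ := ih fun y j hj => h y j (by omega)
    have hA := h .A n (by omega)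
    have hB := h .B n (by omega)
    have hC := h .C n (by omega)
    exact ⟨h1.mul_left ((hB.mul_left hA).mul_left hC), ((hC.mul_left hA).mul_left hB).mul_left h2⟩

theorem blockProd_conj_succ (g : Kind → ℕ → 𝒜) (n : ℕ) (x : 𝒜) :
    blockProd g (n + 1) * x * blockProdT g (n + 1) = blockProd g n *
      (g .B n * (g .A n * (g .C n * x * g .C n) * g .A n) * g .B n) * blockProdT g n := by
  simp only [blockProd, blockProdT, mul_assoc]


end Blocks

variable {𝒜 : Type} [Ring 𝒜] [Algebra ℂ 𝒜]

/-- `g = cos(ϕ/2) + u sin(ϕ/2)` with `c = cos ϕ`, `s = sin ϕ`, by its algebraic properties. -/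
structure IsGate (g u : 𝒜) (c s : ℂ) : Prop where
  sq : g * g = 1 + s • u
  conj : ∀ x, u * x = -(x * u) → g * x * g = c • x
  comm : ∀ x, Commute u x → Commute g x
  unit : c ^ 2 + s ^ 2 = 1
  inv : s • (u * u) = s • 1

/-- Half-angle formulas. The alternative ϕ = 0 serves the positions without a term, where the gate
has to be 1 although u is no involution. -/
theorem isGate_cos_sin {u : 𝒜} {ϕ : ℂ} (h : u * u = 1 ∨ ϕ = 0) :
    IsGate (Complex.cos (ϕ / 2) • (1 : 𝒜) + Complex.sin (ϕ / 2) • u) u (Complex.cos ϕ)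
      (Complex.sin ϕ) := by
  rcases h with h | rfl
  · have hc : Complex.cos ϕ = Complex.cos (ϕ / 2) ^ 2 - Complex.sin (ϕ / 2) ^ 2 := by
      rw [← Complex.cos_two_mul']; ring_nf
    have hs : Complex.sin ϕ = 2 * Complex.sin (ϕ / 2) * Complex.cos (ϕ / 2) := by
      rw [← Complex.sin_two_mul]; ring_nf
    have h1 := Complex.sin_sq_add_cos_sq (ϕ / 2)
    refine ⟨?_, fun x hx => ?_, fun x hx => ?_, by rw [Complex.cos_sq_add_sin_sq], by rw [h]⟩
    · have : (1 : 𝒜) = (Complex.sin (ϕ / 2) ^ 2 + Complex.cos (ϕ / 2) ^ 2) • (1 : 𝒜) := by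
        rw [h1, one_smul]
      rw [hs]
      nth_rw 3 [this]
      simp only [mul_add, add_mul, smul_mul_assoc, mul_smul_comm, h, mul_one, one_mul]
      module
    · rw [hc]
      simp only [mul_add, add_mul, smul_mul_assoc, mul_smul_comm, mul_one, one_mul, smul_smul,
        smul_add, hx, neg_mul, mul_assoc, h, smul_neg]
      module
    · exact ((Commute.one_left x).smul_left _).add_left (hx.smul_left _)
  · refine ⟨by simp, by simp, by simp, by simp, by simp⟩

/-- Relations between the cosines and sines `c`, `s` of the angles. -/
structure FactorAngles (L : ℕ) (a b : ℕ → ℂ) (v : ℂ) (c s : Kind → ℕ → ℂ) : Prop where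
  recA : ∀ j, j + 2 ≤ L → s .A (j + 2) * (c .C j * c .A j * c .A (j + 1) * c .B (j + 1) *
    c .C (j + 1)) = -(v * (a (j + 1) * a (j + 2)))
  recB : ∀ j, j + 2 ≤ L → s .B (j + 2) * (c .C j * c .B j * c .A (j + 1) * c .B (j + 1) *
    c .C (j + 1)) = -(v * (b (j + 1) * b (j + 2)))
  recC : ∀ j, j + 1 ≤ L → s .C (j + 1) * (c .C j ^ 2 * c .A j * c .B j * c .A (j + 1) *
    c .B (j + 1)) = -(v * (a (j + 1) * b (j + 1)))
  constraint : ∀ j, j + 1 ≤ L → s .A (j + 1) * s .B (j + 1) =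
    s .C (j + 1) * c .A (j + 1) * c .B (j + 1) * s .C j

variable {u : Kind → ℕ → 𝒜}

theorem conj_commute {u g x : 𝒜} {c s : ℂ} (hg : IsGate g u c s) (hx : Commute u x) :
    g * x * g = x * (1 + s • u) := by
  rw [(hg.comm x hx).eq, mul_assoc, hg.sq]

/-- A_{n+2} anticommutes with all terms of block n + 1 and with C_n and A_n, and each of these gates
contributes a cosine: this is the denominator in the recursion for the A angle. It commutes with
B_n, whose gate therefore contributes its square, giving T^B_n between the outer blocks. -/
theorem conj_A (h : TermRel u) {L : ℕ} {g : Kind → ℕ → 𝒜} {c s : Kind → ℕ → ℂ}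
    (hg : ∀ x j, j ≤ L → IsGate (g x j) (u x j) (c x j) (s x j)) (n : ℕ) (hn : n + 2 ≤ L)
    {X : 𝒜} (hX : blockProd g n * (1 + s .B n • u .B n) * blockProdT g n = X) :
    blockProd g (n + 2) * u .A (n + 2) * blockProdT g (n + 2) =
      (c .C n * c .A n * c .A (n + 1) * c .B (n + 1) * c .C (n + 1)) • (u .A (n + 2) * X) := by
  have e1 := (hg .C (n + 1) (by omega)).conj (u .A (n + 2))
    (h.anticommute_of_sign (j := n + 1) (d := 1) (by rfl))
  have e2 := (hg .A (n + 1) (by omega)).conj (u .A (n + 2))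
    (h.anticommute_of_sign (j := n + 1) (d := 1) (by rfl))
  have e3 := (hg .B (n + 1) (by omega)).conj (u .A (n + 2))
    (h.anticommute_of_sign (j := n + 1) (d := 1) (by rfl))
  have e4 := (hg .C n (by omega)).conj (u .A (n + 2)) (h.anticommute_of_sign (by rfl))
  have e5 := (hg .A n (by omega)).conj (u .A (n + 2)) (h.anticommute_of_sign (by rfl))
  have e6 := conj_commute (hg .B n (by omega)) (h.commute_of_sign (x := .B) (y := .A) (j := n)
    (d := 2) (by rfl))
  obtain ⟨h1, -⟩ := blockProd_commute (g := g) (x := u .A (n + 2)) (n := n) fun y j hj =>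
    (hg y j (by omega)).comm _ (h.commute_far .A y (by omega)).symm
  rw [show n + 2 = n + 1 + 1 from rfl, blockProd_conj_succ, blockProd_conj_succ, e1]
  simp only [mul_smul_comm, smul_mul_assoc, e2, e3, e4, e5, e6, smul_smul]
  rw [← hX, ← mul_assoc (blockProd g n), h1.eq]
  simp only [mul_assoc]
  congr 1
  ring

/-- Not a literal mirror image of `conj_A`: within a block the B gate is outermost, so it also has
to pass the squared A gate, which uses that A_n and B_n commute. -/
theorem conj_B (h : TermRel u) {L : ℕ} {g : Kind → ℕ → 𝒜} {c s : Kind → ℕ → ℂ}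
    (hg : ∀ x j, j ≤ L → IsGate (g x j) (u x j) (c x j) (s x j)) (n : ℕ) (hn : n + 2 ≤ L)
    {X : 𝒜} (hX : blockProd g n * (1 + s .A n • u .A n) * blockProdT g n = X) :
    blockProd g (n + 2) * u .B (n + 2) * blockProdT g (n + 2) =
      (c .C n * c .B n * c .A (n + 1) * c .B (n + 1) * c .C (n + 1)) • (u .B (n + 2) * X) := by
  have e1 := (hg .C (n + 1) (by omega)).conj (u .B (n + 2))
    (h.anticommute_of_sign (j := n + 1) (d := 1) (by rfl))
  have e2 := (hg .A (n + 1) (by omega)).conj (u .B (n + 2))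
    (h.anticommute_of_sign (j := n + 1) (d := 1) (by rfl))
  have e3 := (hg .B (n + 1) (by omega)).conj (u .B (n + 2))
    (h.anticommute_of_sign (j := n + 1) (d := 1) (by rfl))
  have e4 := (hg .C n (by omega)).conj (u .B (n + 2)) (h.anticommute_of_sign (by rfl))
  have hAB : Commute (u .A n) (u .B n) := h.commute_of_sign (j := n) (d := 0) (by rfl)
  have e5 := (hg .B n (by omega)).conj (u .B (n + 2) * (1 + s .A n • u .A n)) (by
    have e : u .B n * u .B (n + 2) = -(u .B (n + 2) * u .B n) := h.anticommute_of_sign (by rfl)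
    have e' : Commute (u .B n) (1 + s .A n • u .A n) :=
      (Commute.one_right _).add_right (hAB.symm.smul_right _)
    rw [← mul_assoc, e, neg_mul, mul_assoc, e'.eq, mul_assoc])
  have e6 := conj_commute (hg .A n (by omega)) (h.commute_of_sign (x := .A) (y := .B) (j := n)
    (d := 2) (by rfl))
  obtain ⟨h1, -⟩ := blockProd_commute (g := g) (x := u .B (n + 2)) (n := n) fun y j hj =>
    (hg y j (by omega)).comm _ (h.commute_far .B y (by omega)).symm
  rw [show n + 2 = n + 1 + 1 from rfl, blockProd_conj_succ, blockProd_conj_succ, e1]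
  simp only [mul_smul_comm, smul_mul_assoc, e2, e3, e4, e5, e6, smul_smul]
  rw [← hX, ← mul_assoc (blockProd g n), h1.eq]
  simp only [mul_assoc]
  congr 1
  ring

/-- The gate of C_n contributes its square 1 + sC_n, and (1 - sC_n)(1 + sC_n) = 1 - s² = c². This is
the source of the squared cosine in the recursion for the C angle. -/
theorem conj_C (h : TermRel u) {L : ℕ} {g : Kind → ℕ → 𝒜} {c s : Kind → ℕ → ℂ}
    (hg : ∀ x j, j ≤ L → IsGate (g x j) (u x j) (c x j) (s x j)) (n : ℕ) (hn : n + 1 ≤ L)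
    {X : 𝒜} (hX : blockProd g n * blockProdT g n = X) :
    blockProd g (n + 1) * (u .C (n + 1) * (1 - s .C n • u .C n)) * blockProdT g (n + 1) =
      (c .C n ^ 2 * c .A n * c .B n) • (u .C (n + 1) * X) := by
  have hC := hg .C n (by omega)
  have e2 := (hg .A n (by omega)).conj (u .C (n + 1)) (h.anticommute_of_sign (by rfl))
  have e3 := (hg .B n (by omega)).conj (u .C (n + 1)) (h.anticommute_of_sign (by rfl))
  have hCC : Commute (u .C n) (u .C (n + 1)) := h.commute_of_sign (by rfl)
  have e1 : g .C n * (u .C (n + 1) * (1 - s .C n • u .C n)) * g .C n =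
      c .C n ^ 2 • u .C (n + 1) := by
    have h2 : Commute (u .C n) (u .C (n + 1) * (1 - s .C n • u .C n)) :=
      hCC.mul_right ((Commute.one_right _).sub_right ((Commute.refl _).smul_right _))
    rw [conj_commute hC h2, eq_sub_of_add_eq hC.unit, mul_assoc]
    have h3 : (1 - s .C n • u .C n) * (1 + s .C n • u .C n) = (1 - s .C n ^ 2) • (1 : 𝒜) := by
      have h4 : s .C n • s .C n • (u .C n * u .C n) = s .C n • s .C n • (1 : 𝒜) := by rw [hC.inv]
      simp only [mul_add, sub_mul, mul_one, one_mul, smul_mul_assoc, mul_smul_comm, smul_sub, h4]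
      module
    rw [h3, mul_smul_comm, mul_one]
  obtain ⟨h1, -⟩ := blockProd_commute (g := g) (x := u .C (n + 1)) (n := n) fun y j hj => by
    refine (hg y j (by omega)).comm _ ?_
    obtain ⟨d, hd⟩ := Nat.exists_eq_add_of_le (show j + 2 ≤ n + 1 by omega)
    rw [hd, add_assoc]
    refine h.commute_of_sign ?_
    match d with
    | 0 => rcases y <;> rfl
    | d + 1 => rw [show 2 + (d + 1) = d + 3 by ring, exchangeSign_three]
  rw [blockProd_conj_succ, e1]
  simp only [mul_smul_comm, smul_mul_assoc, e2, e3, smul_smul]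
  rw [← hX, h1.eq]
  simp only [mul_assoc]

/-- The cross term of the squared A and B gates is -s^A s^B C_nC_{n+1}. By the angle constraint it
merges with the C contribution into a multiple of C_{n+1}(1 - s^C_n C_n), the combination that
`conj_C` can treat. -/
theorem conj_one (h : TermRel u) {L : ℕ} {g : Kind → ℕ → 𝒜} {c s : Kind → ℕ → ℂ}
    (hg : ∀ x j, j ≤ L → IsGate (g x j) (u x j) (c x j) (s x j)) (n : ℕ) (hn : n + 1 ≤ L)
    (hs : s .A (n + 1) * s .B (n + 1) = s .C (n + 1) * c .A (n + 1) * c .B (n + 1) * s .C n) :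
    g .B (n + 1) * (g .A (n + 1) * (g .C (n + 1) * 1 * g .C (n + 1)) * g .A (n + 1)) *
      g .B (n + 1) = (1 + s .A (n + 1) • u .A (n + 1)) + (1 + s .B (n + 1) • u .B (n + 1)) - 1
        + (s .C (n + 1) * c .A (n + 1) * c .B (n + 1)) •
          (u .C (n + 1) * (1 - s .C n • u .C n)) := by
  have e1 := (hg .A (n + 1) hn).conj (u .C (n + 1))
    (h.anticommute_of_sign (j := n + 1) (d := 0) (by rfl))
  have e2 := (hg .B (n + 1) hn).conj (u .C (n + 1))
    (h.anticommute_of_sign (j := n + 1) (d := 0) (by rfl))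
  have e3 := conj_commute (hg .B (n + 1) hn)
    (h.commute_of_sign (x := .B) (y := .A) (j := n + 1) (d := 0) (by rfl))
  have hCC : Commute (u .C n) (u .C (n + 1)) := h.commute_of_sign (by rfl)
  simp only [mul_add, mul_sub, add_mul, mul_one, (hg .C (n + 1) hn).sq, (hg .A (n + 1) hn).sq,
    (hg .B (n + 1) hn).sq, mul_smul_comm, smul_mul_assoc, e1, e2, e3, smul_smul, h.mulAB,
    hCC.eq, add_zero] at *
  linear_combination (norm := module) (-hs) • (u .C (n + 1) * u .C n)

/-- T^A and T^B appear as the same product with one extra squared gate in the middle, and all three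
have to be followed together. Blocks are counted from 0, so n of them give T_{n-1}. -/
theorem sT_eq_blockProd (h : TermRel u) {L : ℕ} {g : Kind → ℕ → 𝒜} {c s : Kind → ℕ → ℂ}
    (hg : ∀ x j, j ≤ L → IsGate (g x j) (u x j) (c x j) (s x j)) {a b : ℕ → ℂ} {v : ℂ}
    (hF : FactorAngles L a b v c s) (h0 : ∀ x, g x 0 = 1) (n : ℕ) (hn : n ≤ L + 1) :
    blockProd g n * blockProdT g n = sT u a b v (n + 1) ∧
    (n ≤ L → blockProd g n * (1 + s .A n • u .A n) * blockProdT g n = sA u a b v (n + 2) ∧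
      blockProd g n * (1 + s .B n • u .B n) * blockProdT g n = sB u a b v (n + 2)) := by
  have hz := h.toLowZero
  induction n using Nat.strong_induction_on with
  | _ n ih =>
    match n, ih with
    | 0, _ => simp [blockProd, blockProdT, hz.sA_succ, hz.sB_succ, h.zero]
    | 1, _ =>
      simp [blockProd, blockProdT, hz.sA_succ, hz.sB_succ, h0, h.A1, h.B1, sT_two hz]
    | n + 2, ih =>
      obtain ⟨i1, i2⟩ := ih n (by omega) (by omega)
      obtain ⟨iA, iB⟩ := i2 (by omega)
      obtain ⟨j1, j2⟩ := ih (n + 1) (by omega) (by omega)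
      obtain ⟨jA, jB⟩ := j2 (by omega)
      have hT : blockProd g (n + 2) * blockProdT g (n + 2) = sT u a b v (n + 3) := by
        have e := conj_one h hg n (by omega) (hF.constraint n (by omega))
        rw [← mul_one (blockProd g (n + 2)), show n + 2 = n + 1 + 1 from rfl,
          blockProd_conj_succ, e]
        simp only [mul_add, mul_sub, add_mul, sub_mul, mul_smul_comm, smul_mul_assoc] at jA jB ⊢
        have hC := conj_C h hg n (by omega) i1
        simp only [mul_sub, sub_mul, mul_smul_comm, smul_mul_assoc] at hC
        have hAexp := hz.sA_succ a b v (n + 1)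
        have hBexp := hz.sB_succ a b v (n + 1)
        have hTexp := hz.sT_succ a b v (n + 1)
        have hr := hF.recC n (by omega)
        simp only [mul_one] at *
        rw [show n + 1 + 2 = n + 3 from rfl] at *
        simp only [couplingR] at *
        rw [hTexp]
        linear_combination (norm := module) jA + jB - j1 + hAexp + hBexp
          + (s .C (n + 1) * c .A (n + 1) * c .B (n + 1)) • hC
          + hr • (u .C (n + 1) * sT u a b v (n + 1))
      refine ⟨hT, fun hL => ⟨?_, ?_⟩⟩
      · have e := conj_A h hg n hL iB
        rw [mul_add, add_mul, mul_one, hT, mul_smul_comm, smul_mul_assoc, e, smul_smul,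
          hF.recA n hL, hz.sA_succ, neg_smul, ← sub_eq_add_neg]
        rfl
      · have e := conj_B h hg n hL iA
        rw [mul_add, add_mul, mul_one, hT, mul_smul_comm, smul_mul_assoc, e, smul_smul,
          hF.recB n hL, hz.sB_succ, neg_smul, ← sub_eq_add_neg]
        rfl

end Factorization

/-- Padding by trivial gates removes the exceptional first step of the staircase; the trivial block
of index 0 accounts for the shift m + 1. -/
theorem stair_eq_blockProd {𝒜 : Type} [Ring 𝒜] {g g' : Kind → ℕ → 𝒜} {L : ℕ}
    (hg : ∀ x j, IsTerm L x j → g x j = g' x j) (h0 : ∀ x, g' x 0 = 1) (hA : g' .A 1 = 1)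
    (hB : g' .B 1 = 1) (m : ℕ) (hm : m ≤ L) :
    stairG g m = blockProd g' (m + 1) ∧ stairGT g m = blockProdT g' (m + 1) := by
  induction m with
  | zero => simp [stairG, stairGT, blockProd, blockProdT, h0]
  | succ m ih =>
    obtain ⟨h1, h2⟩ := ih (by omega)
    match m with
    | 0 =>
      have := hg .C 1 ⟨le_rfl, hm, fun _ => rfl⟩
      simp [stairG, stairGT, blockProd, blockProdT, h0, hA, hB, this]
    | m + 1 =>
      have eA := hg .A (m + 2) ⟨by omega, hm, by omega⟩
      have eB := hg .B (m + 2) ⟨by omega, hm, by omega⟩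
      have eC := hg .C (m + 2) ⟨by omega, hm, by omega⟩
      rw [stairG, stairGT, h1, h2, eA, eB, eC]
      exact ⟨rfl, rfl⟩

/-! ### Angles -/

theorem angleRecursion_iff (L : ℕ) (a b : ℕ → ℝ) (y : ℝ) (θ : Kind → ℕ → ℝ) :
    AngleRecursion L a b (Complex.I * y) (fun x j => Complex.I * θ x j) ↔
      HyperbolicRecursion L a b y θ := by
  have hs : ∀ r : ℝ, Complex.sin (Complex.I * r) = (Real.sinh r : ℂ) * Complex.I := fun r => by
    rw [mul_comm, Complex.sin_mul_I, Complex.ofReal_sinh]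
  have hc : ∀ r : ℝ, Complex.cos (Complex.I * r) = (Real.cosh r : ℂ) := fun r => by
    rw [mul_comm, Complex.cos_mul_I, Complex.ofReal_cosh]
  have key : ∀ r p q d : ℝ, ((r : ℂ) * Complex.I = -(Complex.I * y * p * q / (d : ℂ)) ↔
      r = -(y * p * q / d)) := fun r p q d => by
    rw [show -(Complex.I * y * p * q / (d : ℂ)) = ((-(y * p * q / d) : ℝ) : ℂ) * Complex.I by
      push_cast; ring, mul_left_inj' Complex.I_ne_zero, Complex.ofReal_inj]
  constructor
  · rintro ⟨⟨h1, h2, h3⟩, hA, hB, hC⟩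
    refine ⟨⟨fun x => by simpa using h1 x, by simpa using h2, by simpa using h3⟩,
      fun j h h' => ?_, fun j h h' => ?_, fun j h => ?_⟩
    · have := hA j h h'
      simp only [hs, hc] at this
      exact (key _ _ _ _).1 (by exact_mod_cast this)
    · have := hB j h h'
      simp only [hs, hc] at this
      exact (key _ _ _ _).1 (by exact_mod_cast this)
    · have := hC j h
      simp only [hs, hc] at this
      exact (key _ _ _ _).1 (by exact_mod_cast this)
  · rintro ⟨⟨h1, h2, h3⟩, hA, hB, hC⟩
    refine ⟨⟨fun x => by simpa using h1 x, by simpa using h2, by simpa using h3⟩,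
      fun j h h' => ?_, fun j h h' => ?_, fun j h => ?_⟩
    · simp only [hs, hc]
      exact_mod_cast (key _ _ _ _).2 (hA j h h')
    · simp only [hs, hc]
      exact_mod_cast (key _ _ _ _).2 (hB j h h')
    · simp only [hs, hc]
      exact_mod_cast (key _ _ _ _).2 (hC j h)

-- Solving the recursion at imaginary spectral parameter.

section Existence

variable (a b : ℕ → ℝ) (y : ℝ)

/-- The angles at `j + 1`, from those at `j - 1` and at `j`. -/
noncomputable def nextAngle (j : ℕ) (p q : Kind → ℝ) : Kind → ℝ :=
  let A := if j = 0 then 0 else Real.arsinh (-(y * a j * a (j + 1) /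
    (Real.cosh (p .C) * Real.cosh (p .A) * Real.cosh (q .A) * Real.cosh (q .B) *
      Real.cosh (q .C))))
  let B := if j = 0 then 0 else Real.arsinh (-(y * b j * b (j + 1) /
    (Real.cosh (p .C) * Real.cosh (p .B) * Real.cosh (q .A) * Real.cosh (q .B) *
      Real.cosh (q .C))))
  fun
  | .A => A
  | .B => B
  | .C => Real.arsinh (-(y * a (j + 1) * b (j + 1) /
      (Real.cosh (q .C) ^ 2 * Real.cosh (q .A) * Real.cosh (q .B) * Real.cosh A * Real.cosh B)))

/-- The angles at `j - 1` and at `j`. -/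
noncomputable def anglePair : ℕ → (Kind → ℝ) × (Kind → ℝ)
  | 0 => (0, 0)
  | j + 1 => ((anglePair j).2, nextAngle a b y j (anglePair j).1 (anglePair j).2)

/-- No step can fail: sinh is a bijection of ℝ and the denominators are products of hyperbolic
cosines. -/
theorem exists_hyperbolicRecursion (L : ℕ) :
    ∃ θ : Kind → ℕ → ℝ, HyperbolicRecursion L a b y θ := by
  refine ⟨fun x j => (anglePair a b y j).2 x, ⟨fun x => rfl, ?_, ?_⟩, fun j h _ => ?_,
    fun j h _ => ?_, fun j _ => ?_⟩
  · simp [anglePair, nextAngle]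
  · simp [anglePair, nextAngle]
  · obtain ⟨i, rfl⟩ := Nat.exists_eq_add_of_le' h
    simp [anglePair, nextAngle, Real.sinh_arsinh]
  · obtain ⟨i, rfl⟩ := Nat.exists_eq_add_of_le' h
    simp [anglePair, nextAngle, Real.sinh_arsinh]
  · simp [anglePair, nextAngle, Real.sinh_arsinh]

end Existence

theorem HyperbolicRecursion.unique {L : ℕ} {a b : ℕ → ℝ} {y : ℝ} {θ θ' : Kind → ℕ → ℝ}
    (h : HyperbolicRecursion L a b y θ) (h' : HyperbolicRecursion L a b y θ') :
    ∀ j x, j ≤ L → θ x j = θ' x j := by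
  intro j
  induction j using Nat.strong_induction_on with
  | _ j ih =>
    intro x hj
    match j, ih, hj with
    | 0, _, _ => rw [h.1.1, h'.1.1]
    | j + 1, ih, hj =>
      have e0 : ∀ x, θ x j = θ' x j := fun x => ih j (by omega) x (by omega)
      have e1 : ∀ x, θ x (j - 1) = θ' x (j - 1) := fun x => ih (j - 1) (by omega) x (by omega)
      have hA : θ .A (j + 1) = θ' .A (j + 1) := by
        rcases Nat.eq_zero_or_pos j with rfl | h1
        · rw [h.1.2.1, h'.1.2.1]
        · apply Real.sinh_injective
          rw [h.recA j h1 hj, h'.recA j h1 hj]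
          simp only [e0, e1]
      have hB : θ .B (j + 1) = θ' .B (j + 1) := by
        rcases Nat.eq_zero_or_pos j with rfl | h1
        · rw [h.1.2.2, h'.1.2.2]
        · apply Real.sinh_injective
          rw [h.recB j h1 hj, h'.recB j h1 hj]
          simp only [e0, e1]
      have hC : θ .C (j + 1) = θ' .C (j + 1) := by
        apply Real.sinh_injective
        rw [h.recC j hj, h'.recC j hj]
        simp only [e0, hA, hB]
      rcases x with _ | _ | _
      exacts [hA, hB, hC]

/-- For j ≥ 1 both sides contain y²a_ja_{j+1}b_jb_{j+1}, once from the A and B recursions and once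
from two consecutive C recursions, and the denominators agree. At j = 0 both sides vanish. -/
theorem HyperbolicRecursion.constraint {L : ℕ} {a b : ℕ → ℝ} {y : ℝ} {θ : Kind → ℕ → ℝ}
    (h : HyperbolicRecursion L a b y θ) (j : ℕ) (hj : j + 1 ≤ L) :
    Real.sinh (θ .A (j + 1)) * Real.sinh (θ .B (j + 1)) =
      Real.sinh (θ .C (j + 1)) * Real.cosh (θ .A (j + 1)) * Real.cosh (θ .B (j + 1)) *
        Real.sinh (θ .C j) := by
  match j, hj with
  | 0, _ => simp [h.1.1, h.1.2.1]
  | j + 1, hj =>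
    rw [h.recA (j + 1) (by omega) hj, h.recB (j + 1) (by omega) hj, h.recC (j + 1) hj,
      h.recC j (by omega)]
    simp only [Nat.add_sub_cancel]
    have := fun x j => (Real.cosh_pos (θ x j)).ne'
    field_simp [this]

-- The Gudermannian change of angles.

section CircuitAngle

variable (θ : Kind → ℕ → ℝ) (x : Kind) (j : ℕ)

theorem cosh_eq_half (r : ℝ) : Real.cosh r = Real.cosh (r / 2) ^ 2 + Real.sinh (r / 2) ^ 2 := by
  rw [← Real.cosh_two_mul]; ring_nf

theorem one_add_tanh_sq (r : ℝ) :
    1 + Real.tanh (r / 2) ^ 2 = Real.cosh r / Real.cosh (r / 2) ^ 2 := by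
  have := (Real.cosh_pos (r / 2)).ne'
  rw [cosh_eq_half, Real.tanh_eq_sinh_div_cosh]
  field_simp

theorem sqrt_one_add_tanh_sq (r : ℝ) :
    √(1 + Real.tanh (r / 2) ^ 2) = √(Real.cosh r) / Real.cosh (r / 2) := by
  rw [one_add_tanh_sq, Real.sqrt_div' _ (sq_nonneg _), Real.sqrt_sq (Real.cosh_pos _).le]

theorem cos_circuitAngle :
    Real.cos (circuitAngle θ x j) = Real.cosh (θ x j / 2) / √(Real.cosh (θ x j)) := by
  rw [circuitAngle, Real.cos_arctan, sqrt_one_add_tanh_sq, one_div_div]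

theorem sin_circuitAngle :
    Real.sin (circuitAngle θ x j) = Real.sinh (θ x j / 2) / √(Real.cosh (θ x j)) := by
  have := (Real.cosh_pos (θ x j / 2)).ne'
  rw [circuitAngle, Real.sin_arctan, sqrt_one_add_tanh_sq, Real.tanh_eq_sinh_div_cosh]
  field_simp

/-- The doubled angle is the Gudermannian of θ: its cosine, sine and tangent are 1/cosh θ, tanh θ
and sinh θ, which turns the hyperbolic recursion into the one for tan 2φ. -/
theorem cos_two_circuitAngle :
    Real.cos (2 * circuitAngle θ x j) = 1 / Real.cosh (θ x j) := by
  have h := Real.cosh_pos (θ x j)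
  rw [Real.cos_two_mul', cos_circuitAngle, sin_circuitAngle, div_pow, div_pow,
    Real.sq_sqrt h.le, ← sub_div, Real.cosh_sq_sub_sinh_sq]

theorem sin_two_circuitAngle :
    Real.sin (2 * circuitAngle θ x j) = Real.sinh (θ x j) / Real.cosh (θ x j) := by
  have h := Real.cosh_pos (θ x j)
  have h2 : Real.sinh (θ x j) = 2 * Real.sinh (θ x j / 2) * Real.cosh (θ x j / 2) := by
    rw [← Real.sinh_two_mul]; ring_nf
  have h3 := Real.sqrt_ne_zero'.2 h
  rw [Real.sin_two_mul, cos_circuitAngle, sin_circuitAngle, h2]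
  nth_rw 3 [← Real.sq_sqrt h.le]
  field_simp

theorem tan_two_circuitAngle :
    Real.tan (2 * circuitAngle θ x j) = Real.sinh (θ x j) := by
  have h := (Real.cosh_pos (θ x j)).ne'
  rw [Real.tan_eq_sin_div_cos, cos_two_circuitAngle, sin_two_circuitAngle]
  field_simp

theorem abs_circuitAngle_lt : |circuitAngle θ x j| < Real.pi / 4 := by
  rw [circuitAngle, ← Real.arctan_one, abs_lt, ← Real.arctan_neg]
  exact ⟨Real.arctan_strictMono (Real.neg_one_lt_tanh _),
    Real.arctan_strictMono (Real.tanh_lt_one _)⟩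

end CircuitAngle

theorem HyperbolicRecursion.circuitRecursion {L : ℕ} {a b : ℕ → ℝ} {y : ℝ} {θ : Kind → ℕ → ℝ}
    (h : HyperbolicRecursion L a b y θ) : CircuitRecursion L a b y (circuitAngle θ) := by
  have hi : ∀ x j, θ x j = 0 → circuitAngle θ x j = 0 := fun x j hx => by simp [circuitAngle, hx]
  refine ⟨⟨fun x => hi _ _ (h.1.1 x), hi _ _ h.1.2.1, hi _ _ h.1.2.2⟩,
    fun j h1 h2 => ?_, fun j h1 h2 => ?_, fun j h1 => ?_⟩
  · rw [tan_two_circuitAngle, h.recA j h1 h2]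
    simp only [cos_two_circuitAngle]
    field_simp
  · rw [tan_two_circuitAngle, h.recB j h1 h2]
    simp only [cos_two_circuitAngle]
    field_simp
  · rw [tan_two_circuitAngle, h.recC j h1]
    simp only [cos_two_circuitAngle]
    field_simp

theorem HyperbolicRecursion.angleConstraint {L : ℕ} {a b : ℕ → ℝ} {y : ℝ} {θ : Kind → ℕ → ℝ}
    (h : HyperbolicRecursion L a b y θ) : AngleConstraint L (circuitAngle θ) := by
  intro j h1 h2
  obtain ⟨i, rfl⟩ := Nat.exists_eq_add_of_le' (show 1 ≤ j by omega)
  have := h.constraint i h2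
  have hA := (Real.cosh_pos (θ .A (i + 1))).ne'
  have hB := (Real.cosh_pos (θ .B (i + 1))).ne'
  simp only [tan_two_circuitAngle, sin_two_circuitAngle, Nat.add_sub_cancel]
  field_simp
  linarith

theorem HyperbolicRecursion.factorAngles {L : ℕ} {a b : ℕ → ℝ} {y : ℝ} {θ : Kind → ℕ → ℝ}
    (h : HyperbolicRecursion L a b y θ) :
    FactorAngles L (fun j => (a j : ℂ)) (fun j => (b j : ℂ)) (Complex.I * y)
      (fun x j => Complex.cos (Complex.I * θ x j)) (fun x j => Complex.sin (Complex.I * θ x j)) := by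
  have hs : ∀ r : ℝ, Complex.sin (Complex.I * r) = (Real.sinh r : ℂ) * Complex.I := fun r => by
    rw [mul_comm, Complex.sin_mul_I, Complex.ofReal_sinh]
  have hc : ∀ r : ℝ, Complex.cos (Complex.I * r) = (Real.cosh r : ℂ) := fun r => by
    rw [mul_comm, Complex.cos_mul_I, Complex.ofReal_cosh]
  have hne : ∀ x j, Real.cosh (θ x j) ≠ 0 := fun x j => (Real.cosh_pos _).ne'
  simp only [hs, hc]
  refine ⟨fun j hj => ?_, fun j hj => ?_, fun j hj => ?_, fun j hj => ?_⟩
  · have e : Real.sinh (θ .A (j + 2)) * (Real.cosh (θ .C j) * Real.cosh (θ .A j) *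
        Real.cosh (θ .A (j + 1)) * Real.cosh (θ .B (j + 1)) * Real.cosh (θ .C (j + 1))) =
        -(y * a (j + 1) * a (j + 2)) := by
      rw [h.recA (j + 1) (by omega) (by omega)]
      simp only [Nat.add_sub_cancel]
      field_simp [hne]
    have e' := congrArg (fun r : ℝ => (r : ℂ) * Complex.I) e
    push_cast at e'
    push_cast
    linear_combination e'
  · have e : Real.sinh (θ .B (j + 2)) * (Real.cosh (θ .C j) * Real.cosh (θ .B j) *
        Real.cosh (θ .A (j + 1)) * Real.cosh (θ .B (j + 1)) * Real.cosh (θ .C (j + 1))) =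
        -(y * b (j + 1) * b (j + 2)) := by
      rw [h.recB (j + 1) (by omega) (by omega)]
      simp only [Nat.add_sub_cancel]
      field_simp [hne]
    have e' := congrArg (fun r : ℝ => (r : ℂ) * Complex.I) e
    push_cast at e'
    push_cast
    linear_combination e'
  · have e : Real.sinh (θ .C (j + 1)) * (Real.cosh (θ .C j) ^ 2 * Real.cosh (θ .A j) *
        Real.cosh (θ .B j) * Real.cosh (θ .A (j + 1)) * Real.cosh (θ .B (j + 1))) =
        -(y * a (j + 1) * b (j + 1)) := by
      rw [h.recC j (by omega)]
      field_simp [hne]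
    have e' := congrArg (fun r : ℝ => (r : ℂ) * Complex.I) e
    push_cast at e'
    push_cast
    linear_combination e'
  · have e' := congrArg (fun r : ℝ => (r : ℂ)) (h.constraint j hj)
    push_cast at e'
    push_cast
    linear_combination Complex.I ^ 2 * e'

/-! ### Gates -/

section Gates

variable {L : ℕ}

/-- The algebra homomorphism from `ℂ × ℂ` determined by an involution. -/
noncomputable def involutionHom {N : ℕ} {u : Op N} (hu : u * u = 1) : ℂ × ℂ →+* Op N where
  toFun z := ((z.1 + z.2) / 2) • 1 + ((z.1 - z.2) / 2) • u
  map_one' := by simp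
  map_zero' := by simp
  map_add' z w := by simp only [Prod.fst_add, Prod.snd_add]; module
  map_mul' z w := by
    simp only [Prod.fst_mul, Prod.snd_mul, mul_add, add_mul, smul_mul_assoc, mul_smul_comm, hu,
      one_mul, mul_one]
    module

/-- The complementary projections (1 ± u)/2 give a ring homomorphism from ℂ × ℂ, which carries the
componentwise exponential to the exponential of a multiple of u. -/
theorem exp_smul_involution {N : ℕ} {u : Op N} (hu : u * u = 1) (r : ℝ) :
    NormedSpace.exp ((Complex.I * (r : ℂ)) • u) =
      (Real.cos r : ℂ) • (1 : Op N) + (Complex.I * (Real.sin r : ℂ)) • u := by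
  have hcont : Continuous (involutionHom hu) := by
    change Continuous fun z : ℂ × ℂ => ((z.1 + z.2) / 2) • (1 : Op N) + ((z.1 - z.2) / 2) • u
    fun_prop
  have h1 : (Complex.I * (r : ℂ)) • u = involutionHom hu (Complex.I * r, -(Complex.I * r)) := by
    change _ = (((Complex.I * r) + -(Complex.I * r)) / 2) • (1 : Op N)
      + (((Complex.I * r) - -(Complex.I * r)) / 2) • u
    module
  have h2 : involutionHom hu (NormedSpace.exp (Complex.I * (r : ℂ), -(Complex.I * (r : ℂ)))) =
      NormedSpace.exp (involutionHom hu (Complex.I * (r : ℂ), -(Complex.I * (r : ℂ)))) :=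
    letI := Matrix.linftyOpNormedRing (n := Fin N → Fin 2) (α := ℂ)
    letI := Matrix.linftyOpNormedAlgebra (n := Fin N → Fin 2) (α := ℂ) (R := ℚ)
    NormedSpace.map_exp (involutionHom hu) hcont _
  rw [h1, ← h2]
  change (((NormedSpace.exp (Complex.I * (r : ℂ), -(Complex.I * (r : ℂ)))).1
      + (NormedSpace.exp (Complex.I * (r : ℂ), -(Complex.I * (r : ℂ)))).2) / 2) • (1 : Op N)
    + (((NormedSpace.exp (Complex.I * (r : ℂ), -(Complex.I * (r : ℂ)))).1
      - (NormedSpace.exp (Complex.I * (r : ℂ), -(Complex.I * (r : ℂ)))).2) / 2) • u = _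
  rw [Prod.fst_exp, Prod.snd_exp, ← Complex.exp_eq_exp_ℂ, mul_comm, ← neg_mul, Complex.exp_mul_I,
    Complex.exp_mul_I, Complex.cos_neg, Complex.sin_neg]
  push_cast
  module

theorem gateU_eq {φ : Kind → ℕ → ℝ} {x : Kind} {j : ℕ} (h : IsTerm L x j) :
    gateU (L + 2) φ x j = (Real.cos (φ x j) : ℂ) • (1 : Op (L + 2)) +
      (Complex.I * (Real.sin (φ x j) : ℂ)) • t (L + 2) x j :=
  exp_smul_involution (t_mul_self h) _

theorem gateG_eq (N : ℕ) (θ : Kind → ℕ → ℝ) (x : Kind) (j : ℕ) :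
    gateG N (fun x j => Complex.I * θ x j) x j =
      (Real.cosh (θ x j / 2) : ℂ) • (1 : Op N) +
        (Complex.I * (Real.sinh (θ x j / 2) : ℂ)) • t N x j := by
  have e : Complex.I * (θ x j : ℂ) / 2 = ((θ x j / 2 : ℝ) : ℂ) * Complex.I := by push_cast; ring
  rw [gateG, e, Complex.cos_mul_I, Complex.sin_mul_I, Complex.ofReal_cosh, Complex.ofReal_sinh,
    mul_comm Complex.I]

theorem gateU_circuitAngle {θ : Kind → ℕ → ℝ} {x : Kind} {j : ℕ} (h : IsTerm L x j) :
    gateU (L + 2) (circuitAngle θ) x j = (1 / (Real.sqrt (Real.cosh (θ x j)) : ℂ)) •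
      gateG (L + 2) (fun x j => Complex.I * θ x j) x j := by
  rw [gateU_eq h, gateG_eq, cos_circuitAngle, sin_circuitAngle]
  push_cast
  module

theorem gateU_mem_unitaryGroup {φ : Kind → ℕ → ℝ} {x : Kind} {j : ℕ} (h : IsTerm L x j) :
    gateU (L + 2) φ x j ∈ Matrix.unitaryGroup (Fin (L + 2) → Fin 2) ℂ := by
  rw [Matrix.mem_unitaryGroup_iff, Matrix.star_eq_conjTranspose, gateU_eq h]
  have h1 : ((Real.cos (φ x j) : ℂ)) ^ 2 + (Real.sin (φ x j) : ℂ) ^ 2 = 1 := by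
    exact_mod_cast Real.cos_sq_add_sin_sq (φ x j)
  simp only [Matrix.conjTranspose_add, Matrix.conjTranspose_smul, Matrix.conjTranspose_one,
    t_conjTranspose h, star_mul', Complex.star_def, Complex.conj_I, Complex.conj_ofReal, mul_add,
    add_mul, smul_mul_assoc, mul_smul_comm, t_mul_self h, one_mul, mul_one]
  have h2 : (1 : Op (L + 2)) =
      ((Real.cos (φ x j) : ℂ) ^ 2 + (Real.sin (φ x j) : ℂ) ^ 2) • (1 : Op (L + 2)) := by
    rw [h1, one_smul]
  nth_rw 3 [h2]
  have hI := Complex.I_mul_I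
  linear_combination (norm := module) (-(Real.sin (φ x j) : ℂ) ^ 2) • congrArg
    (fun z : ℂ => z • (1 : Op (L + 2))) hI

theorem actsOn_gateU {φ : Kind → ℕ → ℝ} {x : Kind} {j : ℕ} (h : IsTerm L x j) :
    ActsOn (sites x j) (gateU (L + 2) φ x j) := by
  rw [gateU_eq h, ActsOn]
  have hs : ∀ P k, k ∈ sites x j → siteOp (L + 2) P k ∈
      Algebra.adjoin ℂ {O : Op (L + 2) | ∃ k ∈ sites x j, ∃ P, O = siteOp (L + 2) P k} :=
    fun P k hk => Algebra.subset_adjoin ⟨k, hk, P, rfl⟩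
  refine add_mem (Subalgebra.smul_mem _ (one_mem _) _) (Subalgebra.smul_mem _ ?_ _)
  rcases x with _ | _ | _
  · exact mul_mem (mul_mem (hs _ _ (by simp [sites])) (hs _ _ (by simp [sites])))
      (hs _ _ (by simp [sites]))
  · exact mul_mem (mul_mem (hs _ _ (by simp [sites])) (hs _ _ (by simp [sites])))
      (hs _ _ (by simp [sites]))
  · exact mul_mem (hs _ _ (by simp [sites])) (hs _ _ (by simp [sites]))

theorem stair_mem {M : Type} [Monoid M] (S : Submonoid M) {g : Kind → ℕ → M} {L : ℕ}
    (hg : ∀ x j, IsTerm L x j → g x j ∈ S) (m : ℕ) (hm : m ≤ L) :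
    stairG g m ∈ S ∧ stairGT g m ∈ S := by
  induction m with
  | zero => exact ⟨one_mem S, one_mem S⟩
  | succ m ih =>
    obtain ⟨h1, h2⟩ := ih (by omega)
    match m, h1, h2 with
    | 0, _, _ =>
      have := hg .C 1 ⟨le_rfl, hm, fun _ => rfl⟩
      exact ⟨this, this⟩
    | m + 1, h1, h2 =>
      have eA := hg .A (m + 2) ⟨by omega, hm, by omega⟩
      have eB := hg .B (m + 2) ⟨by omega, hm, by omega⟩
      have eC := hg .C (m + 2) ⟨by omega, hm, by omega⟩
      exact ⟨mul_mem h1 (mul_mem (mul_mem eB eA) eC), mul_mem (mul_mem (mul_mem eC eA) eB) h2⟩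

theorem circuit_mem_unitaryGroup (φ : Kind → ℕ → ℝ) :
    circuit L φ ∈ Matrix.unitaryGroup (Fin (L + 2) → Fin 2) ℂ := by
  obtain ⟨h1, h2⟩ := stair_mem (Matrix.unitaryGroup (Fin (L + 2) → Fin 2) ℂ)
    (g := gateU (L + 2) φ) (fun x j h => gateU_mem_unitaryGroup h) L le_rfl
  exact mul_mem h1 h2

theorem stair_smul {𝒜 : Type} [Ring 𝒜] [Algebra ℂ 𝒜] {g g' : Kind → ℕ → 𝒜} {r : Kind → ℕ → ℂ}
    (hg : ∀ x j, IsTerm L x j → g x j = r x j • g' x j) (m : ℕ) (hm : m + 1 ≤ L) :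
    stairG g (m + 1) = (r .C 1 * ∏ j ∈ Finset.Icc 2 (m + 1), (r .A j * r .B j * r .C j)) •
        stairG g' (m + 1) ∧
      stairGT g (m + 1) = (r .C 1 * ∏ j ∈ Finset.Icc 2 (m + 1), (r .A j * r .B j * r .C j)) •
        stairGT g' (m + 1) := by
  induction m with
  | zero => simp [stairG, stairGT, hg .C 1 ⟨le_rfl, hm, fun _ => rfl⟩]
  | succ m ih =>
    obtain ⟨h1, h2⟩ := ih (by omega)
    have eA := hg .A (m + 2) ⟨by omega, hm, by omega⟩
    have eB := hg .B (m + 2) ⟨by omega, hm, by omega⟩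
    have eC := hg .C (m + 2) ⟨by omega, hm, by omega⟩
    rw [stairG, stairGT, h1, h2, eA, eB, eC,
      Finset.prod_Icc_succ_top (show 2 ≤ m + 1 + 1 by omega)]
    simp only [smul_mul_assoc, mul_smul_comm, smul_smul, stairG, stairGT]
    exact ⟨by congr 1; ring, by congr 1; ring⟩

theorem couplingR_ofReal (a b : ℕ → ℝ) (x : Kind) (j : ℕ) :
    couplingR (fun j => (a j : ℂ)) (fun j => (b j : ℂ)) x j = (coupling a b x j : ℂ) := by
  rcases x <;> simp [couplingR, coupling]

theorem transferMatrix_eq_sT (a b : ℕ → ℝ) (v : ℂ) :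
    transferMatrix L a b v =
      sT (chainTerm L) (fun j => (a j : ℂ)) (fun j => (b j : ℂ)) v (L + 2) := by
  refine (fam_congr L (fun x j h => ?_) L le_rfl).1
  rw [term, couplingR_ofReal, chainTerm_of h]

theorem HyperbolicRecursion.transferMatrix_eq {a b : ℕ → ℝ} {y : ℝ} {θ : Kind → ℕ → ℝ}
    (h : HyperbolicRecursion L a b y θ) :
    transferMatrix L a b (Complex.I * y) =
      stairG (gateG (L + 2) (fun x j => Complex.I * θ x j)) L *
        stairGT (gateG (L + 2) (fun x j => Complex.I * θ x j)) L := by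
  set g' : Kind → ℕ → Op (L + 2) := fun x j =>
    Complex.cos (Complex.I * θ x j / 2) • (1 : Op (L + 2)) +
      Complex.sin (Complex.I * θ x j / 2) • chainTerm L x j with hg'
  have hg : ∀ x j, j ≤ L → IsGate (g' x j) (chainTerm L x j) (Complex.cos (Complex.I * θ x j))
      (Complex.sin (Complex.I * θ x j)) := fun x j hj => by
    refine isGate_cos_sin ?_
    by_cases hT : IsTerm L x j
    · exact Or.inl (chainTerm_mul_self hT)
    -- The positions up to L without a term are j = 0 and A_1, B_1, where the initial conditions
    -- make the angle vanish.
    · right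
      have : θ x j = 0 := by
        rcases Nat.eq_zero_or_pos j with rfl | h1
        · exact h.1.1 x
        · have hj1 : j = 1 := by
            by_contra hne
            exact hT ⟨h1, hj, fun h' => absurd h' hne⟩
          subst hj1
          rcases x with _ | _ | _
          exacts [h.1.2.1, h.1.2.2, absurd ⟨h1, hj, fun _ => rfl⟩ hT]
      simp [this]
  have h0 : ∀ x, g' x 0 = 1 := fun x => by simp [hg', h.1.1]
  obtain ⟨e1, e2⟩ := stair_eq_blockProd (g := gateG (L + 2) (fun x j => Complex.I * θ x j))
    (g' := g') (fun x j hT => by simp only [gateG, hg', chainTerm_of hT]) h0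
    (by simp [hg', h.1.2.1]) (by simp [hg', h.1.2.2]) L le_rfl
  rw [transferMatrix_eq_sT, e1, e2,
    (sT_eq_blockProd (chainTerm_rel L) hg h.factorAngles h0 (L + 1) le_rfl).1]

theorem HyperbolicRecursion.transferMatrix_eq_circuit {a b : ℕ → ℝ} {y : ℝ} {θ : Kind → ℕ → ℝ}
    (hL : 1 ≤ L) (h : HyperbolicRecursion L a b y θ) :
    transferMatrix L a b (Complex.I * y) =
      ((Real.cosh (θ .C 1) * ∏ j ∈ Finset.Icc 2 L,
        (Real.cosh (θ .A j) * Real.cosh (θ .B j) * Real.cosh (θ .C j)) : ℝ) : ℂ) •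
          circuit L (circuitAngle θ) := by
  have hpos : ∀ x j, 0 ≤ Real.cosh (θ x j) := fun x j => (Real.cosh_pos _).le
  obtain ⟨m, rfl⟩ := Nat.exists_eq_add_of_le' hL
  obtain ⟨e1, e2⟩ := stair_smul (L := m + 1)
    (g := gateG (m + 1 + 2) (fun x j => Complex.I * θ x j))
    (g' := gateU (m + 1 + 2) (circuitAngle θ))
    (r := fun x j => (Real.sqrt (Real.cosh (θ x j)) : ℂ)) (fun x j hT => by
      rw [gateU_circuitAngle hT, smul_smul, mul_one_div_cancel, one_smul]
      exact_mod_cast Real.sqrt_ne_zero'.2 (Real.cosh_pos _)) m le_rfl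
  rw [h.transferMatrix_eq, e1, e2, smul_mul_assoc, mul_smul_comm, smul_smul, circuit]
  congr 1
  rw [← sq, mul_pow, ← Finset.prod_pow]
  simp only [mul_pow, ← Complex.ofReal_pow, Real.sq_sqrt (hpos _ _)]
  push_cast
  rfl

end Gates

-- Couplings from angles.

section Converse

variable {L : ℕ} {y : ℝ} {φ : Kind → ℕ → ℝ}

/-- The couplings `a_j`, `b_j` recovered from the circuit angles. -/
noncomputable def couplingsOf (y : ℝ) (φ : Kind → ℕ → ℝ) : ℕ → ℝ × ℝ
  | 0 => (0, 0)
  -- The value a_1 = 1 is a normalization: multiplying a_j by λ and b_j by 1/λ for odd j, and the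
  -- reverse for even j, changes no product that occurs.
  | 1 => (1, -Real.tan (2 * φ .C 1) / y)
  | j + 2 =>
    (-Real.tan (2 * φ .A (j + 2)) / (y * (couplingsOf y φ (j + 1)).1 * Real.cos (2 * φ .C j) *
        Real.cos (2 * φ .A j) * Real.cos (2 * φ .A (j + 1)) * Real.cos (2 * φ .B (j + 1)) *
        Real.cos (2 * φ .C (j + 1))),
      -Real.tan (2 * φ .B (j + 2)) / (y * (couplingsOf y φ (j + 1)).2 * Real.cos (2 * φ .C j) *
        Real.cos (2 * φ .B j) * Real.cos (2 * φ .A (j + 1)) * Real.cos (2 * φ .B (j + 1)) *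
        Real.cos (2 * φ .C (j + 1))))

/-- A zero coupling below level L would block the next step. The constraint excludes it, since
nonzero tangents of two consecutive C angles force both sines to be nonzero. At level L a zero is
harmless, as nothing is divided by it. -/
theorem couplingsOf_ne_zero (hy : y ≠ 0) (hcos : ∀ x j, j ≤ L → Real.cos (2 * φ x j) ≠ 0)
    (htan : ∀ j, 1 ≤ j → j < L → Real.tan (2 * φ .C j) ≠ 0) (hcon : AngleConstraint L φ)
    (j : ℕ) (hj : j + 1 < L) :
    (couplingsOf y φ (j + 1)).1 ≠ 0 ∧ (couplingsOf y φ (j + 1)).2 ≠ 0 := by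
  induction j with
  | zero =>
    exact ⟨one_ne_zero, div_ne_zero (neg_ne_zero.2 (htan 1 le_rfl hj)) hy⟩
  | succ j ih =>
    obtain ⟨ha, hb⟩ := ih (by omega)
    have h1 : Real.sin (2 * φ .A (j + 2)) * Real.sin (2 * φ .B (j + 2)) ≠ 0 := by
      rw [← hcon (j + 2) (by omega) hj.le]
      exact mul_ne_zero (htan _ (by omega) (by omega)) (htan _ (by omega) hj)
    have tan_ne : ∀ x, Real.sin (2 * φ x (j + 2)) ≠ 0 → -Real.tan (2 * φ x (j + 2)) ≠ 0 :=
      fun x hx => by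
        rw [Real.tan_eq_sin_div_cos]
        exact neg_ne_zero.2 (div_ne_zero hx (hcos x _ hj.le))
    have c0 : ∀ x, Real.cos (2 * φ x j) ≠ 0 := fun x => hcos x _ (by omega)
    have c1 : ∀ x, Real.cos (2 * φ x (j + 1)) ≠ 0 := fun x => hcos x _ (by omega)
    constructor
    · refine div_ne_zero (tan_ne .A (left_ne_zero_of_mul h1)) ?_
      simp [hy, ha, c0, c1]
    · refine div_ne_zero (tan_ne .B (right_ne_zero_of_mul h1)) ?_
      simp [hy, hb, c0, c1]

theorem circuitRecursion_couplingsOf (hy : y ≠ 0) (h0 : InitialZero φ)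
    (hcos : ∀ x j, j ≤ L → Real.cos (2 * φ x j) ≠ 0)
    (htan : ∀ j, 1 ≤ j → j < L → Real.tan (2 * φ .C j) ≠ 0) (hcon : AngleConstraint L φ) :
    CircuitRecursion L (fun j => (couplingsOf y φ j).1) (fun j => (couplingsOf y φ j).2) y φ := by
  have hne := couplingsOf_ne_zero hy hcos htan hcon
  have hA : ∀ j, j + 1 < L → Real.tan (2 * φ .A (j + 2)) =
      -(y * (couplingsOf y φ (j + 1)).1 * (couplingsOf y φ (j + 2)).1 * Real.cos (2 * φ .C j) *
        Real.cos (2 * φ .A j) * Real.cos (2 * φ .A (j + 1)) * Real.cos (2 * φ .B (j + 1)) *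
        Real.cos (2 * φ .C (j + 1))) := fun j hj => by
    have c0 : ∀ x, Real.cos (2 * φ x j) ≠ 0 := fun x => hcos x _ (by omega)
    have c1 : ∀ x, Real.cos (2 * φ x (j + 1)) ≠ 0 := fun x => hcos x _ (by omega)
    have := (hne j hj).1
    have c0A := c0 .A
    have c0C := c0 .C
    have c1A := c1 .A
    have c1B := c1 .B
    have c1C := c1 .C
    rw [couplingsOf]
    field_simp
  have hB : ∀ j, j + 1 < L → Real.tan (2 * φ .B (j + 2)) =
      -(y * (couplingsOf y φ (j + 1)).2 * (couplingsOf y φ (j + 2)).2 * Real.cos (2 * φ .C j) *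
        Real.cos (2 * φ .B j) * Real.cos (2 * φ .A (j + 1)) * Real.cos (2 * φ .B (j + 1)) *
        Real.cos (2 * φ .C (j + 1))) := fun j hj => by
    have c0 : ∀ x, Real.cos (2 * φ x j) ≠ 0 := fun x => hcos x _ (by omega)
    have c1 : ∀ x, Real.cos (2 * φ x (j + 1)) ≠ 0 := fun x => hcos x _ (by omega)
    have := (hne j hj).2
    have c0B := c0 .B
    have c0C := c0 .C
    have c1A := c1 .A
    have c1B := c1 .B
    have c1C := c1 .C
    rw [couplingsOf]
    field_simp
  refine ⟨h0, fun j h1 h2 => ?_, fun j h1 h2 => ?_, fun j => ?_⟩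
  · obtain ⟨j, rfl⟩ := Nat.exists_eq_add_of_le' h1
    exact hA j h2
  · obtain ⟨j, rfl⟩ := Nat.exists_eq_add_of_le' h1
    exact hB j h2
  · induction j with
    | zero =>
      intro _
      simp only [couplingsOf, h0.1, h0.2.1, h0.2.2, zero_add, mul_zero, Real.cos_zero, one_pow,
        mul_one]
      field_simp
    | succ j ih =>
      intro hj
      have e := ih (by omega)
      have hc := hcon (j + 2) (by omega) hj
      have eA := hA j hj
      have eB := hB j hj
      have tan_mul : ∀ x, Real.sin (2 * φ x (j + 2)) =
          Real.tan (2 * φ x (j + 2)) * Real.cos (2 * φ x (j + 2)) :=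
        fun x => (Real.tan_mul_cos (hcos x _ hj)).symm
      -- Multiplied by the tangent of the previous C angle, the C recursion becomes the constraint
      -- with the A and B recursions inserted.
      refine mul_left_cancel₀ (htan (j + 1) (by omega) hj) ?_
      change Real.tan (2 * φ .C (j + 1)) * Real.tan (2 * φ .C (j + 2)) = _
      rw [show j + 2 - 1 = j + 1 from rfl] at hc
      rw [hc, tan_mul, tan_mul, eA, eB, e]
      ring

theorem circuitAngle_arsinh_tan {φ : Kind → ℕ → ℝ} {x : Kind} {j : ℕ}
    (h : |φ x j| < Real.pi / 4) :
    circuitAngle (fun x j => Real.arsinh (Real.tan (2 * φ x j))) x j = φ x j := by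
  rw [abs_lt] at h
  set θ : Kind → ℕ → ℝ := fun x j => Real.arsinh (Real.tan (2 * φ x j)) with hθ
  have h1 := tan_two_circuitAngle (θ := θ) (x := x) (j := j)
  have h2 := abs_lt.1 (abs_circuitAngle_lt (θ := θ) (x := x) (j := j))
  rw [hθ] at h1
  rw [Real.sinh_arsinh] at h1
  have := Real.injOn_tan ⟨by linarith [h2.1], by linarith [h2.2]⟩
    ⟨by linarith [h.1], by linarith [h.2]⟩ h1
  linarith

theorem CircuitRecursion.hyperbolicRecursion {a b : ℕ → ℝ} (hr : CircuitRecursion L a b y φ)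
    (h : ∀ x j, j ≤ L → |φ x j| < Real.pi / 4) :
    HyperbolicRecursion L a b y (fun x j => Real.arsinh (Real.tan (2 * φ x j))) := by
  have hcosh : ∀ x j, j ≤ L → Real.cosh (Real.arsinh (Real.tan (2 * φ x j))) =
      1 / Real.cos (2 * φ x j) := fun x j hj => by
    have e := cos_two_circuitAngle (θ := fun x j => Real.arsinh (Real.tan (2 * φ x j)))
      (x := x) (j := j)
    rw [circuitAngle_arsinh_tan (h x j hj)] at e
    rw [e, one_div_one_div]
  refine ⟨⟨fun x => ?_, ?_, ?_⟩, fun j h1 h2 => ?_, fun j h1 h2 => ?_, fun j h2 => ?_⟩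
  · simp [hr.1.1]
  · simp [hr.1.2.1]
  · simp [hr.1.2.2]
  · rw [Real.sinh_arsinh, hr.recA j h1 h2, hcosh _ _ (by omega), hcosh _ _ (by omega),
      hcosh _ _ (by omega), hcosh _ _ (by omega), hcosh _ _ (by omega)]
    field_simp
  · rw [Real.sinh_arsinh, hr.recB j h1 h2, hcosh _ _ (by omega), hcosh _ _ (by omega),
      hcosh _ _ (by omega), hcosh _ _ (by omega), hcosh _ _ (by omega)]
    field_simp
  · rw [Real.sinh_arsinh, hr.recC j h2, hcosh _ _ (by omega), hcosh _ _ (by omega),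
      hcosh _ _ (by omega), hcosh _ _ (by omega), hcosh _ _ (by omega)]
    field_simp

theorem exists_couplings_of_angleConstraint (hy : y ≠ 0) (h0 : InitialZero φ)
    (hcos : ∀ x j, j ≤ L → Real.cos (2 * φ x j) ≠ 0)
    (htan : ∀ j, 1 ≤ j → j < L → Real.tan (2 * φ .C j) ≠ 0) (hcon : AngleConstraint L φ) :
    ∃ a b : ℕ → ℝ, CircuitRecursion L a b y φ ∧
      ((∀ x j, j ≤ L → |φ x j| < Real.pi / 4) → ∃ θ : Kind → ℕ → ℝ,
        AngleRecursion L a b (Complex.I * y) (fun x j => Complex.I * θ x j) ∧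
        ∀ x j, j ≤ L → φ x j = circuitAngle θ x j) := by
  have hr := circuitRecursion_couplingsOf hy h0 hcos htan hcon
  exact ⟨_, _, hr, fun h => ⟨_, (angleRecursion_iff L _ _ y _).2 (hr.hyperbolicRecursion h),
    fun x j hj => (circuitAngle_arsinh_tan (h x j hj)).symm⟩⟩

end Converse

/-! ### Algebraic preliminaries for the spectrum -/

section JointEigenvector

variable {K V ι : Type} [Field K] [IsAlgClosed K] [AddCommGroup V] [Module K V]
  [FiniteDimensional K V]

/-- A commuting family of endomorphisms has a joint eigenvector in each eigenspace. -/
theorem exists_joint_eigenvector (f : ι → Module.End K V) (hf : ∀ i j, Commute (f i) (f j))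
    {i₀ : ι} {μ : K} (hμ : (f i₀).HasEigenvalue μ) :
    ∃ (x : V) (χ : ι → K), x ≠ 0 ∧ (∀ i, f i x = χ i • x) ∧ χ i₀ = μ := by
  let S : Set (Submodule K V) :=
    {W | W ≠ ⊥ ∧ W ≤ (f i₀).eigenspace μ ∧ ∀ i, ∀ x ∈ W, f i x ∈ W}
  have key : ∀ (i : ι) (ν : K) (W : Submodule K V), (∀ j, ∀ x ∈ W, f j x ∈ W) →
      ∀ j, ∀ x ∈ W ⊓ (f i).eigenspace ν, f j x ∈ W ⊓ (f i).eigenspace ν := by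
    intro i ν W hW j x hx
    refine ⟨hW j x hx.1, ?_⟩
    have h1 := Module.End.mem_eigenspace_iff.1 hx.2
    refine Module.End.mem_eigenspace_iff.2 ?_
    have h2 : f i (f j x) = f j (f i x) := congrArg (fun g : Module.End K V => g x) (hf i j).eq
    rw [h2, h1, map_smul]
  have hS : S.Nonempty := by
    refine ⟨⊤ ⊓ (f i₀).eigenspace μ, ?_, inf_le_right, key i₀ μ ⊤ fun _ _ _ => trivial⟩
    rw [top_inf_eq]
    exact hμ
  -- On a minimal nonzero invariant subspace of the eigenspace each f i is scalar, for an eigenspace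
  -- of f i inside it is again invariant.
  obtain ⟨W, ⟨hW0, hWμ, hWf⟩, hmin⟩ := WellFounded.has_min (wellFounded_lt) S hS
  have hex : ∀ i, ∃ ν : K, ∀ x ∈ W, f i x = ν • x := by
    intro i
    have : Nontrivial W := (Submodule.nontrivial_iff_ne_bot).2 hW0
    obtain ⟨ν, hν⟩ := Module.End.exists_eigenvalue ((f i).restrict (hWf i))
    obtain ⟨x, hx⟩ := hν.exists_hasEigenvector
    refine ⟨ν, fun z hz => ?_⟩
    have hx1 : f i x = ν • (x : V) := by
      have := congrArg Subtype.val hx.apply_eq_smul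
      simpa using this
    have hx0 : (x : V) ≠ 0 := fun h => hx.2 (Subtype.ext h)
    have hmem : W ⊓ (f i).eigenspace ν ∈ S := by
      refine ⟨fun h => hx0 ?_, inf_le_left.trans hWμ, key i ν W hWf⟩
      rw [← Submodule.mem_bot K, ← h]
      exact ⟨x.2, Module.End.mem_eigenspace_iff.2 hx1⟩
    have hle : W ≤ W ⊓ (f i).eigenspace ν := by
      by_contra hlt
      exact hmin _ hmem (lt_of_le_of_ne inf_le_left fun h => hlt h.ge)
    exact Module.End.mem_eigenspace_iff.1 (hle hz).2
  choose χ hχ using hex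
  obtain ⟨x, hxW, hx0⟩ := Submodule.exists_mem_ne_zero_of_ne_bot hW0
  refine ⟨x, χ, hx0, fun i => hχ i x hxW, ?_⟩
  have h1 := Module.End.mem_eigenspace_iff.1 (hWμ hxW)
  rw [hχ i₀ x hxW] at h1
  exact smul_left_injective K hx0 h1

end JointEigenvector

-- Factoring polynomials with constant term 1.

section Factorization

open Polynomial

variable {K : Type} [Field K]

/-- The polynomial `∏_k (1 - x_k X)`. -/
noncomputable def rootProd {N : ℕ} {R : Type} [CommRing R] (x : Fin N → R) : R[X] :=
  ∏ k, (1 - X * C (x k))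

/-- Vanishing entries absorb a drop in degree, so the number of factors can be fixed in advance. -/
theorem exists_rootProd [IsAlgClosed K] (N : ℕ) (p : K[X]) (h0 : p.coeff 0 = 1)
    (hd : p.natDegree ≤ N) : ∃ ε : Fin N → K, p = rootProd (fun k => ε k ^ 2) := by
  induction N generalizing p with
  | zero =>
    refine ⟨fun _ => 0, ?_⟩
    rw [eq_C_of_natDegree_eq_zero (Nat.le_zero.1 hd), h0]
    simp [rootProd]
  | succ N ih =>
    by_cases hp : p.natDegree = 0
    · refine ⟨fun _ => 0, ?_⟩
      rw [eq_C_of_natDegree_eq_zero hp, h0]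
      simp [rootProd]
    obtain ⟨r, hr⟩ := IsAlgClosed.exists_root p (fun h => hp (natDegree_eq_of_degree_eq_some h))
    have hr0 : r ≠ 0 := by
      rintro rfl
      rw [IsRoot, ← coeff_zero_eq_eval_zero, h0] at hr
      exact one_ne_zero hr
    obtain ⟨q, hq⟩ := dvd_iff_isRoot.2 hr
    obtain ⟨e, he⟩ := IsAlgClosed.exists_pow_nat_eq (r⁻¹) (n := 2) (by norm_num)
    have hpq : p = (1 - X * C (e ^ 2)) * (C (-r) * q) := by
      rw [hq, he]
      have : C r * C r⁻¹ = (1 : K[X]) := by rw [← C_mul, mul_inv_cancel₀ hr0, C_1]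
      rw [C_neg]
      linear_combination (-X * q) * this
    have hq0 : (C (-r) * q).coeff 0 = 1 := by
      rw [hpq, mul_coeff_zero] at h0
      simpa using h0
    have hqd : (C (-r) * q).natDegree ≤ N := by
      refine (natDegree_C_mul_le _ _).trans ?_
      have hq' : q ≠ 0 := by rintro rfl; simp at hq0
      rw [hq, natDegree_mul (X_sub_C_ne_zero r) hq', natDegree_X_sub_C] at hd
      omega
    obtain ⟨ε, hε⟩ := ih _ hq0 hqd
    refine ⟨Fin.cons e ε, ?_⟩
    rw [hpq, hε, rootProd, rootProd, Fin.prod_univ_succ]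
    simp

theorem rootProd_succ {N : ℕ} {R : Type} [CommRing R] (x : Fin (N + 1) → R) :
    rootProd x = (1 - X * C (x 0)) * rootProd (fun k => x k.succ) := by
  rw [rootProd, Fin.prod_univ_succ, rootProd]

theorem natDegree_rootProd {N : ℕ} {x : Fin N → K} (h : ∀ k, x k ≠ 0) :
    (rootProd x).natDegree = N := by
  rw [rootProd, natDegree_prod _ _ fun k _ hk => by simpa using congrArg (eval 0) hk]
  have : ∀ k, (1 - X * C (x k)).natDegree = 1 := fun k => by
    have e : 1 - X * C (x k) = C (-x k) * X + C 1 := by simp; ring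
    rw [e, natDegree_linear (neg_ne_zero.2 (h k))]
  rw [Finset.sum_congr rfl fun k _ => this k]
  simp

theorem exists_perm_of_rootProd_eq {N : ℕ} {x y : Fin N → K} (h : rootProd x = rootProd y) :
    ∃ σ : Equiv.Perm (Fin N), ∀ k, x k = y (σ k) := by
  induction N with
  | zero => exact ⟨1, fun k => k.elim0⟩
  | succ N ih =>
    obtain ⟨k, hk⟩ : ∃ k, y k = x 0 := by
      -- A zero entry is not visible as a root; that y also has one follows by comparing degrees.
      by_cases hx : x 0 = 0
      · by_contra! hne
        have hd : (rootProd y).natDegree = N + 1 := natDegree_rootProd fun k => hx ▸ hne k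
        have hd' : (rootProd x).natDegree ≤ N := by
          rw [rootProd_succ, hx]
          simp only [C_0, mul_zero, sub_zero, one_mul]
          refine (natDegree_prod_le _ _).trans ?_
          refine (Finset.sum_le_card_nsmul _ _ 1 fun k _ => ?_).trans (by simp)
          compute_degree
        rw [h, hd] at hd'
        omega
      · have h1 : eval (x 0)⁻¹ (rootProd y) = 0 := by
          rw [← h, rootProd_succ]
          simp [hx]
        rw [rootProd, eval_prod, Finset.prod_eq_zero_iff] at h1
        obtain ⟨k, -, hk⟩ := h1
        refine ⟨k, ?_⟩
        simp only [eval_sub, eval_one, eval_mul, eval_X, eval_C] at hk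
        field_simp at hk
        linear_combination -hk
    have hy : rootProd y = rootProd (fun i => y (Equiv.swap 0 k i)) :=
      (Equiv.prod_comp (Equiv.swap 0 k) fun i => (1 - X * C (y i))).symm
    rw [hy, rootProd_succ, rootProd_succ, Equiv.swap_apply_left, hk] at h
    have hne : (1 - X * C (x 0) : K[X]) ≠ 0 := fun h => by simpa using congrArg (eval 0) h
    obtain ⟨σ, hσ⟩ := ih (mul_left_cancel₀ hne h)
    refine ⟨(Equiv.Perm.decomposeFin.symm (0, σ)).trans (Equiv.swap 0 k), fun i => ?_⟩
    refine Fin.cases ?_ (fun i => ?_) i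
    · simp [hk]
    · simp [hσ]

/-- The polynomial `∏_k (1 + s_k ε_k X)`. -/
noncomputable def signPoly {N : ℕ} {R : Type} [CommRing R] (ε : Fin N → R) (s : Fin N → ℤˣ) :
    R[X] :=
  ∏ k, (1 + C (((s k : ℤ) : R) * ε k) * X)

/-- The point 1/ε_k is a root of q(w)q(-w), so 1/ε_k or -1/ε_k is a root of q. This fixes one sign,
and the factor can be divided out. -/
theorem exists_signPoly {N : ℕ} (ε : Fin N → K) (q : K[X]) (h0 : q.coeff 0 = 1)
    (hq : q * q.comp (-X) = (rootProd (fun k => ε k ^ 2)).comp (X ^ 2)) :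
    ∃ s, q = signPoly ε s := by
  induction N generalizing q with
  | zero =>
    have hu : IsUnit q := IsUnit.of_mul_eq_one _ (hq.trans (by simp [rootProd]))
    refine ⟨fun _ => 1, ?_⟩
    rw [eq_C_of_natDegree_eq_zero (natDegree_eq_zero_of_isUnit hu), h0]
    simp [signPoly]
  | succ N ih =>
    by_cases he : ε 0 = 0
    · obtain ⟨s, hs⟩ := ih (fun k => ε k.succ) q h0 (by rw [hq, rootProd_succ, he]; simp)
      refine ⟨Fin.cons 1 s, ?_⟩
      rw [hs, signPoly, signPoly, Fin.prod_univ_succ, he]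
      simp
    · have h1 : ∃ σ : ℤˣ, q.eval (-((σ : ℤ) : K) * (ε 0)⁻¹) = 0 := by
        have h2 := congrArg (eval (ε 0)⁻¹) hq
        rw [eval_mul, eval_comp, rootProd_succ, mul_comp, eval_mul] at h2
        have h3 : eval (ε 0)⁻¹ ((1 - X * C (ε 0 ^ 2)).comp (X ^ 2)) = 0 := by
          simp [he]
        rw [h3, zero_mul, mul_eq_zero] at h2
        rcases h2 with h2 | h2
        · exact ⟨-1, by simpa using h2⟩
        · exact ⟨1, by simpa using h2⟩
      obtain ⟨σ, hσ⟩ := h1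
      have hσ2 : ((σ : ℤ) : K) * ((σ : ℤ) : K) = 1 := by
        rw [← Int.cast_mul, ← Units.val_mul, Int.units_mul_self]
        simp
      obtain ⟨r, hr⟩ := dvd_iff_isRoot.2 hσ
      set c : K := ((σ : ℤ) : K) * ε 0 with hc
      have hc0 : c ≠ 0 := mul_ne_zero (left_ne_zero_of_mul_eq_one hσ2) he
      have hqr : q = (1 + C c * X) * (C c⁻¹ * r) := by
        rw [hr]
        have e1 : -((σ : ℤ) : K) * (ε 0)⁻¹ = -c⁻¹ := by
          rw [hc, mul_inv, neg_mul, inv_eq_of_mul_eq_one_left hσ2]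
        have e2 : C c * C c⁻¹ = (1 : K[X]) := by rw [← C_mul, mul_inv_cancel₀ hc0, C_1]
        rw [e1, C_neg]
        linear_combination (-X * r) * e2
      have hr0 : (C c⁻¹ * r).coeff 0 = 1 := by
        rw [hqr, mul_coeff_zero] at h0
        simpa using h0
      have hne : ((1 - X * C (ε 0 ^ 2)).comp (X ^ 2) : K[X]) ≠ 0 := fun h => by
        simpa using congrArg (eval 0) h
      obtain ⟨s, hs⟩ := ih (fun k => ε k.succ) (C c⁻¹ * r) hr0 (by
        refine mul_left_cancel₀ hne ?_
        rw [← mul_comp, ← rootProd_succ (fun k => ε k ^ 2), ← hq]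
        have e3 : C (ε 0 ^ 2) = C c ^ 2 := by
          rw [hc, ← C_pow, mul_pow, sq ((σ : ℤ) : K), hσ2, one_mul]
        simp only [mul_comp, sub_comp, add_comp, one_comp, X_comp, pow_comp, C_comp, e3, hqr]
        ring)
      refine ⟨Fin.cons σ s, ?_⟩
      rw [hqr, hs, signPoly, signPoly, Fin.prod_univ_succ]
      simp [hc]

/-- The constant coefficient 1 becomes the leading one when p is reversed, and a nonzero ε_k² is a
root of this monic polynomial. -/
theorem isIntegral_of_rootProd {R : Type} [CommRing R] [Algebra R K] {N : ℕ} {ε : Fin N → K}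
    {p : R[X]} (h0 : p.coeff 0 = 1) (hd : p.natDegree ≤ N)
    (hp : p.map (algebraMap R K) = rootProd (fun k => ε k ^ 2)) (k : Fin N) :
    IsIntegral R (ε k) := by
  by_cases he : ε k = 0
  · rw [he]; exact isIntegral_zero
  refine IsIntegral.of_pow (n := 2) (by norm_num) ?_
  set x : K := (ε k ^ 2)⁻¹ with hx
  have hx0 : x ≠ 0 := inv_ne_zero (pow_ne_zero 2 he)
  let := invertibleOfNonzero hx0
  have hinv : ⅟x = ε k ^ 2 := by rw [invOf_eq_inv, hx, inv_inv]
  refine ⟨p.reflect N, ?_, ?_⟩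
  · refine monic_of_natDegree_le_of_coeff_eq_one N ?_ ?_
    · exact (natDegree_reflect_le ..).trans (by simp [hd])
    · rw [coeff_reflect, revAt_le le_rfl, Nat.sub_self, h0]
  · rw [← hinv, eval₂_reflect_eq_zero_iff _ _ _ _ hd, ← eval_map, hp, rootProd, eval_prod]
    refine Finset.prod_eq_zero (Finset.mem_univ k) ?_
    simp [hx, he]

end Factorization

-- Specializing integral elements at a point.

section Specialization

open Polynomial

theorem exists_algHom_of_isIntegral {K A : Type} [Field K] [IsAlgClosed K] [CommRing A]
    [Nontrivial A] [Algebra K A] [Algebra.IsIntegral K A] : Nonempty (A →ₐ[K] K) := by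
  obtain ⟨m, hm⟩ := Ideal.exists_maximal A
  let := Ideal.Quotient.field m
  have hb : Function.Bijective (algebraMap K (A ⧸ m)) :=
    IsAlgClosed.algebraMap_bijective_of_isIntegral
  exact ⟨((AlgEquiv.ofBijective (Algebra.ofId K (A ⧸ m)) hb).symm : (A ⧸ m) →ₐ[K] K).comp
    (Ideal.Quotient.mkₐ K m)⟩

/-- Evaluation at a point extends to the integral closure of `ℂ[X]`. -/
theorem exists_algHom_integralClosure (K : Type) [Field K] [Algebra ℂ K] [Algebra ℂ[X] K]
    [IsScalarTower ℂ ℂ[X] K] [FaithfulSMul ℂ[X] K] (τ : ℂ) :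
    ∃ ψ : integralClosure ℂ[X] K →ₐ[ℂ] ℂ,
      ∀ p, ψ (algebraMap ℂ[X] (integralClosure ℂ[X] K) p) = p.eval τ := by
  set A := integralClosure ℂ[X] K
  have hker : RingHom.ker (algebraMap ℂ[X] A) ≤ RingHom.ker (evalRingHom τ) := by
    rw [(RingHom.injective_iff_ker_eq_bot _).1 (FaithfulSMul.algebraMap_injective ℂ[X] A)]
    exact bot_le
  have hmax : (RingHom.ker (evalRingHom τ)).IsMaximal :=
    RingHom.ker_isMaximal_of_surjective _ fun z => ⟨C z, eval_C⟩
  -- Lying over provides a maximal ideal above the point τ. Its residue field is integral over ℂ and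
  -- thus maps to ℂ.
  obtain ⟨m, hm, hcomap⟩ := Ideal.exists_ideal_over_maximal_of_isIntegral
    (S := A) (RingHom.ker (evalRingHom τ)) hker
  have hmk : ∀ p : ℂ[X], Ideal.Quotient.mk m (algebraMap ℂ[X] A p) =
      algebraMap ℂ (A ⧸ m) (p.eval τ) := fun p => by
    have e : algebraMap ℂ (A ⧸ m) (p.eval τ) =
        Ideal.Quotient.mk m (algebraMap ℂ[X] A (C (p.eval τ))) := by
      rw [IsScalarTower.algebraMap_apply ℂ A (A ⧸ m), IsScalarTower.algebraMap_apply ℂ ℂ[X] A]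
      rfl
    rw [e, Ideal.Quotient.eq, ← map_sub, ← Ideal.mem_comap, hcomap, RingHom.mem_ker]
    simp
  have hint : Algebra.IsIntegral ℂ (A ⧸ m) := by
    refine ⟨fun x => ?_⟩
    obtain ⟨x, rfl⟩ := Ideal.Quotient.mk_surjective x
    obtain ⟨p, hp, hx⟩ := Algebra.IsIntegral.isIntegral (R := ℂ[X]) x
    refine ⟨p.map (evalRingHom τ), hp.map _, ?_⟩
    have hcomp : (algebraMap ℂ (A ⧸ m)).comp (evalRingHom τ) =
        (Ideal.Quotient.mk m).comp (algebraMap ℂ[X] A) := RingHom.ext fun p => (hmk p).symm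
    rw [eval₂_map, hcomp, ← hom_eval₂, hx, map_zero]
  obtain ⟨χ⟩ := exists_algHom_of_isIntegral (K := ℂ) (A := A ⧸ m)
  refine ⟨χ.comp (Ideal.Quotient.mkₐ ℂ m), fun p => ?_⟩
  rw [AlgHom.comp_apply, Ideal.Quotient.mkₐ_eq_mk, hmk, AlgHom.commutes]
  rfl

end Specialization

/-! ### The polynomial `P_L` -/

section Polynomials

open Polynomial

variable {R : Type} [CommRing R]

theorem fam_natDegree_le (κ : Kind → ℕ → R) (m : ℕ) :
    (fam (fun x j => X * C (κ x j)) m).natDegree ≤ (m + 1) / 2 ∧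
    (famA (fun x j => X * C (κ x j)) m).natDegree ≤ m / 2 ∧
    (famB (fun x j => X * C (κ x j)) m).natDegree ≤ m / 2 := by
  have hmul : ∀ (z : R) (p : R[X]) (d : ℕ), p.natDegree ≤ d → (X * C z * p).natDegree ≤ d + 1 :=
    fun z p d hp => by
      refine natDegree_mul_le.trans ?_
      have : (X * C z : R[X]).natDegree ≤ 1 := by compute_degree
      omega
  induction m using Nat.strong_induction_on with
  | _ m ih =>
    match m, ih with
    | 0, _ => simp [fam, famA, famB]
    | 1, _ =>
      simp only [fam, famA, famB, natDegree_one, Nat.zero_le, and_self, and_true]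
      compute_degree
    | m + 2, ih =>
      obtain ⟨h1, -, -⟩ := ih (m + 1) (by omega)
      obtain ⟨h2, h3, h4⟩ := ih m (by omega)
      have hA : (famA (fun x j => X * C (κ x j)) (m + 2)).natDegree ≤ (m + 2) / 2 := by
        rw [famA]
        have := hmul (κ .A (m + 2)) _ _ h4
        exact (natDegree_sub_le_of_le h1 this).trans (by omega)
      have hB : (famB (fun x j => X * C (κ x j)) (m + 2)).natDegree ≤ (m + 2) / 2 := by
        rw [famB]
        have := hmul (κ .B (m + 2)) _ _ h3
        exact (natDegree_sub_le_of_le h1 this).trans (by omega)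
      refine ⟨?_, hA, hB⟩
      rw [fam]
      have := hmul (κ .C (m + 2)) _ _ h2
      exact (natDegree_sub_le_of_le (natDegree_sub_le_of_le
        (natDegree_add_le_of_le hA hB) h1) this).trans (by omega)

theorem fam_zero_coupling {𝒜 : Type} [Ring 𝒜] (m : ℕ) :
    fam (fun _ _ => (0 : 𝒜)) m = 1 ∧ famA (fun _ _ => (0 : 𝒜)) m = 1 ∧
      famB (fun _ _ => (0 : 𝒜)) m = 1 := by
  induction m using Nat.strong_induction_on with
  | _ m ih =>
    match m, ih with
    | 0, _ => simp [fam, famA, famB]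
    | 1, _ => simp [fam, famA, famB]
    | m + 2, ih =>
      simp [fam, famA, famB, (ih (m + 1) (by omega)).1]

theorem fam_coeff_zero (κ : Kind → ℕ → R) (m : ℕ) :
    (fam (fun x j => X * C (κ x j)) m).coeff 0 = 1 := by
  have := (map_fam (evalRingHom (0 : R)) (fun x j => X * C (κ x j)) m).1
  rw [coeff_zero_eq_eval_zero, ← coe_evalRingHom, this]
  simpa using (fam_zero_coupling m).1

/-- After X ↦ -X the recursion has only plus signs and nothing can cancel. The C term alone raises
the degree by one every two levels, so only its coupling has to be positive. -/
theorem fam_coeff_pos {κ : Kind → ℕ → ℝ} (hκ : ∀ x j, 0 ≤ κ x j) {L : ℕ}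
    (hC : ∀ j, 1 ≤ j → j ≤ L → 0 < κ .C j) (m : ℕ) (hm : m ≤ L) :
    (∀ i, 0 ≤ (fam (fun x j => -(X * C (κ x j))) m).coeff i) ∧
    (∀ i, 0 ≤ (famA (fun x j => -(X * C (κ x j))) m).coeff i) ∧
    (∀ i, 0 ≤ (famB (fun x j => -(X * C (κ x j))) m).coeff i) ∧
    0 < (fam (fun x j => -(X * C (κ x j))) m).coeff ((m + 1) / 2) := by
  have hmul : ∀ (z : ℝ) (p : ℝ[X]), 0 ≤ z → (∀ i, 0 ≤ p.coeff i) →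
      ∀ i, 0 ≤ (X * C z * p).coeff i := fun z p hz hp i => by
    rw [mul_assoc]
    match i with
    | 0 => simp
    | i + 1 =>
      rw [coeff_X_mul, coeff_C_mul]
      exact mul_nonneg hz (hp i)
  have hone : ∀ i, 0 ≤ (1 : ℝ[X]).coeff i := fun i => by
    rw [coeff_one]; split_ifs <;> norm_num
  induction m using Nat.strong_induction_on with
  | _ m ih =>
    match m, ih, hm with
    | 0, _, _ => simpa [fam, famA, famB] using hone
    | 1, _, hm =>
      have h1 := hC 1 le_rfl hm
      have e : fam (fun x j => -(X * C (κ x j))) 1 = 1 + X * C (κ .C 1) * 1 := by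
        simp only [fam, famA, famB]; ring
      refine ⟨fun i => ?_, by simpa [famA] using hone, by simpa [famB] using hone, ?_⟩
      · rw [e, coeff_add]
        exact add_nonneg (hone i) (hmul _ _ h1.le hone i)
      · rw [e]
        simpa [coeff_one] using h1
    | m + 2, ih, hm =>
      obtain ⟨h1, -, -, p1⟩ := ih (m + 1) (by omega) (by omega)
      obtain ⟨h2, h3, h4, p2⟩ := ih m (by omega) (by omega)
      have eA : famA (fun x j => -(X * C (κ x j))) (m + 2) =
          fam (fun x j => -(X * C (κ x j))) (m + 1) + X * C (κ .A (m + 2)) *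
            famB (fun x j => -(X * C (κ x j))) m := by
        rw [famA]; ring
      have eB : famB (fun x j => -(X * C (κ x j))) (m + 2) =
          fam (fun x j => -(X * C (κ x j))) (m + 1) + X * C (κ .B (m + 2)) *
            famA (fun x j => -(X * C (κ x j))) m := by
        rw [famB]; ring
      have e : fam (fun x j => -(X * C (κ x j))) (m + 2) =
          fam (fun x j => -(X * C (κ x j))) (m + 1) + X * C (κ .A (m + 2)) *
            famB (fun x j => -(X * C (κ x j))) m + X * C (κ .B (m + 2)) *
            famA (fun x j => -(X * C (κ x j))) m + X * C (κ .C (m + 2)) *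
            fam (fun x j => -(X * C (κ x j))) m := by
        rw [fam, eA, eB]; ring
      have q4 := hmul _ _ (hκ .A (m + 2)) h4
      have q3 := hmul _ _ (hκ .B (m + 2)) h3
      have q2 := hmul _ _ (hκ .C (m + 2)) h2
      refine ⟨fun i => ?_, fun i => ?_, fun i => ?_, ?_⟩
      · simp only [e, coeff_add]
        exact add_nonneg (add_nonneg (add_nonneg (h1 i) (q4 i)) (q3 i)) (q2 i)
      · rw [eA, coeff_add]
        exact add_nonneg (h1 i) (q4 i)
      · rw [eB, coeff_add]
        exact add_nonneg (h1 i) (q3 i)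
      · have hi : (m + 2 + 1) / 2 = (m + 1) / 2 + 1 := by omega
        have pos : 0 < (X * C (κ .C (m + 2)) * fam (fun x j => -(X * C (κ x j))) m).coeff
            ((m + 1) / 2 + 1) := by
          rw [mul_assoc, coeff_X_mul, coeff_C_mul]
          exact mul_pos (hC _ (by omega) hm) p2
        rw [hi, e, coeff_add, coeff_add, coeff_add]
        have := h1 ((m + 1) / 2 + 1)
        have := q4 ((m + 1) / 2 + 1)
        have := q3 ((m + 1) / 2 + 1)
        linarith

theorem polyP_natDegree_le (L : ℕ) (a b : ℕ → ℝ) : (polyP L a b).natDegree ≤ (L + 1) / 2 :=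
  (fam_natDegree_le _ L).1

theorem polyP_natDegree_eq {L : ℕ} {a b : ℕ → ℝ} (h : ∀ j, 1 ≤ j → j ≤ L → a j ≠ 0 ∧ b j ≠ 0) :
    (polyP L a b).natDegree = (L + 1) / 2 := by
  refine le_antisymm (polyP_natDegree_le L a b) ?_
  have hpos := (fam_coeff_pos (κ := fun x j => coupling a b x j ^ 2) (fun x j => sq_nonneg _)
    (fun j h1 h2 => sq_pos_of_ne_zero (mul_ne_zero (h j h1 h2).1 (h j h1 h2).2)) L le_rfl).2.2.2
  have e := (map_fam (compRingHom (-X : ℝ[X]))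
    (fun x j => X * C (coupling a b x j ^ 2)) L).1
  simp only [coe_compRingHom, mul_comp, X_comp, C_comp, neg_mul] at e
  rw [← e] at hpos
  have h1 := le_natDegree_of_ne_zero hpos.ne'
  rw [natDegree_comp] at h1
  simpa [polyP] using h1

/-- The polynomial `P_L` for couplings in a commutative ring. -/
noncomputable def polyR (L : ℕ) (a b : ℕ → R) : R[X] :=
  fam (fun x j => X * C (couplingR a b x j ^ 2)) L

theorem polyR_natDegree_le (L : ℕ) (a b : ℕ → R) : (polyR L a b).natDegree ≤ (L + 1) / 2 :=
  (fam_natDegree_le _ L).1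

theorem polyR_coeff_zero (L : ℕ) (a b : ℕ → R) : (polyR L a b).coeff 0 = 1 :=
  fam_coeff_zero _ L

theorem map_couplingR {S : Type} [CommRing S] (f : R →+* S) (a b : ℕ → R) (x : Kind) (j : ℕ) :
    f (couplingR a b x j) = couplingR (fun j => f (a j)) (fun j => f (b j)) x j := by
  rcases x <;> simp [couplingR]

theorem polyR_map {S : Type} [CommRing S] (f : R →+* S) (L : ℕ) (a b : ℕ → R) :
    (polyR L a b).map f = polyR L (fun j => f (a j)) (fun j => f (b j)) := by
  have := (map_fam (mapRingHom f) (fun x j => X * C (couplingR a b x j ^ 2)) L).1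
  simp only [coe_mapRingHom, Polynomial.map_mul, map_X, Polynomial.map_C] at this
  rw [polyR, this, polyR]
  congr 1
  funext x j
  rw [map_pow f, map_couplingR]

theorem polyP_map (L : ℕ) (a b : ℕ → ℝ) :
    (polyP L a b).map (algebraMap ℝ ℂ) = polyR L (fun j => (a j : ℂ)) (fun j => (b j : ℂ)) := by
  have e : polyP L a b = polyR L a b := by
    unfold polyP polyR
    congr 1
  rw [e, polyR_map]
  rfl

/-- With couplings on every other site only, the recursion decouples. -/
theorem fam_decoupled {c : Kind → ℕ → R} (hA : ∀ j, c .A j = 0) (hB : ∀ j, c .B j = 0)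
    (hC : ∀ j, c .C (2 * j) = 0) (m : ℕ) :
    fam c m = ∏ k : Fin ((m + 1) / 2), (1 - c .C (2 * (k : ℕ) + 1)) := by
  have hfA : ∀ m, famA c (m + 1) = fam c m := fun m => by
    match m with
    | 0 => simp [famA, fam]
    | m + 1 => simp [famA, hA]
  have hfB : ∀ m, famB c (m + 1) = fam c m := fun m => by
    match m with
    | 0 => simp [famB, fam]
    | m + 1 => simp [famB, hB]
  have hrec : ∀ m, fam c (m + 2) = fam c (m + 1) - c .C (m + 2) * fam c m := fun m => by
    rw [fam, hfA, hfB]; ring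
  have h1 : fam c 1 = 1 - c .C 1 := by
    simp only [fam, famA, famB]; ring
  have key : ∀ n, fam c (2 * n) = ∏ k ∈ Finset.range n, (1 - c .C (2 * k + 1)) ∧
      fam c (2 * n + 1) = ∏ k ∈ Finset.range (n + 1), (1 - c .C (2 * k + 1)) := by
    intro n
    induction n with
    | zero => simp [fam, h1]
    | succ n ih =>
      have e1 : fam c (2 * (n + 1)) = fam c (2 * n + 1) := by
        have := hC (n + 1)
        rw [show 2 * (n + 1) = 2 * n + 2 by ring] at this ⊢
        rw [hrec, this]; ring
      refine ⟨by rw [e1, ih.2], ?_⟩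
      rw [Finset.prod_range_succ, ← ih.2, show 2 * (n + 1) + 1 = (2 * n + 1) + 2 by ring, hrec,
        show 2 * n + 1 + 1 = 2 * (n + 1) by ring, e1]
      ring
  rw [Fin.prod_univ_eq_prod_range (fun k => 1 - c .C (2 * k + 1))]
  obtain ⟨n, rfl | rfl⟩ := Nat.even_or_odd' m
  · rw [(key n).1, show (2 * n + 1) / 2 = n by omega]
  · rw [(key n).2, show (2 * n + 1 + 1) / 2 = n + 1 by omega]

end Polynomials

/-! ### The decoupled point -/

section Decoupled

open Polynomial

/-- The eigenvalue of `Z` at a basis vector. -/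
def zEigenvalue (x : Fin 2) : ℂ := if x = 0 then 1 else -1

theorem pauliZ_apply (x y : Fin 2) : pauliZ x y = if x = y then zEigenvalue x else 0 := by
  fin_cases x <;> fin_cases y <;> simp [pauliZ, zEigenvalue]

theorem siteOp_pauliZ {N k : ℕ} (hk : k < N) :
    siteOp N pauliZ k = Matrix.diagonal fun s => zEigenvalue (s ⟨k, hk⟩) := by
  ext s s'
  rw [siteOp, Matrix.of_apply, Matrix.diagonal_apply]
  split_ifs with h
  · subst h
    rw [Finset.prod_eq_single ⟨k, hk⟩]
    · simp [pauliZ_apply]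
    · intro i _ hi
      rw [if_neg fun h => hi (Fin.ext h), Matrix.one_apply_eq]
    · exact fun h => absurd (Finset.mem_univ _) h
  · obtain ⟨i, hi⟩ := Function.ne_iff.1 h
    refine Finset.prod_eq_zero (Finset.mem_univ i) ?_
    split_ifs
    · rw [pauliZ_apply, if_neg hi]
    · rw [Matrix.one_apply_ne hi]

theorem zEigenvalue_mul (x y : Fin 2) : zEigenvalue x * zEigenvalue y = zEigenvalue (x + y) := by
  fin_cases x <;> fin_cases y <;> simp [zEigenvalue]

/-- The parities of neighbouring sites of even label. -/
def parityHom (L : ℕ) : (Fin (L + 2) → Fin 2) →+ (Fin ((L + 1) / 2) → Fin 2) where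
  toFun s k := s ⟨2 * k, by omega⟩ + s ⟨2 * k + 2, by omega⟩
  map_zero' := rfl
  map_add' s s' := by
    funext k
    simp only [Pi.add_apply]
    abel

theorem parityHom_surjective (L : ℕ) : Function.Surjective (parityHom L) := by
  intro x
  -- A preimage by partial sums: modulo 2, neighbouring even sites differ by the prescribed parity.
  refine ⟨fun i => ∑ l ∈ Finset.range (i / 2), if h : l < (L + 1) / 2 then x ⟨l, h⟩ else 0, ?_⟩
  funext k
  change (∑ l ∈ Finset.range (2 * (k : ℕ) / 2), if h : l < (L + 1) / 2 then x ⟨l, h⟩ else 0) +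
    (∑ l ∈ Finset.range ((2 * (k : ℕ) + 2) / 2), if h : l < (L + 1) / 2 then x ⟨l, h⟩ else 0) = _
  rw [show (2 * (k : ℕ) + 2) / 2 = 2 * (k : ℕ) / 2 + 1 by omega, Finset.sum_range_succ, ← add_assoc,
    show 2 * (k : ℕ) / 2 = k by omega, dif_pos k.2]
  have h2 : ∀ z : Fin 2, z + z = 0 := by decide
  rw [h2, zero_add]

theorem prod_parityHom {M : Type} [CommMonoid M] (L : ℕ) (F : (Fin ((L + 1) / 2) → Fin 2) → M) :
    ∃ d : ℕ, ∏ s, F (parityHom L s) = ∏ x, F x ^ d := by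
  refine ⟨Fintype.card {s // parityHom L s = 0}, ?_⟩
  rw [Finset.prod_comp F (parityHom L), Finset.image_univ_of_surjective (parityHom_surjective L)]
  refine Finset.prod_congr rfl fun x _ => ?_
  rw [AddMonoidHom.card_fiber_eq_of_mem_range (parityHom L) (parityHom_surjective L x)
    (parityHom_surjective L 0), Fintype.card_subtype]

/-- The sign `-z` for an eigenvalue `z` of `Z`. -/
def negSign (x : Fin 2) : ℤˣ := if x = 0 then -1 else 1

theorem negSign_cast (x : Fin 2) : ((negSign x : ℤ) : ℂ) = -zEigenvalue x := by
  fin_cases x <;> simp [negSign, zEigenvalue]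

/-- With a_j and b_j supported on odd j only the terms C_{2k+1} = Z_{2k}Z_{2k+2} survive. T is then
diagonal, a product of factors 1 - e_k v Z_{2k}Z_{2k+2}, and all sign patterns are equally frequent
because the fibres of the parity map have the same size. -/
theorem exists_charpoly_decoupled (L : ℕ) (e : Fin ((L + 1) / 2) → ℂ) (v : ℂ) :
    ∃ a b : ℕ → ℂ, polyR L a b = rootProd (fun k => e k ^ 2) ∧ ∃ d : ℕ,
      (sT (chainTerm L) a b v (L + 2)).charpoly =
        ∏ s, (X - C ((signPoly e s).eval v)) ^ d := by
  classical
  let e' : ℕ → ℂ := fun k => if h : k < (L + 1) / 2 then e ⟨k, h⟩ else 0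
  let a : ℕ → ℂ := fun j => if Odd j then e' (j / 2) else 0
  let b : ℕ → ℂ := fun j => if Odd j then 1 else 0
  have ha0 : ∀ j, a (j - 1) * a j = 0 := fun j => by
    rcases Nat.even_or_odd j with h | h
    · have : ¬ Odd j := Nat.not_odd_iff_even.2 h
      simp [a, this]
    · have : ¬ Odd (j - 1) := Nat.not_odd_iff_even.2 (Nat.Odd.sub_odd h odd_one)
      simp [a, this]
  have hb0 : ∀ j, b (j - 1) * b j = 0 := fun j => by
    rcases Nat.even_or_odd j with h | h
    · have : ¬ Odd j := Nat.not_odd_iff_even.2 h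
      simp [b, this]
    · have : ¬ Odd (j - 1) := Nat.not_odd_iff_even.2 (Nat.Odd.sub_odd h odd_one)
      simp [b, this]
  have hab0 : ∀ j, a (2 * j) * b (2 * j) = 0 := fun j => by
    have : ¬ Odd (2 * j) := Nat.not_odd_iff_even.2 (even_two_mul j)
    simp [b, this]
  have hab1 : ∀ k : Fin ((L + 1) / 2), a (2 * (k : ℕ) + 1) * b (2 * (k : ℕ) + 1) = e k := fun k => by
    have h1 : Odd (2 * (k : ℕ) + 1) := odd_two_mul_add_one _
    have h2 : (2 * (k : ℕ) + 1) / 2 = k := by omega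
    simp only [a, b, h1, if_true, h2, mul_one, e', dif_pos k.2]
  refine ⟨a, b, ?_, ?_⟩
  · rw [polyR, fam_decoupled (fun j => by simp [couplingR, ha0]) (fun j => by simp [couplingR, hb0])
      (fun j => by simp [couplingR, hab0]), rootProd]
    simp only [couplingR, hab1]
  let δ : Kind → ℕ → (Fin (L + 2) → Fin 2) → ℂ := fun x j s =>
    match x with
    | .C => v * (a j * b j) * ((if h : j - 1 < L + 2 then zEigenvalue (s ⟨j - 1, h⟩) else 1) *
        (if h : j + 1 < L + 2 then zEigenvalue (s ⟨j + 1, h⟩) else 1))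
    | _ => 0
  have hfam : sT (chainTerm L) a b v (L + 2) = Matrix.diagonal (fam δ L) := by
    have h1 : sT (chainTerm L) a b v (L + 2) =
        fam (fun x j => Matrix.diagonalRingHom _ ℂ (δ x j)) L := by
      refine (fam_congr L (fun x j hT => ?_) L le_rfl).1
      rw [term, chainTerm_of hT]
      rcases x with _ | _ | _
      · simp [couplingR, ha0, δ]
      · simp [couplingR, hb0, δ]
      · have hj := hT.2.1
        rw [t, siteOp_pauliZ (show j - 1 < L + 2 by omega), siteOp_pauliZ (show j + 1 < L + 2 by omega),
          Matrix.diagonal_mul_diagonal, ← Matrix.diagonal_smul]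
        simp only [Matrix.diagonalRingHom_apply, δ, couplingR, dif_pos (show j - 1 < L + 2 by omega),
          dif_pos (show j + 1 < L + 2 by omega)]
        rfl
    rw [h1, ← (map_fam (Matrix.diagonalRingHom _ ℂ) δ L).1]
    rfl
  have hval : ∀ s, fam δ L s = (signPoly e (fun k => negSign (parityHom L s k))).eval v := fun s => by
    rw [fam_decoupled (fun j => rfl) (fun j => rfl)
      (fun j => by funext s; simp [δ, hab0]), Finset.prod_apply, signPoly, eval_prod]
    refine Finset.prod_congr rfl fun k _ => ?_
    have h1 : 2 * (k : ℕ) + 1 - 1 < L + 2 := by omega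
    have h2 : 2 * (k : ℕ) + 1 + 1 < L + 2 := by omega
    simp only [Pi.sub_apply, Pi.one_apply, δ, dif_pos h1, dif_pos h2, hab1, eval_add, eval_one,
      eval_mul, eval_C, eval_X, negSign_cast]
    change _ = 1 + -zEigenvalue (s ⟨2 * k, _⟩ + s ⟨2 * k + 2, _⟩) * e k * v
    rw [← zEigenvalue_mul]
    simp only [Nat.add_sub_cancel]
    ring
  obtain ⟨d, hd⟩ := prod_parityHom L
    (fun x => (X - C ((signPoly e (fun k => negSign (x k))).eval v) : ℂ[X]))
  refine ⟨d, ?_⟩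
  rw [hfam, Matrix.charpoly_diagonal]
  simp only [hval]
  rw [hd]
  exact Equiv.prod_comp (Equiv.piCongrRight fun _ : Fin ((L + 1) / 2) =>
      Equiv.ofBijective negSign (by decide))
    (fun s => (X - C ((signPoly e s).eval v)) ^ d)

theorem exists_signPoly_eval_injective (N : ℕ) {v : ℂ} (hv : v ≠ 0) :
    ∃ e : Fin N → ℂ, Function.Injective fun s => (signPoly e s).eval v := by
  -- The e_k are chosen such that (1 + e_k v)/(1 - e_k v) = 2^(2^k). Up to a common factor, a choice
  -- of signs then gives 2^m with m having the positive signs as binary digits, so the values are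
  -- distinct.
  let r : ℕ → ℂ := fun k => 2 ^ 2 ^ k
  have hr : ∀ k, r k + 1 ≠ 0 := fun k => by
    have : ((2 ^ 2 ^ k + 1 : ℕ) : ℂ) ≠ 0 := Nat.cast_ne_zero.2 (by positivity)
    simpa [r] using this
  refine ⟨fun k => (r k - 1) / ((r k + 1) * v), ?_⟩
  have key : ∀ s : Fin N → ℤˣ,
      (signPoly (fun k : Fin N => (r k - 1) / ((r k + 1) * v)) s).eval v =
        (∏ k : Fin N, 2 / (r k + 1)) *
          ((2 ^ ∑ i ∈ (Finset.univ.filter fun k => s k = 1).map Fin.valEmbedding, 2 ^ i : ℕ) : ℂ) := by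
    intro s
    rw [Finset.sum_map, Finset.sum_filter, ← Finset.prod_pow_eq_pow_sum, Nat.cast_prod,
      ← Finset.prod_mul_distrib, signPoly, eval_prod]
    refine Finset.prod_congr rfl fun k _ => ?_
    have := hr k
    rcases Int.units_eq_one_or (s k) with h | h
    · simp only [h, if_true, Fin.valEmbedding_apply, Nat.cast_pow, Nat.cast_ofNat, Units.val_one,
        Int.cast_one, one_mul, eval_add, eval_one, eval_mul, eval_C, eval_X]
      change 1 + _ = 2 / (r k + 1) * r k
      field_simp
      ring
    · have h1 : (-1 : ℤˣ) ≠ 1 := by decide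
      simp only [h, if_neg h1, pow_zero, Nat.cast_one, Units.val_neg, Units.val_one, Int.cast_neg,
        Int.cast_one, eval_add, eval_one, eval_mul, eval_C, eval_X]
      field_simp
      ring
  intro s s' h
  simp only [key] at h
  have hne : (∏ k : Fin N, 2 / (r k + 1)) ≠ 0 :=
    Finset.prod_ne_zero_iff.2 fun k _ => div_ne_zero two_ne_zero (hr k)
  have h1 := Nat.pow_right_injective le_rfl (Nat.cast_injective (mul_left_cancel₀ hne h))
  have h2 := Finset.map_injective _ (Finset.geomSum_injective le_rfl h1)
  funext k
  have h3 : s k = 1 ↔ s' k = 1 := by simpa using Finset.ext_iff.1 h2 k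
  rcases Int.units_eq_one_or (s k) with e1 | e1 <;> rcases Int.units_eq_one_or (s' k) with e2 | e2
  · rw [e1, e2]
  · rw [h3.1 e1, e1]
  · rw [e2, h3.2 e2]
  · rw [e1, e2]

end Decoupled

/-! ### The spectrum of the transfer matrix -/

section Spectrum

open Polynomial

theorem signPoly_map {R S : Type} [CommRing R] [CommRing S] (f : R →+* S) {N : ℕ} (ε : Fin N → R)
    (s : Fin N → ℤˣ) : (signPoly ε s).map f = signPoly (fun k => f (ε k)) s := by
  simp [signPoly, Polynomial.map_prod]

theorem rootProd_map {R S : Type} [CommRing R] [CommRing S] (f : R →+* S) {N : ℕ} (x : Fin N → R) :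
    (rootProd x).map f = rootProd (fun k => f (x k)) := by
  simp [rootProd, Polynomial.map_prod]

variable {R : Type} [CommRing R] [Algebra ℂ R]

/-- The terms as matrices over a commutative `ℂ`-algebra. -/
noncomputable def chainTermR (R : Type) [CommRing R] [Algebra ℂ R] (L : ℕ) (x : Kind) (j : ℕ) :
    Matrix (Fin (L + 2) → Fin 2) (Fin (L + 2) → Fin 2) R :=
  (algebraMap ℂ R).mapMatrix (chainTerm L x j)

theorem TermRel.map {𝒜 ℬ : Type} [Ring 𝒜] [Ring ℬ] {u : Kind → ℕ → 𝒜} (h : TermRel u)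
    (f : 𝒜 →+* ℬ) : TermRel (fun x j => f (u x j)) where
  zero x := by rw [h.zero, map_zero]
  A1 := by rw [h.A1, map_zero]
  B1 := by rw [h.B1, map_zero]
  comm x y j d := by rw [← map_mul, h.comm, map_zsmul, map_mul]
  mulAB j := by rw [← map_mul, h.mulAB, map_neg, map_mul]

theorem chainTermR_rel (L : ℕ) : TermRel (chainTermR R L) := (chainTerm_rel L).map _

/-- The transfer matrix for couplings and spectral parameter in a commutative `ℂ`-algebra. -/
noncomputable def transferR (L : ℕ) (a b : ℕ → R) (v : R) :
    Matrix (Fin (L + 2) → Fin 2) (Fin (L + 2) → Fin 2) R :=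
  sT (chainTermR R L) a b v (L + 2)

theorem transferR_complex (L : ℕ) (a b : ℕ → ℂ) (v : ℂ) :
    transferR L a b v = sT (chainTerm L) a b v (L + 2) := rfl

theorem transferR_commute (L : ℕ) (a b : ℕ → R) (v w : R) :
    Commute (transferR L a b v) (transferR L a b w) :=
  sT_commute (chainTermR_rel L) a b v w _

theorem transferR_zero (L : ℕ) (a b : ℕ → R) : transferR L a b 0 = 1 := by
  refine Eq.trans ?_ (fam_zero_coupling L).1
  refine (fam_congr L (fun x j _ => ?_) L le_rfl).1
  simp [term]

theorem transferR_map {S : Type} [CommRing S] [Algebra ℂ S] (f : R →+* S)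
    (hf : ∀ z, f (algebraMap ℂ R z) = algebraMap ℂ S z) (L : ℕ) (a b : ℕ → R) (v : R) :
    f.mapMatrix (transferR L a b v) = transferR L (fun j => f (a j)) (fun j => f (b j)) (f v) := by
  refine (map_fam (𝒜 := Matrix (Fin (L + 2) → Fin 2) (Fin (L + 2) → Fin 2) R)
    (ℬ := Matrix (Fin (L + 2) → Fin 2) (Fin (L + 2) → Fin 2) S) f.mapMatrix _ L).1.trans
    ((fam_congr L (fun x j _ => ?_) L le_rfl).1)
  ext s s'
  simp only [term, chainTermR, RingHom.mapMatrix_apply, Matrix.map_apply, Matrix.smul_apply,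
    smul_eq_mul, map_mul, hf, map_couplingR]

theorem transferR_mul_neg (L : ℕ) (a b : ℕ → R) (v : R) :
    transferR L a b v * transferR L a b (-v) =
      algebraMap R _ ((polyR L a b).eval (v ^ 2)) := by
  classical
  have h2 : IsUnit (2 : R) := by
    have := (isUnit_iff_ne_zero.2 (two_ne_zero (α := ℂ))).map (algebraMap ℂ R)
    rwa [map_ofNat] at this
  let e : Kind → ℕ → R := fun x j => if IsTerm L x j then 1 else 0
  have he : LowZero e := by
    constructor <;> simp [e, IsTerm]
  have hu : ∀ x j, chainTermR R L x j * chainTermR R L x j = algebraMap R _ (e x j) := by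
    intro x j
    by_cases h : IsTerm L x j
    · simp only [chainTermR, ← map_mul, chainTerm_mul_self h, e, if_pos h, map_one]
    · simp only [chainTermR, chainTerm_of_not h, map_zero, mul_zero, e, if_neg h]
  refine (sT_mul_sT_neg (chainTermR_rel L) h2 he hu a b v (L + 2)).1.trans ?_
  congr 1
  have h3 := (map_fam (evalRingHom (v ^ 2)) (fun x j => X * C (couplingR a b x j ^ 2)) L).1
  rw [coe_evalRingHom] at h3
  rw [polyR, h3]
  refine (fam_congr L (fun x j hT => ?_) L le_rfl).1
  simp [e, hT]

-- Eigenvalues over an algebraically closed field.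

section AlgClosed

variable {K : Type} [Field K] [IsAlgClosed K] [Algebra ℂ K]

/-- An eigenvector of T(v) can be chosen as a joint eigenvector of all T(w). The eigenvalue as a
function of w is a polynomial, equal to 1 at 0, and subject to q(w)q(-w) = P(w²), which determines
it up to signs. -/
theorem exists_sign_of_isRoot_charpoly (L : ℕ) (a b : ℕ → K) {N : ℕ} {ε : Fin N → K}
    (hε : polyR L a b = rootProd (fun k => ε k ^ 2)) (v : K) {μ : K}
    (hμ : (transferR L a b v).charpoly.IsRoot μ) : ∃ s, μ = (signPoly ε s).eval v := by
  classical
  have : Infinite K := IsAlgClosed.instInfinite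
  have hev : Module.End.HasEigenvalue (Matrix.toLin' (transferR L a b v)) μ := by
    rwa [Module.End.hasEigenvalue_iff_isRoot_charpoly, Matrix.charpoly_toLin']
  obtain ⟨x, χ, hx0, hχ, hχv⟩ := exists_joint_eigenvector
    (fun w : K => Matrix.toLin' (transferR L a b w))
    (fun w w' => by
      have := (transferR_commute L a b w w').eq
      rw [Commute, SemiconjBy, Module.End.mul_eq_comp, Module.End.mul_eq_comp,
        ← Matrix.toLin'_mul, ← Matrix.toLin'_mul, this]) hev
  simp only [Matrix.toLin'_apply] at hχ
  obtain ⟨i, hi⟩ := Function.ne_iff.1 hx0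
  -- Where x i is nonzero, the eigenvalue is the i-th entry of T(w)x divided by x i, which is
  -- visibly polynomial in w.
  let q : K[X] := C (x i)⁻¹ *
    ∑ j, transferR L (fun j => C (a j)) (fun j => C (b j)) (X : K[X]) i j * C (x j)
  have hq : ∀ w, q.eval w = χ w := fun w => by
    have h1 := transferR_map (evalRingHom w) (fun z => by
      rw [coe_evalRingHom, IsScalarTower.algebraMap_apply ℂ K K[X], algebraMap_eq, eval_C]) L
      (fun j => C (a j)) (fun j => C (b j)) X
    simp only [coe_evalRingHom, eval_C, eval_X] at h1
    have h2 := congrFun (hχ w) i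
    rw [← h1] at h2
    simp only [Matrix.mulVec, dotProduct, RingHom.mapMatrix_apply, Matrix.map_apply,
      coe_evalRingHom, Pi.smul_apply, smul_eq_mul] at h2
    simp only [q, eval_mul, eval_C, eval_finsetSum]
    rw [h2]
    have hi' : x i ≠ 0 := hi
    field_simp
  have hinj : Function.Injective fun c : K => c • x := smul_left_injective K hx0
  have hq0 : q.coeff 0 = 1 := by
    rw [coeff_zero_eq_eval_zero, hq]
    refine hinj ?_
    change χ 0 • x = (1 : K) • x
    rw [← hχ, transferR_zero, Matrix.one_mulVec, one_smul]
  have hqq : q * q.comp (-X) = (rootProd (fun k => ε k ^ 2)).comp (X ^ 2) := by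
    refine Polynomial.funext fun w => ?_
    rw [eval_mul, eval_comp, eval_comp, eval_neg, eval_X, eval_pow, eval_X, hq, hq, ← hε]
    refine hinj ?_
    change (χ w * χ (-w)) • x = _ • x
    rw [mul_comm, mul_smul, ← hχ, ← Matrix.mulVec_smul, ← hχ, Matrix.mulVec_mulVec]
    rw [transferR_mul_neg, Algebra.algebraMap_eq_smul_one, Matrix.smul_mulVec, Matrix.one_mulVec]
  obtain ⟨s, hs⟩ := exists_signPoly ε q hq0 hqq
  exact ⟨s, by rw [← hs, hq, hχv]⟩

theorem exists_multiset_charpoly (L : ℕ) (a b : ℕ → K) {N : ℕ} {ε : Fin N → K}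
    (hε : polyR L a b = rootProd (fun k => ε k ^ 2)) (v : K) :
    ∃ S : Multiset (Fin N → ℤˣ), (transferR L a b v).charpoly =
      (S.map fun s => X - C ((signPoly ε s).eval v)).prod := by
  classical
  have h := fun (μ : K) (hμ : (transferR L a b v).charpoly.IsRoot μ) =>
    exists_sign_of_isRoot_charpoly L a b hε v hμ
  choose! g hg using h
  refine ⟨(transferR L a b v).charpoly.roots.map g, ?_⟩
  have h1 := (IsAlgClosed.splits (transferR L a b v).charpoly).eq_prod_roots_of_monic
    (Matrix.charpoly_monic _)
  rw [Multiset.map_map]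
  nth_rw 1 [h1]
  congr 1
  refine Multiset.map_congr rfl fun μ hμ => ?_
  rw [Function.comp_apply, ← hg μ (isRoot_of_mem_roots hμ)]

end AlgClosed

/-- The polynomials for all the choices of signs depend only on the squares. -/
theorem exists_equiv_signPoly {N : ℕ} {ε ε' : Fin N → ℂ}
    (h : rootProd (fun k => ε k ^ 2) = rootProd (fun k => ε' k ^ 2)) :
    ∃ π : (Fin N → ℤˣ) ≃ (Fin N → ℤˣ), ∀ s, signPoly ε s = signPoly ε' (π s) := by
  obtain ⟨σ, hσ⟩ := exists_perm_of_rootProd_eq h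
  have hr : ∀ k, ∃ r : ℤˣ, ε k = ((r : ℤ) : ℂ) * ε' (σ k) := fun k => by
    rcases sq_eq_sq_iff_eq_or_eq_neg.1 (hσ k) with e | e
    · exact ⟨1, by simp [e]⟩
    · exact ⟨-1, by simp [e]⟩
  choose r hr using hr
  refine ⟨(Equiv.mulRight r).trans (Equiv.arrowCongr σ (Equiv.refl _)), fun s => ?_⟩
  refine (Finset.prod_congr rfl fun k _ => ?_).trans (Equiv.prod_comp σ fun k =>
    1 + C ((((s (σ.symm k) * r (σ.symm k) : ℤˣ) : ℤ) : ℂ) * ε' k) * X)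
  rw [hr, Equiv.symm_apply_apply]
  simp [mul_assoc]

theorem map_charpoly_transferR {S : Type} [CommRing S] [Algebra ℂ S] (f : R →+* S)
    (hf : ∀ z, f (algebraMap ℂ R z) = algebraMap ℂ S z) (L : ℕ) (a b : ℕ → R) (v : R) :
    (transferR L a b v).charpoly.map f =
      (transferR L (fun j => f (a j)) (fun j => f (b j)) (f v)).charpoly := by
  rw [← Matrix.charpoly_map, ← RingHom.mapMatrix_apply, transferR_map f hf]

theorem map_prod_signPoly {R S : Type} [CommRing R] [CommRing S] (f : R →+* S) {N : ℕ}
    (ε : Fin N → R) (v : R) (U : Multiset (Fin N → ℤˣ)) :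
    (U.map fun s => X - C ((signPoly ε s).eval v)).prod.map f =
      (U.map fun s => X - C ((signPoly (fun k => f (ε k)) s).eval (f v))).prod := by
  rw [Polynomial.map_multiset_prod, Multiset.map_map]
  congr 1
  refine Multiset.map_congr rfl fun s _ => ?_
  rw [Function.comp_apply, Polynomial.map_sub, map_X, Polynomial.map_C, ← signPoly_map,
    eval_map_apply]

/-- Along a curve of couplings the multiplicities are constant. -/
theorem exists_multiset_charpoly_curve (K : Type) [Field K] [IsAlgClosed K] [Algebra ℂ K]
    [Algebra ℂ[X] K] [IsScalarTower ℂ ℂ[X] K] [FaithfulSMul ℂ[X] K] (L : ℕ) (a b : ℕ → ℂ[X])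
    (v : ℂ) :
    ∃ U : Multiset (Fin ((L + 1) / 2) → ℤˣ), ∀ τ : ℂ, ∃ ε : Fin ((L + 1) / 2) → ℂ,
      polyR L (fun j => (a j).eval τ) (fun j => (b j).eval τ) = rootProd (fun k => ε k ^ 2) ∧
      (transferR L (fun j => (a j).eval τ) (fun j => (b j).eval τ) v).charpoly =
        (U.map fun s => X - C ((signPoly ε s).eval v)).prod := by
  have hinj : Function.Injective (algebraMap (integralClosure ℂ[X] K) K) :=
    FaithfulSMul.algebraMap_injective _ K
  have hmapK : ∀ p : ℂ[X], algebraMap (integralClosure ℂ[X] K) K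
      (algebraMap ℂ[X] (integralClosure ℂ[X] K) p) = algebraMap ℂ[X] K p := fun p => rfl
  have hcK : ∀ z : ℂ, algebraMap (integralClosure ℂ[X] K) K
      (algebraMap ℂ (integralClosure ℂ[X] K) z) = algebraMap ℂ K z := fun z => rfl
  obtain ⟨εK, hεK⟩ := exists_rootProd ((L + 1) / 2)
    (polyR L (fun j => algebraMap ℂ[X] K (a j)) (fun j => algebraMap ℂ[X] K (b j)))
    (polyR_coeff_zero L _ _) (polyR_natDegree_le L _ _)
  obtain ⟨ε, hε⟩ : ∃ ε : Fin ((L + 1) / 2) → integralClosure ℂ[X] K,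
      ∀ k, algebraMap (integralClosure ℂ[X] K) K (ε k) = εK k :=
    ⟨fun k => ⟨εK k, isIntegral_of_rootProd (polyR_coeff_zero L a b) (polyR_natDegree_le L a b)
      (by rw [polyR_map, hεK]) k⟩, fun k => rfl⟩
  obtain ⟨U, hU⟩ := exists_multiset_charpoly L _ _ hεK (algebraMap ℂ K v)
  have hP : polyR L (fun j => algebraMap ℂ[X] (integralClosure ℂ[X] K) (a j))
      (fun j => algebraMap ℂ[X] (integralClosure ℂ[X] K) (b j)) =
      rootProd (fun k => ε k ^ 2) := by
    refine Polynomial.map_injective _ hinj ?_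
    rw [polyR_map, rootProd_map]
    simp only [hmapK, map_pow, hε, hεK]
  have hT : (transferR L (fun j => algebraMap ℂ[X] (integralClosure ℂ[X] K) (a j))
      (fun j => algebraMap ℂ[X] (integralClosure ℂ[X] K) (b j))
      (algebraMap ℂ (integralClosure ℂ[X] K) v)).charpoly =
      (U.map fun s => X - C ((signPoly ε s).eval (algebraMap ℂ (integralClosure ℂ[X] K) v))).prod := by
    refine Polynomial.map_injective _ hinj ?_
    rw [map_charpoly_transferR _ hcK, map_prod_signPoly]
    simp only [hmapK, hcK, hε, hU]
  refine ⟨U, fun τ => ?_⟩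
  obtain ⟨f, hf, hev⟩ : ∃ f : integralClosure ℂ[X] K →+* ℂ,
      (∀ z, f (algebraMap ℂ (integralClosure ℂ[X] K) z) = algebraMap ℂ ℂ z) ∧
      ∀ p, f (algebraMap ℂ[X] (integralClosure ℂ[X] K) p) = p.eval τ := by
    obtain ⟨ψ, hψ⟩ := exists_algHom_integralClosure K τ
    exact ⟨ψ, ψ.commutes, hψ⟩
  refine ⟨fun k => f (ε k), ?_, ?_⟩
  · have h1 := congrArg (Polynomial.map f) hP
    rw [polyR_map, rootProd_map] at h1
    simpa only [hev, map_pow] using h1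
  · have h1 := congrArg (Polynomial.map f) hT
    rw [map_charpoly_transferR f hf, map_prod_signPoly] at h1
    simpa only [hev, hf, Algebra.algebraMap_self, RingHom.id_apply] using h1

/-- The multiset of sign choices is constant along the line of couplings. At the decoupled end,
where all the values are distinct, it can be recovered from the roots, and there it contains every
choice d times. -/
theorem charpoly_transferR_of_ne_zero (L : ℕ) (a b : ℕ → ℂ) {v : ℂ} (hv : v ≠ 0)
    {ε : Fin ((L + 1) / 2) → ℂ} (hε : polyR L a b = rootProd (fun k => ε k ^ 2)) :
    ∃ d : ℕ, (transferR L a b v).charpoly = ∏ s, (X - C ((signPoly ε s).eval v)) ^ d := by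
  classical
  obtain ⟨e, he⟩ := exists_signPoly_eval_injective ((L + 1) / 2) hv
  obtain ⟨a₀, b₀, hP₀, d, hd⟩ := exists_charpoly_decoupled L e v
  refine ⟨d, ?_⟩
  -- The line from the decoupled couplings at parameter 0 to the given ones at parameter 1.
  let aτ : ℕ → ℂ[X] := fun j => C (a₀ j) + X * C (a j - a₀ j)
  let bτ : ℕ → ℂ[X] := fun j => C (b₀ j) + X * C (b j - b₀ j)
  have : FaithfulSMul ℂ[X] (AlgebraicClosure (FractionRing ℂ[X])) :=
    FaithfulSMul.trans ℂ[X] (FractionRing ℂ[X]) _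
  obtain ⟨S, spec⟩ := exists_multiset_charpoly_curve (AlgebraicClosure (FractionRing ℂ[X])) L aτ bτ v
  obtain ⟨ε₀, hε₀, hS₀⟩ := spec 0
  obtain ⟨ε₁, hε₁, hS₁⟩ := spec 1
  have ha0 : ∀ j, (aτ j).eval 0 = a₀ j := fun j => by simp [aτ]
  have hb0 : ∀ j, (bτ j).eval 0 = b₀ j := fun j => by simp [bτ]
  have ha1 : ∀ j, (aτ j).eval 1 = a j := fun j => by simp [aτ]
  have hb1 : ∀ j, (bτ j).eval 1 = b j := fun j => by simp [bτ]
  simp only [ha0, hb0] at hε₀ hS₀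
  simp only [ha1, hb1] at hε₁ hS₁
  obtain ⟨π₀, hπ₀⟩ := exists_equiv_signPoly (hε₀.symm.trans hP₀)
  obtain ⟨π₁, hπ₁⟩ := exists_equiv_signPoly (hε₁.symm.trans hε)
  have hinj₀ : Function.Injective fun s => (signPoly ε₀ s).eval v := by
    intro s s' h
    simp only [hπ₀] at h
    exact π₀.injective (he h)
  have hprod : ∀ (F : (Fin ((L + 1) / 2) → ℤˣ) → ℂ[X]),
      ((d • Finset.univ.val).map F).prod = ∏ s, F s ^ d := fun F => by
    rw [Multiset.map_nsmul, Multiset.prod_nsmul, Finset.prod_pow]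
    rfl
  have hSd : S = d • Finset.univ.val := by
    refine Multiset.map_injective hinj₀ ?_
    rw [← roots_multiset_prod_X_sub_C (S.map _),
      ← roots_multiset_prod_X_sub_C ((d • Finset.univ.val).map _), Multiset.map_map,
      Multiset.map_map]
    have e1 := hS₀.symm.trans hd
    rw [← Equiv.prod_comp π₀] at e1
    simp only [← hπ₀] at e1
    rw [← hprod fun s => X - C ((signPoly ε₀ s).eval v)] at e1
    exact congrArg roots e1
  rw [hS₁, hSd, hprod, ← Equiv.prod_comp π₁ fun s => (X - C ((signPoly ε s).eval v)) ^ d]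
  simp only [hπ₁]

/-- The characteristic polynomial of the transfer matrix. -/
theorem exists_charpoly_transferR (L : ℕ) (a b : ℕ → ℂ) (v : ℂ)
    {ε : Fin ((L + 1) / 2) → ℂ} (hε : polyR L a b = rootProd (fun k => ε k ^ 2)) :
    ∃ d : ℕ, d ≠ 0 ∧
      (transferR L a b v).charpoly = ∏ s, (X - C ((signPoly ε s).eval v)) ^ d := by
  classical
  by_cases hv : v = 0
  -- T(0) is the identity in dimension 2^(L+2), distributed evenly over 2^((L+1)/2) choices of
  -- signs.
  · refine ⟨2 ^ (L + 2 - (L + 1) / 2), by positivity, ?_⟩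
    have h1 : ∀ s, (signPoly ε s).eval 0 = 1 := fun s => by simp [signPoly, eval_prod]
    subst hv
    rw [transferR_zero, Matrix.charpoly_one]
    simp only [h1, Finset.prod_const, C_1, ← pow_mul, Finset.card_univ, Fintype.card_fun,
      Fintype.card_fin, Fintype.card_units_int, ← pow_add]
    congr 2
    omega
  · obtain ⟨d, hd⟩ := charpoly_transferR_of_ne_zero L a b hv hε
    refine ⟨d, ?_, hd⟩
    rintro rfl
    have := congrArg natDegree hd
    rw [Matrix.charpoly_natDegree_eq_dim] at this
    simp at this

end Spectrum

/-! ### Spectrum of the circuit -/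

section Circuit

open Polynomial

theorem signPoly_eval {N : ℕ} {R : Type} [CommRing R] (ε : Fin N → R) (s : Fin N → ℤˣ) (v : R) :
    (signPoly ε s).eval v = ∏ k, (1 + ((s k : ℤ) : R) * ε k * v) := by
  simp [signPoly, eval_prod]

/-- The sign at a vanishing ε does not affect the value, so every added zero doubles the
multiplicities. -/
theorem prod_signPoly_append {n m : ℕ} (ε : Fin n → ℂ) (v : ℂ) (d : ℕ) :
    ∏ s, (X - C ((signPoly (Fin.append ε (fun _ : Fin m => 0)) s).eval v)) ^ d =
      ∏ s, (X - C ((signPoly ε s).eval v)) ^ (d * 2 ^ m) := by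
  rw [← Equiv.prod_comp (Fin.appendEquiv n m), Fintype.prod_prod_type]
  refine Finset.prod_congr rfl fun s _ => ?_
  have h : ∀ s' : Fin m → ℤˣ, (signPoly (Fin.append ε (fun _ : Fin m => 0))
      (Fin.appendEquiv n m (s, s'))).eval v = (signPoly ε s).eval v := fun s' => by
    rw [signPoly_eval, signPoly_eval, Fin.prod_univ_add]
    simp [Fin.appendEquiv]
  simp only [h, Finset.prod_const, Finset.card_univ, Fintype.card_fun, Fintype.card_units_int,
    Fintype.card_fin, pow_mul]

theorem exists_charpoly_transferR_of_le (L : ℕ) (a b : ℕ → ℂ) (v : ℂ) {n : ℕ}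
    (hn : n ≤ (L + 1) / 2) {ε : Fin n → ℂ} (hε : polyR L a b = rootProd (fun k => ε k ^ 2)) :
    ∃ d : ℕ, d ≠ 0 ∧
      (transferR L a b v).charpoly = ∏ s, (X - C ((signPoly ε s).eval v)) ^ d := by
  -- Generalizing the number of factors avoids transporting ε along the equation n + m = (L + 1) /
  -- 2.
  have key : ∀ N (_ : N = (L + 1) / 2) (ε : Fin N → ℂ),
      polyR L a b = rootProd (fun k => ε k ^ 2) → ∃ d : ℕ, d ≠ 0 ∧
        (transferR L a b v).charpoly = ∏ s, (X - C ((signPoly ε s).eval v)) ^ d := by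
    rintro N rfl ε hε
    exact exists_charpoly_transferR L a b v hε
  obtain ⟨m, hm⟩ := Nat.exists_eq_add_of_le hn
  obtain ⟨d, hd, h⟩ := key (n + m) hm.symm (Fin.append ε (fun _ => 0)) (by
    rw [hε, rootProd, rootProd, Fin.prod_univ_add]
    simp)
  exact ⟨d * 2 ^ m, by positivity, by rw [h, prod_signPoly_append]⟩

-- Unitary and normal matrices.

section Unitary

variable {ι : Type} [Fintype ι]

open scoped Matrix.Norms.L2Operator in
theorem norm_eq_one_of_mem_spectrum [DecidableEq ι] {V : Matrix ι ι ℂ} (hV : V ∈ Matrix.unitaryGroup ι ℂ) {z : ℂ}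
    (hz : z ∈ spectrum ℂ V) : ‖z‖ = 1 :=
  spectrum.norm_eq_one_of_unitary hV hz

open Matrix ComplexOrder in
theorem mulVec_eq_zero_of_mulVec_mulVec {M : Matrix ι ι ℂ} (hM : Mᴴ * M = M * Mᴴ) {x : ι → ℂ}
    (hx : M *ᵥ (M *ᵥ x) = 0) : M *ᵥ x = 0 := by
  rw [← conjTranspose_mul_self_mulVec_eq_zero, hM, self_mul_conjTranspose_mulVec_eq_zero,
    mulVec_mulVec, conjTranspose_mul_self_mulVec_eq_zero] at hx
  exact hx

open Matrix in
-- A normal matrix has no generalized eigenvectors besides the eigenvectors, so geometric and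
-- algebraic multiplicities agree.
theorem finrank_eigenspace_eq_rootMultiplicity [DecidableEq ι] {T : Matrix ι ι ℂ} (hT : Tᴴ * T = T * Tᴴ) (z : ℂ) :
    Module.finrank ℂ (Module.End.eigenspace (Matrix.toLin' T) z) =
      T.charpoly.rootMultiplicity z := by
  have hM : (T - z • 1)ᴴ * (T - z • 1) = (T - z • 1) * (T - z • 1)ᴴ := by
    simp only [conjTranspose_sub, conjTranspose_smul, conjTranspose_one, sub_mul, mul_sub, hT,
      smul_mul_assoc, mul_smul_comm, one_mul, mul_one]
    module
  have happ : ∀ x, (Matrix.toLin' T - z • (1 : Module.End ℂ (ι → ℂ))) x = (T - z • 1) *ᵥ x :=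
    fun x => by
      rw [LinearMap.sub_apply, Matrix.toLin'_apply, LinearMap.smul_apply, Module.End.one_apply,
        Matrix.sub_mulVec, Matrix.smul_mulVec, Matrix.one_mulVec]
  have hker : ∀ k x, ((Matrix.toLin' T - z • (1 : Module.End ℂ (ι → ℂ))) ^ (k + 1)) x = 0 →
      (T - z • 1) *ᵥ x = 0 := by
    intro k
    induction k with
    | zero =>
      intro x hx
      rwa [zero_add, pow_one, happ] at hx
    | succ k ih =>
      intro x hx
      rw [pow_succ, Module.End.mul_apply, happ] at hx
      exact mulVec_eq_zero_of_mulVec_mulVec hM (ih _ hx)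
  have h : Module.End.eigenspace (Matrix.toLin' T) z =
      Module.End.maxGenEigenspace (Matrix.toLin' T) z := by
    refine le_antisymm ((Module.End.genEigenspace _ z).monotone le_top) fun x hx => ?_
    obtain ⟨k, hk⟩ := (Module.End.mem_maxGenEigenspace _ _ _).1 hx
    have h1 := hker k x (by rw [pow_succ', Module.End.mul_apply, hk, map_zero])
    rw [Matrix.sub_mulVec, Matrix.smul_mulVec, Matrix.one_mulVec, sub_eq_zero] at h1
    exact Module.End.mem_eigenspace_iff.2 h1
  rw [h, LinearMap.finrank_maxGenEigenspace_eq, Matrix.charpoly_toLin']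

theorem eigenspace_smul [DecidableEq ι] {V : Matrix ι ι ℂ} {ρ : ℂ} (hρ : ρ ≠ 0) (z : ℂ) :
    Module.End.eigenspace (Matrix.toLin' V) z =
      Module.End.eigenspace (Matrix.toLin' (ρ • V)) (ρ * z) := by
  ext x
  rw [Module.End.mem_eigenspace_iff, Module.End.mem_eigenspace_iff, Matrix.toLin'_apply,
    Matrix.toLin'_apply, Matrix.smul_mulVec, mul_smul]
  exact (smul_right_injective _ hρ).eq_iff.symm

end Unitary

/-- Two choices of signs differing only at k share all other factors, and these are nonzero because
ρ is. -/
theorem norm_eq_of_norm_prod_eq {N : ℕ} {ε : Fin N → ℂ} {v : ℂ} {ρ : ℝ} (hρ : 0 < ρ)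
    (h : ∀ s, ‖(signPoly ε s).eval v‖ = ρ) (k : Fin N) : ‖1 + ε k * v‖ = ‖1 - ε k * v‖ := by
  have h1 := h (fun _ => 1)
  have h2 := h (Function.update (fun _ => 1) k (-1))
  rw [signPoly_eval, ← Finset.mul_prod_erase _ _ (Finset.mem_univ k), norm_mul] at h1 h2
  have h3 : ∏ j ∈ Finset.univ.erase k,
      (1 + ((Function.update (fun _ => (1 : ℤˣ)) k (-1) j : ℤ) : ℂ) * ε j * v) =
      ∏ j ∈ Finset.univ.erase k, (1 + (((1 : ℤˣ) : ℤ) : ℂ) * ε j * v) :=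
    Finset.prod_congr rfl fun j hj => by
      rw [Function.update_of_ne (Finset.ne_of_mem_erase hj)]
  rw [h3, ← h1] at h2
  have h4 : ‖∏ j ∈ Finset.univ.erase k, (1 + (((1 : ℤˣ) : ℤ) : ℂ) * ε j * v)‖ ≠ 0 := fun h0 => by
    rw [h0, mul_zero] at h1
    exact hρ.ne h1
  have h5 := mul_right_cancel₀ h4 h2
  simp only [Function.update_self, Units.val_neg, Units.val_one, Int.cast_neg, Int.cast_one,
    one_mul, neg_mul] at h5
  rw [← h5, sub_eq_add_neg]

theorem im_eq_zero_of_norm_eq {z : ℂ} (h : ‖1 + z * Complex.I‖ = ‖1 - z * Complex.I‖) :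
    z.im = 0 := by
  have h1 : Complex.normSq (1 + z * Complex.I) = Complex.normSq (1 - z * Complex.I) := by
    rw [Complex.normSq_eq_norm_sq, Complex.normSq_eq_norm_sq, h]
  simp [Complex.normSq_apply] at h1
  linarith

/-- The positive constant in front of the circuit. -/
noncomputable def coshProd (L : ℕ) (θ : Kind → ℕ → ℝ) : ℝ :=
  Real.cosh (θ .C 1) * ∏ j ∈ Finset.Icc 2 L,
    (Real.cosh (θ .A j) * Real.cosh (θ .B j) * Real.cosh (θ .C j))

theorem coshProd_pos (L : ℕ) (θ : Kind → ℕ → ℝ) : 0 < coshProd L θ :=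
  mul_pos (Real.cosh_pos _) (Finset.prod_pos fun _ _ =>
    mul_pos (mul_pos (Real.cosh_pos _) (Real.cosh_pos _)) (Real.cosh_pos _))

variable {L : ℕ} {a b : ℕ → ℝ} {y : ℝ} {θ : Kind → ℕ → ℝ}

theorem HyperbolicRecursion.transferR_eq (hL : 1 ≤ L) (h : HyperbolicRecursion L a b y θ) :
    transferR L (fun j => (a j : ℂ)) (fun j => (b j : ℂ)) (Complex.I * y) =
      (coshProd L θ : ℂ) • circuit L (circuitAngle θ) := by
  rw [transferR_complex, ← transferMatrix_eq_sT, h.transferMatrix_eq_circuit hL, coshProd]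

open scoped Pointwise in
theorem HyperbolicRecursion.mem_spectrum_circuit (hL : 1 ≤ L) (h : HyperbolicRecursion L a b y θ)
    (z : ℂ) : z ∈ spectrum ℂ (circuit L (circuitAngle θ)) ↔
      (transferR L (fun j => (a j : ℂ)) (fun j => (b j : ℂ)) (Complex.I * y)).charpoly.IsRoot
        ((coshProd L θ : ℂ) * z) := by
  have hρ : (coshProd L θ : ℂ) ≠ 0 := by exact_mod_cast (coshProd_pos L θ).ne'
  rw [← Matrix.mem_spectrum_iff_isRoot_charpoly, h.transferR_eq hL]
  have := spectrum.unit_smul_eq_smul (R := ℂ) (circuit L (circuitAngle θ)) (Units.mk0 _ hρ)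
  rw [Units.smul_mk0, Units.smul_mk0] at this
  rw [this, ← smul_eq_mul, Set.smul_mem_smul_set_iff₀ hρ]

theorem HyperbolicRecursion.norm_signPoly (hL : 1 ≤ L) (h : HyperbolicRecursion L a b y θ) {n : ℕ}
    {ε : Fin n → ℂ} {d : ℕ} (hd : d ≠ 0)
    (hε : (transferR L (fun j => (a j : ℂ)) (fun j => (b j : ℂ)) (Complex.I * y)).charpoly =
      ∏ s, (X - C ((signPoly ε s).eval (Complex.I * y))) ^ d) (s : Fin n → ℤˣ) :
    ‖(signPoly ε s).eval (Complex.I * y)‖ = coshProd L θ := by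
  have hρ := coshProd_pos L θ
  have hρ' : (coshProd L θ : ℂ) ≠ 0 := by exact_mod_cast hρ.ne'
  have h1 : (signPoly ε s).eval (Complex.I * y) / coshProd L θ ∈
      spectrum ℂ (circuit L (circuitAngle θ)) := by
    rw [h.mem_spectrum_circuit hL, mul_div_cancel₀ _ hρ', hε, IsRoot, eval_prod]
    refine Finset.prod_eq_zero (Finset.mem_univ s) ?_
    simp [hd]
  have h2 := norm_eq_one_of_mem_spectrum (circuit_mem_unitaryGroup _) h1
  rw [norm_div, Complex.norm_real, Real.norm_of_nonneg hρ.le, div_eq_one_iff_eq hρ.ne'] at h2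
  exact h2

/-- Reality of the ε_k is a consequence of unitarity: the eigenvalues of V have modulus 1, so at y =
1 flipping a single sign preserves the modulus of the product, and |1 + iε_k| = |1 - iε_k| means
that ε_k is real. -/
theorem exists_real_rootProd (hL : 1 ≤ L) (a b : ℕ → ℝ) :
    ∃ ε : Fin ((L + 1) / 2) → ℝ, polyP L a b = rootProd (fun k => ε k ^ 2) := by
  obtain ⟨ε, hε⟩ := exists_rootProd ((L + 1) / 2)
    (polyR L (fun j => (a j : ℂ)) (fun j => (b j : ℂ)))
    (polyR_coeff_zero L _ _) (polyR_natDegree_le L _ _)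
  obtain ⟨θ, hθ⟩ := exists_hyperbolicRecursion a b 1 L
  obtain ⟨d, hd, hchar⟩ := exists_charpoly_transferR L _ _ (Complex.I * (1 : ℝ)) hε
  have hnorm := hθ.norm_signPoly hL hd hchar
  have him : ∀ k, (ε k).im = 0 := fun k => im_eq_zero_of_norm_eq (by
    simpa using norm_eq_of_norm_prod_eq (coshProd_pos L θ) hnorm k)
  refine ⟨fun k => (ε k).re, ?_⟩
  refine Polynomial.map_injective (algebraMap ℝ ℂ) (algebraMap ℝ ℂ).injective ?_
  rw [polyP_map, hε, rootProd_map]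
  congr 1
  funext k
  rw [map_pow, Complex.coe_algebraMap, Complex.ext (z := ((ε k).re : ℂ)) (w := ε k) rfl
    (by simp [him])]

/-- Vanishing entries are dropped, which brings the number of factors down to the degree, and only
|ε_k| matters. -/
theorem exists_pos_rootProd {N : ℕ} (ε : Fin N → ℝ) : ∃ n, ∃ w : Fin n → ℝ, (∀ k, 0 < w k) ∧
    rootProd (fun k => ε k ^ 2) = rootProd (fun k => (1 / w k) ^ 2) := by
  induction N with
  | zero => exact ⟨0, fun _ => 1, fun _ => one_pos, by simp [rootProd]⟩
  | succ N ih =>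
    obtain ⟨n, w, hw, h⟩ := ih fun k => ε k.succ
    by_cases h0 : ε 0 = 0
    · exact ⟨n, w, hw, by rw [rootProd_succ, h, h0]; simp⟩
    · refine ⟨n + 1, Fin.cons (1 / |ε 0|) w, Fin.cases (by simpa using h0) (by simpa using hw), ?_⟩
      rw [rootProd_succ, h, rootProd_succ]
      simp

theorem roots_rootProd {n : ℕ} {w : Fin n → ℝ} (hw : ∀ k, 0 < w k) :
    (rootProd (fun k => (1 / w k) ^ 2)).roots = Finset.univ.val.map fun k => w k ^ 2 := by
  have h1 : rootProd (fun k => (1 / w k) ^ 2) =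
      C (∏ k, (-(1 / w k) ^ 2)) * (Finset.univ.val.map fun k => X - C (w k ^ 2)).prod := by
    rw [rootProd, map_prod]
    change _ = _ * ∏ k, (X - C (w k ^ 2))
    rw [← Finset.prod_mul_distrib]
    refine Finset.prod_congr rfl fun k _ => ?_
    have h2 : C ((1 / w k) ^ 2) * C (w k ^ 2) = (1 : ℝ[X]) := by
      rw [← C_mul, ← mul_pow, one_div_mul_cancel (hw k).ne', one_pow, C_1]
    rw [C_neg]
    linear_combination -h2
  have hne : ∏ k, (-(1 / w k) ^ 2) ≠ 0 := Finset.prod_ne_zero_iff.2 fun k _ =>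
    neg_ne_zero.2 (pow_ne_zero 2 (one_div_ne_zero (hw k).ne'))
  rw [h1, roots_C_mul _ hne]
  have := roots_multiset_prod_X_sub_C (Finset.univ.val.map fun k => w k ^ 2)
  rwa [Multiset.map_map] at this

theorem exists_pos_roots (hL : 1 ≤ L) (a b : ℕ → ℝ) :
    ∃ w : Fin (polyP L a b).natDegree → ℝ, (∀ k, 0 < w k) ∧
      polyP L a b = rootProd (fun k => (1 / w k) ^ 2) := by
  obtain ⟨ε, hε⟩ := exists_real_rootProd hL a b
  obtain ⟨n, w, hw, h⟩ := exists_pos_rootProd ε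
  have hn : (polyP L a b).natDegree = n := by
    rw [hε, h, natDegree_rootProd fun k => pow_ne_zero 2 (one_div_ne_zero (hw k).ne')]
  rw [hn]
  exact ⟨w, hw, hε.trans h⟩

theorem exp_sign_arctan (s : ℤˣ) (x : ℝ) :
    Complex.exp (Complex.I * (((s : ℤ) : ℝ) * Real.arctan x : ℝ)) =
      (1 + ((s : ℤ) : ℂ) * Complex.I * (x : ℂ)) / (Real.sqrt (1 + x ^ 2) : ℂ) := by
  have e : ((s : ℤ) : ℝ) * Real.arctan x = Real.arctan (((s : ℤ) : ℝ) * x) := by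
    rcases Int.units_eq_one_or s with rfl | rfl <;> simp [Real.arctan_neg]
  have e2 : (((s : ℤ) : ℝ) * x) ^ 2 = x ^ 2 := by
    rcases Int.units_eq_one_or s with rfl | rfl <;> simp
  rw [e, mul_comm, Complex.exp_mul_I, ← Complex.ofReal_cos, ← Complex.ofReal_sin, Real.cos_arctan,
    Real.sin_arctan, e2]
  push_cast
  ring

theorem HyperbolicRecursion.spectrum_circuit (hL : 1 ≤ L) (h : HyperbolicRecursion L a b y θ)
    {n : ℕ} (hn : n ≤ (L + 1) / 2) {w : Fin n → ℝ}
    (hw : polyP L a b = rootProd (fun k => (1 / w k) ^ 2)) :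
    spectrum ℂ (circuit L (circuitAngle θ)) = Set.range (fun s : Fin n → ℤˣ =>
      ∏ k, (1 + ((s k : ℤ) : ℂ) * Complex.I * ((y * (1 / w k) : ℝ) : ℂ)) /
        (Real.sqrt (1 + (y * (1 / w k)) ^ 2) : ℂ)) ∧
    IsFreeFermionic (circuit L (circuitAngle θ)) (fun k => Real.arctan (y * (1 / w k))) := by
  classical
  have hρ := coshProd_pos L θ
  have hρ' : (coshProd L θ : ℂ) ≠ 0 := by exact_mod_cast hρ.ne'
  have hP : polyR L (fun j => (a j : ℂ)) (fun j => (b j : ℂ)) =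
      rootProd (fun k => (((1 / w k : ℝ) : ℂ)) ^ 2) := by
    rw [← polyP_map, hw, rootProd_map]
    simp
  obtain ⟨d, hd, hchar⟩ := exists_charpoly_transferR_of_le L _ _ (Complex.I * y) hn hP
  set lam : (Fin n → ℤˣ) → ℂ :=
    fun s => (signPoly (fun k => ((1 / w k : ℝ) : ℂ)) s).eval (Complex.I * y) with hlam
  have hfac : ∀ s : Fin n → ℤˣ, lam s =
      ∏ k, (1 + ((s k : ℤ) : ℂ) * Complex.I * ((y * (1 / w k) : ℝ) : ℂ)) := fun s => by
    rw [hlam]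
    simp only [signPoly_eval]
    refine Finset.prod_congr rfl fun k _ => ?_
    push_cast
    ring
  -- The constant ρ is the common modulus of all the products, and for the choice of all plus signs
  -- this is ∏|1 + iyε_k|.
  have hsqrt : (coshProd L θ : ℂ) = ∏ k, (Real.sqrt (1 + (y * (1 / w k)) ^ 2) : ℂ) := by
    rw [← h.norm_signPoly hL hd hchar (fun _ => 1), ← Complex.ofReal_prod]
    congr 1
    change ‖lam fun _ => 1‖ = _
    rw [hfac, norm_prod]
    refine Finset.prod_congr rfl fun k _ => ?_
    rw [Units.val_one, Int.cast_one, one_mul, mul_comm, ← Complex.ofReal_one,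
      Complex.norm_add_mul_I, one_pow]
  have hval : ∀ s : Fin n → ℤˣ,
      ∏ k, (1 + ((s k : ℤ) : ℂ) * Complex.I * ((y * (1 / w k) : ℝ) : ℂ)) /
        (Real.sqrt (1 + (y * (1 / w k)) ^ 2) : ℂ) = lam s / coshProd L θ := fun s => by
    rw [Finset.prod_div_distrib, hfac, hsqrt]
  have hspec : spectrum ℂ (circuit L (circuitAngle θ)) =
      Set.range fun s => lam s / coshProd L θ := by
    ext z
    rw [h.mem_spectrum_circuit hL, hchar, IsRoot, eval_prod, Finset.prod_eq_zero_iff]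
    simp only [Finset.mem_univ, true_and, eval_pow, eval_sub, eval_X, eval_C, pow_eq_zero_iff hd,
      sub_eq_zero, Set.mem_range]
    refine exists_congr fun s => ?_
    rw [div_eq_iff hρ', mul_comm z, eq_comm]
  have hsign : signProd (fun k => Real.arctan (y * (1 / w k))) =
      fun s => lam s / coshProd L θ := by
    funext s
    rw [← hval, signProd]
    exact Finset.prod_congr rfl fun k _ => exp_sign_arctan _ _
  refine ⟨by simp only [hval, hspec], circuit_mem_unitaryGroup _, by rw [hsign, hspec],
    fun hinj => ⟨d, fun z hz => ?_⟩⟩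
  rw [hsign] at hinj
  rw [hspec] at hz
  obtain ⟨s₀, rfl⟩ := hz
  have hprod : (transferR L (fun j => (a j : ℂ)) (fun j => (b j : ℂ)) (Complex.I * y)).charpoly =
      (((d • (Finset.univ : Finset (Fin n → ℤˣ)).val).map lam).map fun z => X - C z).prod := by
    rw [hchar, Multiset.map_map, Multiset.map_nsmul, Multiset.prod_nsmul, Finset.prod_pow]
    rfl
  have hinj' : Function.Injective lam := fun s s' hs => hinj (by simp only [hs])
  have hnormal := circuit_mem_unitaryGroup (L := L) (circuitAngle θ)
  -- For injective values each root comes from a single choice of signs, so its multiplicity is d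
  -- throughout.
  rw [eigenspace_smul hρ', ← h.transferR_eq hL, finrank_eigenspace_eq_rootMultiplicity, hprod,
    mul_div_cancel₀ _ hρ', ← count_roots, roots_multiset_prod_X_sub_C,
    Multiset.count_map_eq_count' _ _ hinj', Multiset.count_nsmul]
  · simp
  · rw [h.transferR_eq hL, Matrix.conjTranspose_smul, smul_mul_assoc, mul_smul_comm,
      smul_mul_assoc, mul_smul_comm, ← Matrix.star_eq_conjTranspose,
      Matrix.mem_unitaryGroup_iff.1 hnormal, Matrix.mem_unitaryGroup_iff'.1 hnormal, smul_comm]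

end Circuit

end FFCircuit

open FFCircuit in
theorem mainTheorem3 (L : ℕ) (hL : 1 ≤ L) :
    -- for `v = i y` there are angles `i θ` with `θ` real, and they are unique
    (∀ (a b : ℕ → ℝ) (y : ℝ),
      (∃ θ : Kind → ℕ → ℝ,
        AngleRecursion L a b (Complex.I * y) (fun x j => Complex.I * θ x j)) ∧
      (∀ θ θ' : Kind → ℕ → ℝ,
        AngleRecursion L a b (Complex.I * y) (fun x j => Complex.I * θ x j) →
        AngleRecursion L a b (Complex.I * y) (fun x j => Complex.I * θ' x j) →
        ∀ x j, j ≤ L → θ x j = θ' x j)) ∧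
    (∀ (a b : ℕ → ℝ) (y : ℝ) (θ : Kind → ℕ → ℝ),
      AngleRecursion L a b (Complex.I * y) (fun x j => Complex.I * θ x j) →
      -- the factorized transfer matrix
      transferMatrix L a b (Complex.I * y) =
        stairG (gateG (L + 2) (fun x j => Complex.I * θ x j)) L *
          stairGT (gateG (L + 2) (fun x j => Complex.I * θ x j)) L ∧
      -- its gates are proportional to local unitary gates
      (∀ x j, IsTerm L x j →
        gateG (L + 2) (fun x j => Complex.I * θ x j) x j =
          (Real.cosh (θ x j / 2) : ℂ) • (1 : Op (L + 2)) +
            (Complex.I * (Real.sinh (θ x j / 2) : ℂ)) • t (L + 2) x j ∧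
        gateU (L + 2) (circuitAngle θ) x j =
          (1 / (Real.sqrt (Real.cosh (θ x j)) : ℂ)) •
            gateG (L + 2) (fun x j => Complex.I * θ x j) x j ∧
        gateU (L + 2) (circuitAngle θ) x j ∈ Matrix.unitaryGroup (Fin (L + 2) → Fin 2) ℂ ∧
        ActsOn (sites x j) (gateU (L + 2) (circuitAngle θ) x j)) ∧
      -- recursions and constraint for the angles
      HyperbolicRecursion L a b y θ ∧
      (∀ x j, Real.tan (circuitAngle θ x j) = Real.tanh (θ x j / 2) ∧
        |circuitAngle θ x j| < Real.pi / 4) ∧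
      CircuitRecursion L a b y (circuitAngle θ) ∧
      AngleConstraint L (circuitAngle θ) ∧
      -- the transfer matrix is proportional to the circuit
      transferMatrix L a b (Complex.I * y) =
        ((Real.cosh (θ .C 1) * ∏ j ∈ Finset.Icc 2 L,
          (Real.cosh (θ .A j) * Real.cosh (θ .B j) * Real.cosh (θ .C j)) : ℝ) : ℂ) •
            circuit L (circuitAngle θ) ∧
      -- spectrum of the circuit, in terms of the roots of `P_L`
      (polyP L a b).natDegree ≤ (L + 1) / 2 ∧
      ((∀ j, 1 ≤ j → j ≤ L → a j ≠ 0 ∧ b j ≠ 0) →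
        (polyP L a b).natDegree = (L + 1) / 2) ∧
      ∃ w : Fin (polyP L a b).natDegree → ℝ,
        (∀ k, 0 < w k) ∧
        (polyP L a b).roots = Finset.univ.val.map (fun k => w k ^ 2) ∧
        spectrum ℂ (circuit L (circuitAngle θ)) =
          Set.range (fun s : Fin (polyP L a b).natDegree → ℤˣ =>
            ∏ k, (1 + ((s k : ℤ) : ℂ) * Complex.I * ((y * (1 / w k) : ℝ) : ℂ)) /
              (Real.sqrt (1 + (y * (1 / w k)) ^ 2) : ℂ)) ∧
        IsFreeFermionic (circuit L (circuitAngle θ))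
          (fun k => Real.arctan (y * (1 / w k)))) ∧
    -- angles that satisfy the constraint come from some couplings
    (∀ (y : ℝ) (φ : Kind → ℕ → ℝ), y ≠ 0 → InitialZero φ →
      (∀ x j, j ≤ L → Real.cos (2 * φ x j) ≠ 0) →
      (∀ j, 1 ≤ j → j < L → Real.tan (2 * φ .C j) ≠ 0) →
      AngleConstraint L φ →
      ∃ a b : ℕ → ℝ,
        CircuitRecursion L a b y φ ∧
        ((∀ x j, j ≤ L → |φ x j| < Real.pi / 4) →
          ∃ θ : Kind → ℕ → ℝ,
            AngleRecursion L a b (Complex.I * y) (fun x j => Complex.I * θ x j) ∧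
            ∀ x j, j ≤ L → φ x j = circuitAngle θ x j)) := by
  refine ⟨fun a b y => ⟨?_, fun θ θ' h h' x j hj => ?_⟩, fun a b y θ hθ => ?_,
    fun y φ hy h0 hcos htan hcon => exists_couplings_of_angleConstraint hy h0 hcos htan hcon⟩
  · obtain ⟨θ, hθ⟩ := exists_hyperbolicRecursion a b y L
    exact ⟨θ, (angleRecursion_iff L a b y θ).2 hθ⟩
  · exact ((angleRecursion_iff L a b y θ).1 h).unique ((angleRecursion_iff L a b y θ').1 h') j x hj
  · have h := (angleRecursion_iff L a b y θ).1 hθ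
    obtain ⟨w, hw0, hw⟩ := exists_pos_roots hL a b
    obtain ⟨hspec, hfree⟩ := h.spectrum_circuit hL (polyP_natDegree_le L a b) hw
    exact ⟨h.transferMatrix_eq,
      fun x j hT => ⟨gateG_eq _ θ x j, gateU_circuitAngle hT, gateU_mem_unitaryGroup hT,
        actsOn_gateU hT⟩,
      h, fun x j => ⟨Real.tan_arctan _, abs_circuitAngle_lt θ x j⟩, h.circuitRecursion,
      h.angleConstraint, h.transferMatrix_eq_circuit hL, polyP_natDegree_le L a b,
      polyP_natDegree_eq, w, hw0, by rw [← roots_rootProd hw0, ← hw], hspec, hfree⟩
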